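/- Let $X=(X_1,\dots,X_d)$, $A=(A_1,\dots,A_d)$, $B=(B_1,\dots,B_d)$ be random vectors in $\mathbb R^d$ such that $X\stackrel{d}{=}\operatorname{diag}(A_1,\dots,A_d)X+B$ and $A$ is independent of $X$ ($B$ and $X$ may be dependent). Assume that for every $j$: (A0) the law of $\log|A_j|$ conditioned on $A_j\ne 0$ is non-arithmetic, i.e. not concentrated on $h\mathbb Z$ for any $h>0$; (A1) $\alpha_j>0$ satisfies $\mathbb E|A_j|^{\alpha_j}=1$; (A2) $\mathbb E|A_j|^{\alpha_j}\log^+|A_j|<\infty$, and $\mathbb E|B_j|^{\alpha_j+\sigma}<\infty$ for some $\sigma>0$. Let $I_1,\dots,I_p$ be the classes of the equivalence relation $i\sim j\iff |A_i|^{\alpha_i}=|A_j|^{\alpha_j}$ a.s. on $\{1,\dots,d\}$. Write $d_l=|I_l|$, $\mathbb R^{d_l}=\mathbb R^{I_l}$, $\mathbb R^d=\mathbb R^{d_1}\times\dots\times\mathbb R^{d_p}$ and $x^{(l)}=(x_i)_{i\in I_l}$. On $\mathbb R^d$ and on each block $\mathbb R^{d_l}$ let $|x|_\alpha=\max_i|x_i|^{\alpha_i}$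 and $\delta_t x=(t^{1/\alpha_i}x_i)_i$ for $t>0$ (over the coordinates in question), and let $S^{d-1}$, $S^{d_l-1}$ be the unit spheres $\{|x|_\alpha=1\}$. Let $\mathcal C(\mathbb R^d)$ be the set of bounded continuous $f:\mathbb R^d\to\mathbb R$ with $\operatorname{supp}f\subset\{|x|_\alpha\ge r\}$ for some $r>0$, and for such $f$ put $f_l(x)=f(0,\dots,0,x,0,\dots,0)$, with $x\in\mathbb R^{d_l}$ in the $l$-th block. Then there are Radon measures $\Lambda$ on $\mathbb R^d\setminus\{0\}$ and $\Lambda_l$ on $\mathbb R^{d_l}\setminus\{0\}$, and finite measures $\tilde\nu_l$ on $S^{d_l-1}$ ($l=1,\dots,p$), such that: 1. for every $f\in\mathcal C(\mathbb R^d)$, $f$ is $\Lambda$-integrable, each $f_l$ is $\Lambda_l$-integrable, and $$\lim_{t\to\infty}t\,\mathbb E f(\delta_{t^{-1}}X)=\sum_{l=1}^p\langle f_l,\Lambda_l\rangle=\langle f,\Lambda\rangle;$$ 2. for every $l$ the limit $c_l=\lim_{t\to\infty}t\,\mathbb P(|X^{(l)}|_\alpha>t)$ exists in $[0,\infty)$;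 3. for every $l$, $\tilde\nu_l(S^{d_l-1})=c_l$, and for every $f\in\mathcal C(\mathbb R^d)$ $$\langle f_l,\Lambda_l\rangle=\int_0^\infty\int_{S^{d_l-1}}f_l(\delta_s\omega)\,d\tilde\nu_l(\omega)\,\frac{ds}{s^2};$$ 4. $\lim_{t\to\infty}t\,\mathbb P(|X|_\alpha>t)=\sum_{l=1}^pc_l=:c_\infty$; 5. if $c_\infty>0$, then the measures $m_t(U)=\mathbb P\bigl(\delta_{|X|_\alpha^{-1}}X\in U\,\big|\,|X|_\alpha>t\bigr)$ on $S^{d-1}$ converge weakly, as $t\to\infty$, to a probability measure $\nu$, and, as measures on $\mathbb R^d$, $$\nu=c_\infty^{-1}\sum_{l=1}^p\delta_0^{(1)}\times\dots\times\delta_0^{(l-1)}\times\tilde\nu_l\times\delta_0^{(l+1)}\times\dots\times\delta_0^{(p)},$$ where $\delta_0^{(k)}$ is the Dirac measure at $0\in\mathbb R^{d_k}$. -/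

import Mathlib

open MeasureTheory ProbabilityTheory Filter Topology Set

noncomputable section

namespace DiagonalSRE

/-- A law on `ℝ` is arithmetic if it is carried by `hℤ` for some `h > 0`. -/
def IsArithmetic (μ : Measure ℝ) : Prop :=
  ∃ h : ℝ, 0 < h ∧ ∀ᵐ x ∂μ, x ∈ AddSubgroup.zmultiples h

/-- `|x|_α = max_i |x_i| ^ α_i`. -/
def anorm {ι : Type*} [Finite ι] (α : ι → ℝ) (x : ι → ℝ) : ℝ :=
  ⨆ i, |x i| ^ α i

/-- The dilations `δ_t x = (t ^ (1 / α_i) x_i)_i`. -/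
def dil {ι : Type*} (α : ι → ℝ) (t : ℝ) (x : ι → ℝ) : ι → ℝ :=
  fun i => t ^ (1 / α i) * x i

/-- The unit sphere of `|·|_α`. -/
def asphere {ι : Type*} [Finite ι] (α : ι → ℝ) : Set (ι → ℝ) :=
  {x | anorm α x = 1}

/-- Bounded continuous functions whose support stays away from the origin. -/
structure IsTestFun {ι : Type*} [Finite ι] (α : ι → ℝ) (f : (ι → ℝ) → ℝ) : Prop where
  continuous : Continuous f
  bounded : ∃ C : ℝ, ∀ x, |f x| ≤ C
  support_away : ∃ r : ℝ, 0 < r ∧ tsupport f ⊆ {x | r ≤ anorm α x}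

/-- `i ∼ j` iff `|A_i| ^ α_i = |A_j| ^ α_j` almost surely. -/
def blockSetoid {Ω : Type*} [MeasurableSpace Ω] {d : ℕ} (P : Measure Ω)
    (A : Ω → Fin d → ℝ) (α : Fin d → ℝ) : Setoid (Fin d) where
  r i j := ∀ᵐ ω ∂P, |A ω i| ^ α i = |A ω j| ^ α j
  iseqv :=
    { refl := fun _ => Eventually.of_forall fun _ => rfl
      symm := fun h => h.mono fun _ hω => hω.symm
      trans := fun h₁ h₂ => by
        filter_upwards [h₁, h₂] with ω e₁ e₂ using e₁.trans e₂ }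

/-- The set of equivalence classes (the labels `l = 1, …, p` of the blocks). -/
def Blocks {d : ℕ} (s : Setoid (Fin d)) : Type := Quotient s

/-- The class of a coordinate. -/
def Blocks.of {d : ℕ} (s : Setoid (Fin d)) (i : Fin d) : Blocks s := Quotient.mk s i

instance {d : ℕ} (s : Setoid (Fin d)) : Finite (Blocks s) :=
  inferInstanceAs (Finite (Quotient s))

instance {d : ℕ} (s : Setoid (Fin d)) : Fintype (Blocks s) := Fintype.ofFinite _

instance {d : ℕ} (s : Setoid (Fin d)) : DecidableEq (Blocks s) := Classical.decEq _

/-- The coordinates that belong to the block `l`; the space `ℝ^{d_l}` is `Coord s l → ℝ`. -/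
abbrev Coord {d : ℕ} (s : Setoid (Fin d)) (l : Blocks s) : Type :=
  {i : Fin d // Blocks.of s i = l}

/-- The restriction `v^{(l)}` of a vector `v` (also of the vector of exponents) to the block `l`. -/
def part {d : ℕ} (s : Setoid (Fin d)) (l : Blocks s) (v : Fin d → ℝ) : Coord s l → ℝ :=
  fun i => v i

/-- The identification `∏_l ℝ^{d_l} = ℝ^d`. -/
def assemble {d : ℕ} (s : Setoid (Fin d)) (y : (l : Blocks s) → (Coord s l → ℝ)) : Fin d → ℝ :=
  fun i => y (Blocks.of s i) ⟨i, rfl⟩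

/-- `f_l(x) = f(0, …, 0, x, 0, …, 0)`, with `x` in the block `l`. -/
def slice {d : ℕ} (s : Setoid (Fin d)) (l : Blocks s) (f : (Fin d → ℝ) → ℝ)
    (x : Coord s l → ℝ) : ℝ :=
  f (assemble s (Function.update 0 l x))

/-- The measure `δ_0 × … × δ_0 × μ × δ_0 × … × δ_0` on `ℝ^d`, with `μ` (a measure on the unit
sphere of the block `l`, seen as a measure on `ℝ^{d_l}`) as the factor of index `l`. -/
def placed {d : ℕ} (s : Setoid (Fin d)) (α : Fin d → ℝ) (l : Blocks s)
    (μ : Measure (asphere (part s l α))) : Measure (Fin d → ℝ) :=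
  (Measure.pi (Function.update (fun k : Blocks s => Measure.dirac (0 : Coord s k → ℝ)) l
    (μ.map Subtype.val))).map (assemble s)

/-- The measure `U ↦ P(δ_{|X|_α⁻¹} X ∈ U | |X|_α > t)` on the unit sphere of `|·|_α`. -/
def angularLaw {Ω : Type*} [MeasurableSpace Ω] {d : ℕ} (P : Measure Ω) (α : Fin d → ℝ)
    (X : Ω → Fin d → ℝ) (t : ℝ) : Measure (asphere α) :=
  ((ProbabilityTheory.cond P {ω | t < anorm α (X ω)}).map
    (fun ω => dil α (anorm α (X ω))⁻¹ (X ω))).comap Subtype.val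

end DiagonalSRE

end

/-! Consider one block, with common value R of the |A_i|^{α_i}. Multiplication by diag(A) is there
the dilation δ_R composed with a change of signs θ, so the means g_ε(s) = e^s E f(ε·δ_{e^{-s}} X) of
a test function satisfy g_ε(s) = E R g_{εθ}(s - log R) + ψ_ε(s), a renewal equation on the product
of ℝ and a finite group of signs. Since E R = 1, the weight R changes the probability, and log R has
a positive mean for the new one. The charge ψ compares f at AX + B and at AX. It is summable over
unit intervals (`exists_charge_bound`): f is Hölder for |·|_α, |B|_α has a moment of order above one
and |X|_α has all moments below one (`integrable_rpow`), so Hölder's inequality suffices although B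
and X may be dependent.

A maximum principle for potentials (`exists_superharmonic`, `le_of_le_tilt_add`) bounds t P(|X|_α ≥
t) (`exists_tail_bound`), and so makes g bounded and uniformly continuous for f continuous with
compact support off the origin. The renewal theorem (`IsRenewalSolution.exists_tendsto`) is then
proved analytically. The difference of g and its translate by a value of (log R, θ) solves an
equation of the same kind; a positive upper limit of it would propagate along the translates and, by
telescoping, contradict the boundedness of g. Non-arithmeticity and the finiteness of the group
extend this asymptotic invariance to all real translations, and integrating the equation over (-∞,
s] yields the limit.

The limits define a positive functional, hence by Riesz a measure Λ_l on the punctured block. It is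
homogeneous under dilations, which gives its polar form (`map_polar`) and the smallness of thin
shells around the sphere, hence the convergence of tails and angular laws (`tendsto_radial`).

For coordinates of different blocks E √(R₁R₂) < 1, so √(|X_i|^{α_i} |X_j|^{α_j}) is integrable and
both coordinates are of order t with probability o(1/t) (`tendsto_joint_tail`). Hence f may be
replaced by the sum of its slices, and Λ is the sum of the images of the Λ_l
(`isTailMeasure_blockSum`). -/

set_option linter.unusedSectionVars false
set_option linter.style.haveILetI false

noncomputable section

namespace DiagonalSRE

open scoped ENNReal

/-! ### Algebra of the dilations. -/

section Dilations

variable {ι : Type*} {α : ι → ℝ}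

lemma dil_one (x : ι → ℝ) : dil α 1 x = x := by ext; simp [dil]

lemma dil_dil {s t : ℝ} (hs : 0 ≤ s) (ht : 0 ≤ t) (x : ι → ℝ) :
    dil α s (dil α t x) = dil α (s * t) x := by
  ext i; simp only [dil]; rw [Real.mul_rpow hs ht, mul_assoc]

lemma dil_add (t : ℝ) (x y : ι → ℝ) : dil α t (x + y) = dil α t x + dil α t y := by
  ext i; simp [dil, mul_add]

lemma dil_zero_right (t : ℝ) : dil α t (0 : ι → ℝ) = 0 := by
  ext i; simp [dil]

lemma dil_mul (t : ℝ) (a x : ι → ℝ) :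
    dil α t (fun i => a i * x i) = fun i => a i * dil α t x i := by
  ext i; simp only [dil]; ring

lemma continuous_dil (t : ℝ) : Continuous (dil α t) :=
  continuous_pi fun i => continuous_const.mul (continuous_apply i)

lemma measurable_dil_uncurry :
    Measurable (fun p : ℝ × (ι → ℝ) => dil α p.1 p.2) := by
  refine measurable_pi_iff.2 fun i => ?_
  unfold dil
  fun_prop

end Dilations

/-! ### The homogeneous gauge |·|_α and its triangle inequalities. -/

section Anorm

variable {ι : Type*} [Fintype ι] {α : ι → ℝ}

lemma anorm_nonneg (α x : ι → ℝ) : 0 ≤ anorm α x :=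
  Real.iSup_nonneg fun _ => Real.rpow_nonneg (abs_nonneg _) _

lemma le_anorm (α x : ι → ℝ) (i : ι) : |x i| ^ α i ≤ anorm α x :=
  le_ciSup (f := fun i => |x i| ^ α i) (Set.finite_range _).bddAbove i

lemma anorm_le_iff (x : ι → ℝ) {a : ℝ} (ha : 0 ≤ a) :
    anorm α x ≤ a ↔ ∀ i, |x i| ^ α i ≤ a :=
  ⟨fun h i => (le_anorm α x i).trans h, fun h => Real.iSup_le h ha⟩

lemma exists_anorm_eq [Nonempty ι] (α x : ι → ℝ) : ∃ i, anorm α x = |x i| ^ α i := by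
  obtain ⟨i, hi⟩ := exists_eq_ciSup_of_finite (f := fun i => |x i| ^ α i)
  exact ⟨i, hi.symm⟩

/-- Positivity of `a` takes care of an empty index type, where the supremum has the default value
`0`. -/
lemma le_anorm_iff (x : ι → ℝ) {a : ℝ} (ha : 0 < a) :
    a ≤ anorm α x ↔ ∃ i, a ≤ |x i| ^ α i := by
  constructor
  · intro h
    rcases isEmpty_or_nonempty ι with h' | h'
    · simp [anorm] at h; linarith
    · obtain ⟨i, hi⟩ := exists_anorm_eq α x
      exact ⟨i, hi ▸ h⟩
  · rintro ⟨i, hi⟩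
    exact hi.trans (le_anorm α x i)

lemma continuous_anorm (hα : ∀ i, 0 < α i) : Continuous (anorm α) := by
  rcases isEmpty_or_nonempty ι with h' | h'
  · have : anorm α = fun _ => (0 : ℝ) := by ext; simp [anorm]
    rw [this]; exact continuous_const
  · have : anorm α = fun x : ι → ℝ =>
        Finset.univ.sup' Finset.univ_nonempty (fun i => |x i| ^ α i) := by
      ext x; rw [Finset.sup'_univ_eq_ciSup]; rfl
    rw [this]
    refine Continuous.finset_sup'_apply _ fun i _ => ?_
    exact (continuous_abs.comp (continuous_apply i)).rpow_const fun x => Or.inr (hα i).le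

lemma measurable_anorm (hα : ∀ i, 0 < α i) : Measurable (anorm α) :=
  (continuous_anorm hα).measurable

lemma anorm_zero (hα : ∀ i, 0 < α i) : anorm α (0 : ι → ℝ) = 0 := by
  refine le_antisymm ((anorm_le_iff _ le_rfl).2 fun i => ?_) (anorm_nonneg _ _)
  simp [Real.zero_rpow (hα i).ne']

lemma anorm_eq_zero_iff (hα : ∀ i, 0 < α i) {x : ι → ℝ} : anorm α x = 0 ↔ x = 0 := by
  constructor
  · intro h
    ext i
    have h1 := h ▸ le_anorm α x i
    have h2 : |x i| ^ α i = 0 := le_antisymm h1 (Real.rpow_nonneg (abs_nonneg _) _)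
    have := (Real.rpow_eq_zero (abs_nonneg _) (hα i).ne').1 h2
    simpa using this
  · rintro rfl; exact anorm_zero hα

lemma anorm_pos_iff (hα : ∀ i, 0 < α i) {x : ι → ℝ} : 0 < anorm α x ↔ x ≠ 0 := by
  rw [(anorm_nonneg α x).lt_iff_ne', Ne, anorm_eq_zero_iff hα]

/-- If all the `|a_i| ^ α_i` agree, multiplication by `a` scales `|·|_α`. -/
lemma anorm_mul_of_eq {a : ι → ℝ} {R : ℝ} (hR : 0 ≤ R)
    (ha : ∀ i, |a i| ^ α i = R) (x : ι → ℝ) :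
    anorm α (fun i => a i * x i) = R * anorm α x := by
  rw [anorm, anorm, Real.mul_iSup_of_nonneg hR]
  congr 1; ext i
  rw [abs_mul, Real.mul_rpow (abs_nonneg _) (abs_nonneg _), ha]

lemma anorm_dil (hα : ∀ i, 0 < α i) {t : ℝ} (ht : 0 ≤ t) (x : ι → ℝ) :
    anorm α (dil α t x) = t * anorm α x := by
  refine anorm_mul_of_eq ht (fun i => ?_) x
  rw [abs_of_nonneg (Real.rpow_nonneg ht _), ← Real.rpow_mul ht, one_div,
    inv_mul_cancel₀ (hα i).ne', Real.rpow_one]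

lemma isCompact_anorm_le (hα : ∀ i, 0 < α i) (K : ℝ) : IsCompact {x | anorm α x ≤ K} := by
  refine Metric.isCompact_of_isClosed_isBounded (isClosed_le (continuous_anorm hα) continuous_const)
    ?_
  rw [isBounded_iff_forall_norm_le]
  rcases isEmpty_or_nonempty ι with h' | h'
  · exact ⟨0, fun x _ => by simp [Subsingleton.elim x 0]⟩
  obtain ⟨C, hC⟩ := (Set.finite_range fun i => |K| ^ (1 / α i)).bddAbove
  refine ⟨max C 0, fun x hx => (pi_norm_le_iff_of_nonneg (le_max_right _ _)).2 fun i => ?_⟩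
  have h1 : |x i| ^ α i ≤ |K| := (le_anorm α x i).trans (hx.trans (le_abs_self K))
  have h2 : |x i| ≤ |K| ^ (1 / α i) := by
    rw [one_div, Real.le_rpow_inv_iff_of_pos (abs_nonneg _) (abs_nonneg _) (hα i)]
    exact h1
  exact h2.trans ((hC ⟨i, rfl⟩).trans (le_max_left _ _))

/-- A power inequality with a coefficient arbitrarily close to one on the first term. -/
lemma abs_add_rpow_le {a : ℝ} (ha : 0 ≤ a) {κ : ℝ} (hκ : 0 < κ) (x y : ℝ) :
    |x + y| ^ a ≤ (1 + κ) ^ a * |x| ^ a + (1 + κ⁻¹) ^ a * |y| ^ a := by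
  have hxy : |x + y| ≤ |x| + |y| := abs_add_le x y
  -- Whichever of |y| and κ|x| is larger absorbs the other term, so no convexity in the exponent is
  -- needed.
  rcases le_total |y| (κ * |x|) with h | h
  · have h1 : |x + y| ^ a ≤ ((1 + κ) * |x|) ^ a :=
      Real.rpow_le_rpow (abs_nonneg _) (by linarith) ha
    rw [Real.mul_rpow (by positivity) (abs_nonneg _)] at h1
    have : 0 ≤ (1 + κ⁻¹) ^ a * |y| ^ a := by positivity
    linarith
  · have h0 : |x| ≤ κ⁻¹ * |y| := by
      rw [inv_mul_eq_div, le_div_iff₀ hκ]; linarith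
    have h1 : |x + y| ^ a ≤ ((1 + κ⁻¹) * |y|) ^ a :=
      Real.rpow_le_rpow (abs_nonneg _) (by linarith) ha
    rw [Real.mul_rpow (by positivity) (abs_nonneg _)] at h1
    have : 0 ≤ (1 + κ) ^ a * |x| ^ a := by positivity
    linarith

lemma exists_abs_add_rpow_le {a : ℝ} (ha : 0 ≤ a) {ε : ℝ} (hε : 0 < ε) :
    ∃ C : ℝ, 0 ≤ C ∧ ∀ x y : ℝ, |x + y| ^ a ≤ (1 + ε) * |x| ^ a + C * |y| ^ a := by
  have hlim : Tendsto (fun κ : ℝ => (1 + κ) ^ a) (𝓝 0) (𝓝 ((1 + 0) ^ a)) := by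
    refine ((continuous_const.add continuous_id).rpow_const fun x => Or.inr ha).tendsto' _ _ ?_
    simp
  rw [add_zero, Real.one_rpow] at hlim
  have h1 : ∀ᶠ κ : ℝ in 𝓝[>] 0, (1 + κ) ^ a < 1 + ε :=
    (hlim.eventually (gt_mem_nhds (by linarith))).filter_mono nhdsWithin_le_nhds
  obtain ⟨κ, hκ, hκ0⟩ := (h1.and self_mem_nhdsWithin).exists
  have hκ0 : 0 < κ := hκ0
  refine ⟨(1 + κ⁻¹) ^ a, by positivity, fun x y => (abs_add_rpow_le ha hκ0 x y).trans ?_⟩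
  gcongr

/-- The gauge need not be subadditive when some α_i > 1. A coefficient close to one on the first
term preserves the strict contraction E R^β < 1 in the moment estimates. -/
lemma exists_anorm_add_le (hα : ∀ i, 0 < α i) {ε : ℝ} (hε : 0 < ε) :
    ∃ C : ℝ, 0 ≤ C ∧ ∀ x y : ι → ℝ,
      anorm α (x + y) ≤ (1 + ε) * anorm α x + C * anorm α y := by
  choose C hC0 hC using fun i => exists_abs_add_rpow_le (hα i).le hε
  have hsum : ∀ i, C i ≤ ∑ j, C j := fun i =>
    Finset.single_le_sum (f := C) (fun j _ => hC0 j) (Finset.mem_univ i)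
  have h0 : 0 ≤ ∑ j, C j := Finset.sum_nonneg fun j _ => hC0 j
  refine ⟨∑ i, C i, h0, fun x y => ?_⟩
  have hx := anorm_nonneg α x
  have hy := anorm_nonneg α y
  refine (anorm_le_iff _ (by positivity)).2 fun i => (hC i (x i) (y i)).trans ?_
  gcongr
  · exact le_anorm α x i
  · exact hsum i
  · exact le_anorm α y i

/-- For small exponents, `|·|_α ^ η` is subadditive. -/
lemma anorm_add_rpow_le {η : ℝ} (hη : 0 < η) (hηα : ∀ i, η * α i ≤ 1)
    (hα : ∀ i, 0 < α i) (x y : ι → ℝ) :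
    anorm α (x + y) ^ η ≤ anorm α x ^ η + anorm α y ^ η := by
  rcases isEmpty_or_nonempty ι with h' | h'
  · simp [anorm, Real.zero_rpow hη.ne']
  obtain ⟨i, hi⟩ := exists_anorm_eq α (x + y)
  have hpos := mul_pos hη (hα i)
  have e : ∀ z : ι → ℝ, (|z i| ^ α i) ^ η = |z i| ^ (η * α i) := fun z => by
    rw [← Real.rpow_mul (abs_nonneg _), mul_comm]
  calc anorm α (x + y) ^ η = |x i + y i| ^ (η * α i) := by rw [hi, e]; rfl
    _ ≤ (|x i| + |y i|) ^ (η * α i) :=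
        Real.rpow_le_rpow (abs_nonneg _) (abs_add_le _ _) hpos.le
    _ ≤ |x i| ^ (η * α i) + |y i| ^ (η * α i) :=
        Real.rpow_add_le_add_rpow (abs_nonneg _) (abs_nonneg _) hpos.le (hηα i)
    _ ≤ _ := by
        rw [← e, ← e]
        gcongr <;> exact le_anorm α _ i

lemma anorm_neg (x : ι → ℝ) : anorm α (-x) = anorm α x := by simp [anorm]

lemma abs_anorm_rpow_sub_le {η : ℝ} (hη : 0 < η) (hηα : ∀ i, η * α i ≤ 1)
    (hα : ∀ i, 0 < α i) (x y : ι → ℝ) :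
    |anorm α x ^ η - anorm α y ^ η| ≤ anorm α (x - y) ^ η := by
  have h1 := anorm_add_rpow_le hη hηα hα (x - y) y
  have h2 := anorm_add_rpow_le hη hηα hα (y - x) x
  rw [sub_add_cancel] at h1 h2
  rw [← neg_sub x y, anorm_neg] at h2
  exact abs_sub_le_iff.2 ⟨by linarith, by linarith⟩

/-- Bounded Lipschitz functions are Hölder for `|·|_α`. -/
lemma abs_sub_le_anorm_rpow {η : ℝ} (hη : 0 < η) (hηα : ∀ i, η * α i ≤ 1)
    (hα : ∀ i, 0 < α i) {f : (ι → ℝ) → ℝ} {C : ℝ} (hC : ∀ x, |f x| ≤ C) {K : NNReal}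
    (hf : LipschitzWith K f) (x y : ι → ℝ) :
    |f x - f y| ≤ (2 * C + K) * anorm α (x - y) ^ η := by
  have hC0 : 0 ≤ C := (abs_nonneg _).trans (hC x)
  rcases isEmpty_or_nonempty ι with h' | h'
  · rw [Subsingleton.elim x y]; simp [anorm, Real.zero_rpow hη.ne']
  have hL : |f x - f y| ≤ K * dist x y := by
    rw [← Real.dist_eq]; exact hf.dist_le_mul x y
  have hB : |f x - f y| ≤ 2 * C := by
    have := abs_sub (f x) (f y)
    linarith [hC x, hC y]
  have hN : 0 ≤ anorm α (x - y) ^ η := Real.rpow_nonneg (anorm_nonneg _ _) _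
  obtain ⟨i, -, hi⟩ := Finset.exists_mem_eq_sup' (Finset.univ_nonempty (α := ι))
    (fun i => dist (x i) (y i))
  have hdist : dist x y = |x i - y i| := by
    rw [← Real.dist_eq, ← hi]
    refine le_antisymm ((dist_pi_le_iff ?_).2 fun j => ?_) ?_
    · exact dist_nonneg.trans (Finset.le_sup' (fun i => dist (x i) (y i)) (Finset.mem_univ i))
    · exact Finset.le_sup' (fun i => dist (x i) (y i)) (Finset.mem_univ j)
    · exact Finset.sup'_le _ _ fun j _ => dist_le_pi_dist x y j
  have key : |x i - y i| ^ (η * α i) ≤ anorm α (x - y) ^ η := by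
    rw [mul_comm, Real.rpow_mul (abs_nonneg _)]
    exact Real.rpow_le_rpow (by positivity) (le_anorm α (x - y) i) hη.le
  have hK : (0 : ℝ) ≤ K := K.2
  -- Large increments are covered by the bound 2C, small ones by the Lipschitz constant and u ≤
  -- u^{ηα_i} for 0 ≤ u ≤ 1.
  rcases le_total 1 |x i - y i| with h | h
  · have : 1 ≤ anorm α (x - y) ^ η := (Real.one_le_rpow h (by
      have := hα i; positivity)).trans key
    nlinarith
  · have : |x i - y i| ≤ |x i - y i| ^ (η * α i) := by
      rcases (abs_nonneg (x i - y i)).eq_or_lt with h0 | h0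
      · rw [← h0]; exact Real.rpow_nonneg le_rfl _
      · calc |x i - y i| = |x i - y i| ^ (1 : ℝ) := (Real.rpow_one _).symm
          _ ≤ _ := Real.rpow_le_rpow_of_exponent_ge h0 h (hηα i)
    calc |f x - f y| ≤ K * |x i - y i| := by rw [← hdist]; exact hL
      _ ≤ K * anorm α (x - y) ^ η := by gcongr; exact this.trans key
      _ ≤ _ := by gcongr; linarith

/-- One exponent serves all coordinates. Keeping it below one leaves a positive power 1 - η of
|AX|_α in the estimate of the charge. -/
lemma exists_holder_exponent (hα : ∀ i, 0 < α i) :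
    ∃ η : ℝ, 0 < η ∧ η < 1 ∧ ∀ i, η * α i ≤ 1 := by
  have hs : ∀ i, α i ≤ ∑ j, α j := fun i =>
    Finset.single_le_sum (f := α) (fun j _ => (hα j).le) (Finset.mem_univ i)
  have h0 : 0 ≤ ∑ j, α j := Finset.sum_nonneg fun j _ => (hα j).le
  refine ⟨(2 + ∑ j, α j)⁻¹, by positivity, inv_lt_one_of_one_lt₀ (by linarith), fun i => ?_⟩
  rw [inv_mul_le_iff₀ (by positivity)]
  linarith [hs i]

end Anorm

/-! ### Integration over independent variables. -/

section Independence

variable {Ω : Type*} [MeasurableSpace Ω] {P : Measure Ω} [IsProbabilityMeasure P]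
  {E F : Type*} [MeasurableSpace E] [MeasurableSpace F]

lemma lintegral_indep {Y : Ω → E} {Z : Ω → F} (hY : Measurable Y) (hZ : Measurable Z)
    (h : IndepFun Y Z P) {f : E → F → ℝ≥0∞} (hf : Measurable (Function.uncurry f)) :
    ∫⁻ ω, f (Y ω) (Z ω) ∂P = ∫⁻ ω, ∫⁻ ω', f (Y ω) (Z ω') ∂P ∂P := by
  have hm := (indepFun_iff_map_prod_eq_prod_map_map hY.aemeasurable hZ.aemeasurable).1 h
  have e1 : ∫⁻ ω, f (Y ω) (Z ω) ∂P
      = ∫⁻ p, Function.uncurry f p ∂(P.map fun ω => (Y ω, Z ω)) := by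
    rw [lintegral_map hf (hY.prodMk hZ)]; rfl
  haveI := Measure.isProbabilityMeasure_map (μ := P) hZ.aemeasurable
  rw [e1, hm, lintegral_prod _ hf.aemeasurable, lintegral_map hf.lintegral_prod_right' hY]
  refine lintegral_congr fun ω => ?_
  exact lintegral_map (hf.comp measurable_prodMk_left) hZ

lemma integral_indep {Y : Ω → E} {Z : Ω → F} (hY : Measurable Y) (hZ : Measurable Z)
    (h : IndepFun Y Z P) {f : E → F → ℝ} (hf : Measurable (Function.uncurry f)) {C : ℝ}
    (hC : ∀ y z, |f y z| ≤ C) :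
    ∫ ω, f (Y ω) (Z ω) ∂P = ∫ ω, ∫ ω', f (Y ω) (Z ω') ∂P ∂P := by
  have hm := (indepFun_iff_map_prod_eq_prod_map_map hY.aemeasurable hZ.aemeasurable).1 h
  have e1 : ∫ ω, f (Y ω) (Z ω) ∂P
      = ∫ p, Function.uncurry f p ∂(P.map fun ω => (Y ω, Z ω)) := by
    rw [integral_map (hY.prodMk hZ).aemeasurable hf.aestronglyMeasurable]; rfl
  haveI := Measure.isProbabilityMeasure_map (μ := P) hZ.aemeasurable
  haveI := Measure.isProbabilityMeasure_map (μ := P) hY.aemeasurable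
  have hinteg : Integrable (Function.uncurry f) ((P.map Y).prod (P.map Z)) :=
    Integrable.of_bound hf.aestronglyMeasurable C (Eventually.of_forall fun p => hC _ _)
  rw [e1, hm, integral_prod _ hinteg, integral_map hY.aemeasurable
    hf.stronglyMeasurable.integral_prod_right'.aestronglyMeasurable]
  refine integral_congr_ae (Eventually.of_forall fun ω => ?_)
  exact integral_map hZ.aemeasurable (hf.comp measurable_prodMk_left).aestronglyMeasurable

end Independence

/-! ### Moments below the critical order. -/

section Moments

variable {Ω : Type*} [MeasurableSpace Ω] {P : Measure Ω} [IsProbabilityMeasure P]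

/-- The iterates of `min · M` under `φ ↦ (t ↦ E φ(R t))`. -/
def truncIter (P : Measure Ω) (R : Ω → ℝ≥0∞) (M : ℝ≥0∞) : ℕ → ℝ≥0∞ → ℝ≥0∞
  | 0, t => min t M
  | n + 1, t => ∫⁻ ω, truncIter P R M n (R ω * t) ∂P

variable (P) in
lemma truncIter_mono (R : Ω → ℝ≥0∞) (M : ℝ≥0∞) (n : ℕ) : Monotone (truncIter P R M n) := by
  induction n with
  | zero => exact fun a b h => min_le_min_right _ h
  | succ n ih => exact fun a b h => lintegral_mono fun ω => ih (by gcongr)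

variable (P) in
lemma truncIter_add_le {R : Ω → ℝ≥0∞} (hR : Measurable R) (M : ℝ≥0∞) (n : ℕ) (a b : ℝ≥0∞) :
    truncIter P R M n (a + b) ≤ truncIter P R M n a + truncIter P R M n b := by
  induction n generalizing a b with
  | zero =>
    simp only [truncIter]
    rcases le_total a M with ha | ha <;> rcases le_total b M with hb | hb <;>
      simp [ha, hb]
  | succ n ih =>
    simp only [truncIter]
    have hm := (truncIter_mono P R M n).measurable
    rw [← lintegral_add_left (by fun_prop)]
    refine lintegral_mono fun ω => ?_
    rw [mul_add]; exact ih _ _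

lemma truncIter_le_bound (R : Ω → ℝ≥0∞) (M : ℝ≥0∞) (n : ℕ) (a : ℝ≥0∞) :
    truncIter P R M n a ≤ M := by
  induction n generalizing a with
  | zero => exact min_le_right _ _
  | succ n ih =>
    refine (lintegral_mono fun ω => ih _).trans ?_
    simp

lemma truncIter_le_pow {R : Ω → ℝ≥0∞} (hR : Measurable R) (M : ℝ≥0∞) (n : ℕ) (a : ℝ≥0∞) :
    truncIter P R M n a ≤ (∫⁻ ω, R ω ∂P) ^ n * a := by
  induction n generalizing a with
  | zero => simp [truncIter]
  | succ n ih =>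
    refine (lintegral_mono fun ω => ih _).trans ?_
    rw [lintegral_const_mul _ (hR.mul_const a), lintegral_mul_const _ hR, pow_succ, mul_assoc]

/-- A nonnegative variable dominated in law by `R U + V`, with `R` independent of `U` and
`E R < 1`, `E V < ∞`, has a finite mean. -/
theorem lintegral_lt_top_of_le_mul_add {U U' R V : Ω → ℝ≥0∞} (hU : Measurable U)
    (hU' : Measurable U') (hR : Measurable R) (hV : Measurable V)
    (hfin : ∀ ω, U ω ≠ ∞) (hlaw : P.map U = P.map U') (hind : IndepFun R U P)
    (hle : ∀ᵐ ω ∂P, U' ω ≤ R ω * U ω + V ω) (hR1 : ∫⁻ ω, R ω ∂P < 1)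
    (hV1 : ∫⁻ ω, V ω ∂P < ∞) : ∫⁻ ω, U ω ∂P < ∞ := by
  set ρ := ∫⁻ ω, R ω ∂P with hρ
  set v := ∫⁻ ω, V ω ∂P with hv
  -- E φ(U) ≤ E φ(RU) + E φ(V) for every increasing subadditive φ, and all iterates of the
  -- truncation are such functions. A direct comparison of E U with ρ E U + E V would presuppose E U
  -- < ∞.
  have step : ∀ M n, ∫⁻ ω, truncIter P R M n (U ω) ∂P
      ≤ ∫⁻ ω, truncIter P R M (n + 1) (U ω) ∂P + ρ ^ n * v := by
    intro M n
    have hm := (truncIter_mono P R M n).measurable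
    calc ∫⁻ ω, truncIter P R M n (U ω) ∂P = ∫⁻ ω, truncIter P R M n (U' ω) ∂P := by
          rw [← lintegral_map hm hU, hlaw, lintegral_map hm hU']
      _ ≤ ∫⁻ ω, (truncIter P R M n (R ω * U ω) + truncIter P R M n (V ω)) ∂P := by
          refine lintegral_mono_ae (hle.mono fun ω h => ?_)
          exact (truncIter_mono P R M n h).trans (truncIter_add_le P hR M n _ _)
      _ = ∫⁻ ω, truncIter P R M n (R ω * U ω) ∂P + ∫⁻ ω, truncIter P R M n (V ω) ∂P :=
          lintegral_add_left (hm.comp (hR.mul hU)) _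
      _ ≤ _ := by
          refine add_le_add (le_of_eq ?_) ?_
          · exact lintegral_indep (f := fun u r => truncIter P R M n (r * u)) hU hR hind.symm
              (by unfold Function.uncurry; fun_prop)
          · refine (lintegral_mono fun ω => truncIter_le_pow hR M n (V ω)).trans ?_
            rw [lintegral_const_mul _ hV]
  have iter : ∀ M n, ∫⁻ ω, min (U ω) M ∂P
      ≤ ∫⁻ ω, truncIter P R M n (U ω) ∂P + (∑ k ∈ Finset.range n, ρ ^ k) * v := by
    intro M n
    induction n with
    | zero => simp [truncIter]
    | succ n ih =>
      refine ih.trans ?_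
      rw [Finset.sum_range_succ, add_mul]
      calc _ ≤ (∫⁻ ω, truncIter P R M (n + 1) (U ω) ∂P + ρ ^ n * v)
            + (∑ k ∈ Finset.range n, ρ ^ k) * v := by gcongr; exact step M n
        _ = _ := by ring
  -- For fixed M the iterates are bounded by M and at most ρ^n U pointwise, so dominated convergence
  -- applies as U is finite everywhere.
  have lim : ∀ M : ℝ≥0∞, M ≠ ∞ →
      Tendsto (fun n => ∫⁻ ω, truncIter P R M n (U ω) ∂P) atTop (𝓝 0) := by
    intro M hM
    have := tendsto_lintegral_of_dominated_convergence (μ := P) (fun _ => M)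
      (F := fun n ω => truncIter P R M n (U ω)) (f := fun _ => 0)
      (fun n => (truncIter_mono P R M n).measurable.comp hU)
      (fun n => Eventually.of_forall fun ω => truncIter_le_bound R M n _)
      (by simpa using hM) (Eventually.of_forall fun ω => ?_)
    · simpa using this
    · refine tendsto_of_tendsto_of_tendsto_of_le_of_le tendsto_const_nhds
        (h := fun n => ρ ^ n * U ω) ?_ (fun n => zero_le) (fun n => truncIter_le_pow hR M n _)
      have := ENNReal.Tendsto.mul_const (ENNReal.tendsto_pow_atTop_nhds_zero_of_lt_one hR1)
        (b := U ω) (Or.inr (hfin ω))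
      simpa using this
  have hgeom : ∀ n, (∑ k ∈ Finset.range n, ρ ^ k) * v ≤ (1 - ρ)⁻¹ * v := fun n => by
    rw [← ENNReal.tsum_geometric]; gcongr; exact ENNReal.sum_le_tsum _
  have hbd : ∀ M : ℝ≥0∞, M ≠ ∞ → ∫⁻ ω, min (U ω) M ∂P ≤ (1 - ρ)⁻¹ * v := by
    intro M hM
    have h1 : Tendsto (fun n => ∫⁻ ω, truncIter P R M n (U ω) ∂P + (1 - ρ)⁻¹ * v) atTop
        (𝓝 (0 + (1 - ρ)⁻¹ * v)) := (lim M hM).add tendsto_const_nhds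
    rw [zero_add] at h1
    exact ge_of_tendsto' h1 fun n => (iter M n).trans (add_le_add le_rfl (hgeom n))
  have hmono : ∫⁻ ω, U ω ∂P ≤ (1 - ρ)⁻¹ * v := by
    have h1 := lintegral_tendsto_of_tendsto_of_monotone (μ := P)
      (f := fun (n : ℕ) ω => min (U ω) (n : ℝ≥0∞)) (F := U)
      (fun n => (hU.min measurable_const).aemeasurable)
      (Eventually.of_forall fun ω m n h => by dsimp; gcongr)
      (Eventually.of_forall fun ω => ?_)
    · exact le_of_tendsto' h1 fun n => hbd n (by simp)
    · have : ∀ᶠ n : ℕ in atTop, min (U ω) (n : ℝ≥0∞) = U ω := by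
        obtain ⟨k, hk⟩ := ENNReal.exists_nat_gt (hfin ω)
        filter_upwards [eventually_ge_atTop k] with n hn
        exact min_eq_left (hk.le.trans (by exact_mod_cast hn))
      exact tendsto_const_nhds.congr' (this.mono fun n h => h.symm)
  refine hmono.trans_lt (ENNReal.mul_lt_top (ENNReal.inv_lt_top.2 ?_) hV1)
  exact tsub_pos_of_lt hR1

/-- Real-valued form of `lintegral_lt_top_of_le_mul_add`. -/
theorem integrable_of_le_mul_add {U U' R V : Ω → ℝ} (hU : Measurable U)
    (hU' : Measurable U') (hR : Measurable R) (hV : Measurable V)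
    (hU0 : ∀ ω, 0 ≤ U ω) (hR0 : ∀ ω, 0 ≤ R ω) (hV0 : ∀ ω, 0 ≤ V ω)
    (hlaw : P.map U = P.map U') (hind : IndepFun R U P)
    (hle : ∀ᵐ ω ∂P, U' ω ≤ R ω * U ω + V ω) (hRi : Integrable R P) (hR1 : ∫ ω, R ω ∂P < 1)
    (hVi : Integrable V P) : Integrable U P := by
  have key := lintegral_lt_top_of_le_mul_add (P := P) (U := fun ω => ENNReal.ofReal (U ω))
    (U' := fun ω => ENNReal.ofReal (U' ω)) (R := fun ω => ENNReal.ofReal (R ω))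
    (V := fun ω => ENNReal.ofReal (V ω)) hU.ennreal_ofReal hU'.ennreal_ofReal hR.ennreal_ofReal
    hV.ennreal_ofReal (fun ω => ENNReal.ofReal_ne_top) ?_ ?_ ?_ ?_ ?_
  · refine ⟨hU.aestronglyMeasurable, ?_⟩
    rw [hasFiniteIntegral_iff_ofReal (Eventually.of_forall hU0)]
    exact key
  · have e : ∀ W : Ω → ℝ, Measurable W →
        P.map (fun ω => ENNReal.ofReal (W ω)) = (P.map W).map ENNReal.ofReal := fun W hW => by
      rw [Measure.map_map ENNReal.measurable_ofReal hW]; rfl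
    rw [e U hU, e U' hU', hlaw]
  · exact hind.comp ENNReal.measurable_ofReal ENNReal.measurable_ofReal
  · filter_upwards [hle] with ω h
    rw [← ENNReal.ofReal_mul (hR0 ω), ← ENNReal.ofReal_add (mul_nonneg (hR0 ω) (hU0 ω)) (hV0 ω)]
    exact ENNReal.ofReal_le_ofReal h
  · rw [← ofReal_integral_eq_lintegral_ofReal hRi (Eventually.of_forall hR0)]
    exact ENNReal.ofReal_lt_one.2 hR1
  · exact (hasFiniteIntegral_iff_ofReal (Eventually.of_forall hV0)).1 hVi.2

/-- Mixed moments of a variable with slightly more than a first moment and of a variable with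
all moments of order below one. -/
lemma integrable_rpow_mul_rpow {Z W : Ω → ℝ} (hZ : Measurable Z) (hW : Measurable W)
    (hZ0 : ∀ ω, 0 ≤ Z ω) (hW0 : ∀ ω, 0 ≤ W ω) {σ η : ℝ} (hσ : 0 < σ) (hη : 0 < η) (hη1 : η < 1)
    (hZi : Integrable (fun ω => Z ω ^ (1 + σ)) P)
    (hWi : ∀ β : ℝ, 0 < β → β < 1 → Integrable (fun ω => W ω ^ β) P) :
    Integrable (fun ω => Z ω ^ η * W ω ^ (1 - η)) P := by
  -- Young's inequality with ηp = 1 + σ; the conjugate exponent q satisfies (1 - η)q < 1 exactly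
  -- because ηp > 1.
  set p := (1 + σ) / η with hp
  have hp1 : 1 < p := by rw [hp, lt_div_iff₀ hη]; linarith
  have hpq := Real.HolderConjugate.conjExponent hp1
  set q := p.conjExponent with hq
  have hq1 : 1 < q := hpq.symm.lt
  have hβ1 : (1 - η) * q < 1 := by
    rw [hq, Real.conjExponent, mul_div_assoc', div_lt_one (by linarith)]
    have : η * p = 1 + σ := by rw [hp]; field_simp
    nlinarith
  have hβ0 : 0 < (1 - η) * q := mul_pos (by linarith) (by linarith)
  refine ((hZi.add (hWi _ hβ0 hβ1))).mono'
    ((hZ.pow_const _).mul (hW.pow_const _)).aestronglyMeasurable (Eventually.of_forall fun ω => ?_)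
  have h1 := Real.rpow_nonneg (hZ0 ω) η
  have h2 := Real.rpow_nonneg (hW0 ω) (1 - η)
  rw [Real.norm_of_nonneg (mul_nonneg h1 h2)]
  refine (Real.young_inequality_of_nonneg h1 h2 hpq).trans ?_
  rw [← Real.rpow_mul (hZ0 ω), ← Real.rpow_mul (hW0 ω)]
  have : η * p = 1 + σ := by rw [hp]; field_simp
  rw [this]
  refine add_le_add (div_le_self (Real.rpow_nonneg (hZ0 ω) _) hp1.le)
    (div_le_self (Real.rpow_nonneg (hW0 ω) _) hq1.le)

/-- Strict decrease of the moments of order below one of a nonnegative variable of mean one. -/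
lemma integral_rpow_lt_one {R : Ω → ℝ} (hR : Measurable R) (hR0 : ∀ ω, 0 ≤ R ω)
    (hRi : Integrable R P) (hR1 : ∫ ω, R ω ∂P = 1) (hne : ¬ ∀ᵐ ω ∂P, R ω = 1) {β : ℝ}
    (hβ : 0 < β) (hβ1 : β < 1) :
    Integrable (fun ω => R ω ^ β) P ∧ ∫ ω, R ω ^ β ∂P < 1 := by
  -- The tangent at 1 of a strictly concave function; its mean along R is 1, and equality of means
  -- would force R = 1 almost surely.
  have hle : ∀ r : ℝ, 0 ≤ r → r ^ β ≤ 1 + β * (r - 1) := fun r hr => by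
    have := rpow_one_add_le_one_add_mul_self (s := r - 1) (by linarith) hβ.le hβ1.le
    simpa using this
  have hmaj : Integrable (fun ω => 1 + β * (R ω - 1)) P :=
    (integrable_const _).add ((hRi.sub (integrable_const _)).const_mul _)
  have hinteg : Integrable (fun ω => R ω ^ β) P := by
    refine hmaj.mono' (hR.pow_const _).aestronglyMeasurable (Eventually.of_forall fun ω => ?_)
    rw [Real.norm_of_nonneg (Real.rpow_nonneg (hR0 ω) _)]
    exact hle _ (hR0 ω)
  have hmaj1 : ∫ ω, (1 + β * (R ω - 1)) ∂P = 1 := by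
    have h1 : ∫ ω, (R ω - 1) ∂P = 0 := by
      rw [integral_sub hRi (integrable_const _), hR1]; simp
    have h2 : Integrable (fun ω => β * (R ω - 1)) P :=
      (hRi.sub (integrable_const _)).const_mul _
    rw [integral_add (integrable_const _) h2, integral_const_mul, h1]
    simp
  refine ⟨hinteg, lt_of_le_of_ne ?_ fun heq => hne ?_⟩
  · rw [← hmaj1]; exact integral_mono hinteg hmaj fun ω => hle _ (hR0 ω)
  · have h0 : ∫ ω, (1 + β * (R ω - 1) - R ω ^ β) ∂P = 0 := by
      rw [integral_sub hmaj hinteg, hmaj1, heq, sub_self]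
    have h1 := (integral_eq_zero_iff_of_nonneg
      (fun ω => sub_nonneg.2 (hle _ (hR0 ω))) (hmaj.sub hinteg)).1 h0
    filter_upwards [h1] with ω hω
    by_contra hne1
    have := rpow_one_add_lt_one_add_mul_self (s := R ω - 1) (by linarith [hR0 ω])
      (sub_ne_zero.2 hne1) hβ hβ1
    simp only [Pi.zero_apply] at hω
    rw [add_sub_cancel] at this
    linarith

/-- The tilted mean of `log R` is positive. -/
lemma integral_mul_log_pos {R : Ω → ℝ} (hR0 : ∀ ω, 0 ≤ R ω)
    (hRi : Integrable R P) (hR1 : ∫ ω, R ω ∂P = 1) (hne : ¬ ∀ᵐ ω ∂P, R ω = 1)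
    (hRl : Integrable (fun ω => R ω * Real.log (R ω)) P) :
    0 < ∫ ω, R ω * Real.log (R ω) ∂P := by
  -- r log r lies above its tangent r - 1 at 1, whose mean along R is zero; at r = 0 the product
  -- vanishes.
  have hle : ∀ r : ℝ, 0 ≤ r → r ≠ 1 → r - 1 < r * Real.log r := fun r hr hr1 => by
    rcases hr.eq_or_lt with h | h
    · rw [← h]; simp
    · have := Real.log_lt_sub_one_of_pos (inv_pos.2 h) (by simpa using hr1)
      rw [Real.log_inv] at this
      have h2 := mul_lt_mul_of_pos_left this h
      rw [mul_sub, mul_inv_cancel₀ h.ne'] at h2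
      linarith
  have hle' : ∀ r : ℝ, 0 ≤ r → r - 1 ≤ r * Real.log r := fun r hr => by
    rcases eq_or_ne r 1 with h | h
    · simp [h]
    · exact (hle r hr h).le
  have hi : Integrable (fun ω => R ω - 1) P := hRi.sub (integrable_const (μ := P) (1 : ℝ))
  have hm : ∫ ω, (R ω - 1) ∂P = 0 := by
    rw [integral_sub hRi (integrable_const _), hR1]; simp
  refine lt_of_le_of_ne ?_ fun heq => hne ?_
  · rw [← hm]; exact integral_mono hi hRl fun ω => hle' _ (hR0 ω)
  · have h0 : ∫ ω, (R ω * Real.log (R ω) - (R ω - 1)) ∂P = 0 := by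
      rw [integral_sub hRl hi, hm, ← heq, sub_self]
    have h1 := (integral_eq_zero_iff_of_nonneg
      (fun ω => sub_nonneg.2 (hle' _ (hR0 ω))) (hRl.sub hi)).1 h0
    filter_upwards [h1] with ω hω
    by_contra hne1
    have := hle _ (hR0 ω) hne1
    simp only [Pi.zero_apply] at hω
    linarith

end Moments

/-! ### The transition operator of the tilted random walk. -/

section Potential

variable {Ω : Type*} [MeasurableSpace Ω]

/-- The operator `φ ↦ (s ↦ E R φ(s - log R))`. -/
def tilt (P : Measure Ω) (R : Ω → ℝ) (φ : ℝ → ℝ≥0∞) (s : ℝ) : ℝ≥0∞ :=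
  ∫⁻ ω, ENNReal.ofReal (R ω) * φ (s - Real.log (R ω)) ∂P

variable {P : Measure Ω} [IsProbabilityMeasure P] {R : Ω → ℝ}

lemma tilt_mono {φ φ' : ℝ → ℝ≥0∞} (h : φ ≤ φ') : tilt P R φ ≤ tilt P R φ' :=
  fun s => lintegral_mono fun ω => by gcongr; exact h _

lemma measurable_tilt (hR : Measurable R) {φ : ℝ → ℝ≥0∞} (hφ : Measurable φ) :
    Measurable (tilt P R φ) := by
  unfold tilt
  refine Measurable.lintegral_prod_right' (f := fun p : ℝ × Ω =>
    ENNReal.ofReal (R p.2) * φ (p.1 - Real.log (R p.2))) ?_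
  fun_prop

lemma tilt_add (hR : Measurable R) {φ φ' : ℝ → ℝ≥0∞} (hφ : Measurable φ) :
    tilt P R (φ + φ') = tilt P R φ + tilt P R φ' := by
  ext s
  simp only [tilt, Pi.add_apply, mul_add]
  exact lintegral_add_left (by fun_prop) _

lemma tilt_tsum (hR : Measurable R) {κ : Type*} [Countable κ] {φ : κ → ℝ → ℝ≥0∞}
    (hφ : ∀ k, Measurable (φ k)) :
    tilt P R (fun s => ∑' k, φ k s) = fun s => ∑' k, tilt P R (φ k) s := by
  ext s
  simp only [tilt, ← ENNReal.tsum_mul_left]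
  exact lintegral_tsum fun k => by have := hφ k; fun_prop

lemma tilt_const_mul (hR : Measurable R) (c : ℝ≥0∞) {φ : ℝ → ℝ≥0∞} (hφ : Measurable φ) :
    tilt P R (fun s => c * φ s) = fun s => c * tilt P R φ s := by
  ext s
  simp only [tilt]
  rw [← lintegral_const_mul _ (by fun_prop)]
  exact lintegral_congr fun ω => by ring

lemma tilt_le_const (hR : Measurable R) (hR1 : ∫⁻ ω, ENNReal.ofReal (R ω) ∂P ≤ 1) {φ : ℝ → ℝ≥0∞} {M : ℝ≥0∞}
    (h : ∀ s, φ s ≤ M) (s : ℝ) : tilt P R φ s ≤ M := by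
  calc tilt P R φ s ≤ ∫⁻ ω, M * ENNReal.ofReal (R ω) ∂P :=
        lintegral_mono fun ω => by rw [mul_comm]; gcongr; exact h _
    _ = M * ∫⁻ ω, ENNReal.ofReal (R ω) ∂P := lintegral_const_mul _ hR.ennreal_ofReal
    _ ≤ M := mul_le_of_le_one_right' hR1

end Potential

/-! ### Potentials of unit intervals and a maximum principle. -/

section Potential

variable {Ω : Type*} [MeasurableSpace Ω] {P : Measure Ω} [IsProbabilityMeasure P] {R : Ω → ℝ}

/-- Where R > 0, R e^{-δ log R} = R^{1-δ}, so exponentials are eigenfunctions. Only an inequality is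
claimed: at R = 0 the left integrand vanishes, whatever the value of `0 ^ (1 - δ)`. -/
lemma tilt_exp_le (hR : Measurable R) (hR0 : ∀ ω, 0 ≤ R ω) (C : ℝ≥0∞) (δ y s : ℝ) :
    tilt P R (fun s => C * ENNReal.ofReal (Real.exp (δ * (s - y)))) s
      ≤ (∫⁻ ω, ENNReal.ofReal (R ω ^ (1 - δ)) ∂P) * C
        * ENNReal.ofReal (Real.exp (δ * (s - y))) := by
  rw [tilt_const_mul hR C (by fun_prop), mul_comm _ C, mul_assoc]
  refine mul_le_mul_right ?_ C
  rw [← lintegral_mul_const _ (by fun_prop)]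
  refine lintegral_mono fun ω => ?_
  rcases (hR0 ω).eq_or_lt with h | h
  · simp [← h]
  · rw [← ENNReal.ofReal_mul (hR0 ω), ← ENNReal.ofReal_mul (by positivity)]
    refine ENNReal.ofReal_le_ofReal (le_of_eq ?_)
    rw [Real.rpow_sub h, Real.rpow_one, Real.rpow_def_of_pos h, div_mul_eq_mul_div,
      eq_div_iff (Real.exp_ne_zero _), mul_assoc, ← Real.exp_add]
    congr 2; ring

/-- The indicator of a unit interval, and its potential for the operator `tilt`. -/
def unitBox (j : ℤ) : ℝ → ℝ≥0∞ := (Ico (j : ℝ) (j + 1)).indicator 1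

lemma measurable_unitBox (j : ℤ) : Measurable (unitBox j) :=
  measurable_one.indicator measurableSet_Ico

lemma measurable_iterate_tilt (hR : Measurable R) {φ : ℝ → ℝ≥0∞} (hφ : Measurable φ) (n : ℕ) :
    Measurable ((tilt P R)^[n] φ) := by
  induction n with
  | zero => simpa using hφ
  | succ n ih => rw [Function.iterate_succ_apply']; exact measurable_tilt hR ih

/-- Maximum principle: the potential of a unit interval, cut at its bound on that interval, is
still superharmonic with at least the same charge. -/
lemma exists_superharmonic (hR : Measurable R) (hR0 : ∀ ω, 0 ≤ R ω)
    (hR1 : ∫⁻ ω, ENNReal.ofReal (R ω) ∂P ≤ 1) {δ : ℝ} (hδ : 0 ≤ δ) (j : ℤ) :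
    ∃ w : ℝ → ℝ≥0∞, Measurable w ∧
      (∀ s, w s ≤ ENNReal.ofReal (Real.exp δ)
        * (1 - ∫⁻ ω, ENNReal.ofReal (R ω ^ (1 - δ)) ∂P)⁻¹) ∧
      ∀ s, unitBox j s + tilt P R w s ≤ w s := by
  set ρ := ∫⁻ ω, ENNReal.ofReal (R ω ^ (1 - δ)) ∂P with hρ
  set M := ENNReal.ofReal (Real.exp δ) * (1 - ρ)⁻¹ with hM
  have hmeas := measurable_iterate_tilt (P := P) hR (measurable_unitBox j)
  set u : ℝ → ℝ≥0∞ := fun s => ∑' n, (tilt P R)^[n] (unitBox j) s with hu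
  have humeas : Measurable u := Measurable.tsum fun n => hmeas n
  have hrec : ∀ s, u s = unitBox j s + tilt P R u s := by
    intro s
    rw [hu, tilt_tsum hR hmeas]
    dsimp only
    rw [tsum_eq_zero_add' ENNReal.summable]
    simp [Function.iterate_succ_apply']
  -- This bound is uniform in s over the unit interval, where it sums to M, but not over the whole
  -- line.
  have hexp : ∀ n s, (tilt P R)^[n] (unitBox j) s
      ≤ ρ ^ n * ENNReal.ofReal (Real.exp (δ * (s - j))) := by
    intro n
    induction n with
    | zero =>
      intro s
      simp only [Function.iterate_zero, id, pow_zero, one_mul, unitBox, indicator]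
      split_ifs with h
      · simp only [Pi.one_apply, ENNReal.one_le_ofReal]
        exact Real.one_le_exp (mul_nonneg hδ (by linarith [h.1]))
      · exact zero_le
    | succ n ih =>
      intro s
      rw [Function.iterate_succ_apply']
      refine (tilt_mono ih s).trans ((tilt_exp_le hR hR0 _ δ j s).trans (le_of_eq ?_))
      rw [pow_succ]; ring
  have hin : ∀ s ∈ Ico (j : ℝ) (j + 1), u s ≤ M := by
    intro s hs
    calc u s ≤ ∑' n, ρ ^ n * ENNReal.ofReal (Real.exp δ) := by
          refine ENNReal.tsum_le_tsum fun n => (hexp n s).trans ?_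
          gcongr
          nlinarith [hs.2]
      _ = M := by rw [ENNReal.tsum_mul_right, ENNReal.tsum_geometric, hM, mul_comm]
  refine ⟨fun s => min (u s) M, humeas.min measurable_const, fun s => min_le_right _ _, fun s => ?_⟩
  have h1 : tilt P R (fun s => min (u s) M) s ≤ tilt P R u s :=
    tilt_mono (fun s => min_le_left _ _) s
  have h2 : tilt P R (fun s => min (u s) M) s ≤ M :=
    tilt_le_const hR hR1 (fun s => min_le_right _ _) s
  change _ ≤ min (u s) M
  -- On the interval u ≤ M, so the cut is not active and u keeps its charge. Off the interval there
  -- is no charge, and the minimum of u with the constant M remains superharmonic because E R ≤ 1.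
  by_cases hs : s ∈ Ico (j : ℝ) (j + 1)
  · rw [min_eq_left (hin s hs), hrec s]
    gcongr
  · have : unitBox j s = 0 := indicator_of_notMem hs _
    rw [this, zero_add, hrec s, this, zero_add]
    exact le_min h1 h2

/-- A subsolution of the renewal equation with a summably dominated charge is bounded. -/
theorem le_of_le_tilt_add (hR : Measurable R) (hR0 : ∀ ω, 0 ≤ R ω)
    (hR1 : ∫⁻ ω, ENNReal.ofReal (R ω) ∂P ≤ 1) {δ : ℝ} (hδ : 0 ≤ δ)
    (hδ1 : ∫⁻ ω, ENNReal.ofReal (R ω ^ (1 - δ)) ∂P < 1) {d : ℤ → ℝ≥0∞} {g D : ℝ → ℝ≥0∞}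
    {C : ℝ≥0∞} (hC : C ≠ ∞)
    (hgC : ∀ s, g s ≤ C * ENNReal.ofReal (Real.exp (δ * s)))
    (hD : ∀ s, D s ≤ d ⌊s⌋) (hg : ∀ s, g s ≤ tilt P R g s + D s) (s : ℝ) :
    g s ≤ (∑' j, d j) * (ENNReal.ofReal (Real.exp δ)
        * (1 - ∫⁻ ω, ENNReal.ofReal (R ω ^ (1 - δ)) ∂P)⁻¹) := by
  set ρ := ∫⁻ ω, ENNReal.ofReal (R ω ^ (1 - δ)) ∂P with hρ
  set M := ENNReal.ofReal (Real.exp δ) * (1 - ρ)⁻¹ with hM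
  choose w hwm hwM hw using exists_superharmonic (P := P) hR hR0 hR1 hδ
  -- A supersolution for the charge D, obtained by superposing the superharmonic functions of the
  -- unit intervals with weights d_j.
  set W : ℝ → ℝ≥0∞ := fun s => ∑' j, d j * w j s with hW
  have hWm : Measurable W := Measurable.tsum fun j => (hwm j).const_mul _
  have hbox : ∀ s, d ⌊s⌋ ≤ ∑' j, d j * unitBox j s := fun s => by
    refine le_trans (le_of_eq ?_) (ENNReal.le_tsum ⌊s⌋)
    have : s ∈ Ico ((⌊s⌋ : ℤ) : ℝ) (⌊s⌋ + 1) := ⟨Int.floor_le s, Int.lt_floor_add_one s⟩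
    rw [unitBox, indicator_of_mem this]; simp
  have hsup : ∀ s, tilt P R W s + D s ≤ W s := by
    intro s
    rw [hW, tilt_tsum hR fun j => (hwm j).const_mul _]
    dsimp only
    calc _ ≤ ∑' j, tilt P R (fun s => d j * w j s) s + ∑' j, d j * unitBox j s := by
          gcongr; exact (hD s).trans (hbox s)
      _ = ∑' j, (d j * (unitBox j s + tilt P R (w j) s)) := by
          rw [← ENNReal.tsum_add]
          congr 1; ext j
          rw [tilt_const_mul hR _ (hwm j)]; ring
      _ ≤ _ := ENNReal.tsum_le_tsum fun j => by gcongr; exact hw j s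
  -- Each use of the inequality for g multiplies the exponential majorant by ρ < 1, while the
  -- supersolution W reabsorbs the charge.
  have iter : ∀ n s, g s ≤ ρ ^ n * C * ENNReal.ofReal (Real.exp (δ * s)) + W s := by
    intro n
    induction n with
    | zero => intro s; simpa using (hgC s).trans le_self_add
    | succ n ih =>
      intro s
      have h1 : tilt P R g s ≤ tilt P R (fun s => ρ ^ n * C * ENNReal.ofReal (Real.exp (δ * s))) s
          + tilt P R W s := by
        have h2 := tilt_mono (P := P) (R := R) (φ := g)
          (φ' := (fun s => ρ ^ n * C * ENNReal.ofReal (Real.exp (δ * s))) + W) ih s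
        rw [tilt_add hR (by fun_prop)] at h2
        exact h2
      have h3 := tilt_exp_le (P := P) hR hR0 (ρ ^ n * C) δ 0 s
      simp only [sub_zero] at h3
      calc g s ≤ tilt P R g s + D s := hg s
        _ ≤ ρ * (ρ ^ n * C) * ENNReal.ofReal (Real.exp (δ * s)) + tilt P R W s + D s := by
            gcongr; exact h1.trans (by gcongr)
        _ ≤ ρ * (ρ ^ n * C) * ENNReal.ofReal (Real.exp (δ * s)) + W s := by
            rw [add_assoc]; gcongr; exact hsup s
        _ = _ := by rw [pow_succ]; ring
  have hlim : Tendsto (fun n : ℕ => ρ ^ n * C * ENNReal.ofReal (Real.exp (δ * s)) + W s) atTop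
      (𝓝 (0 + W s)) := by
    refine Tendsto.add ?_ tendsto_const_nhds
    have h1 := ENNReal.Tendsto.mul_const (ENNReal.tendsto_pow_atTop_nhds_zero_of_lt_one hδ1)
        (b := C * ENNReal.ofReal (Real.exp (δ * s)))
        (Or.inr (ENNReal.mul_ne_top hC ENNReal.ofReal_ne_top))
    simpa [mul_assoc] using h1
  rw [zero_add] at hlim
  refine (ge_of_tendsto' hlim fun n => iter n s).trans ?_
  rw [hW, ← ENNReal.tsum_mul_right]
  exact ENNReal.tsum_le_tsum fun j => by gcongr; exact hwM j s

/-- Geometric sums over the integers below a level. -/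
lemma tsum_exp_indicator_le {γ : ℝ} (hγ : 0 < γ) :
    ∃ K : ℝ, 0 ≤ K ∧ ∀ z : ℝ, 0 ≤ z →
      ∑' j : ℤ, ENNReal.ofReal (if Real.exp j ≤ z then Real.exp (γ * j) else 0)
        ≤ ENNReal.ofReal (K * z ^ γ) := by
  have hq : Real.exp (-γ) < 1 := by rw [Real.exp_lt_one_iff]; linarith
  refine ⟨(1 - Real.exp (-γ))⁻¹, inv_nonneg.2 (by linarith), fun z hz => ?_⟩
  rcases hz.eq_or_lt with h | hz
  · rw [← h]
    have : ∀ j : ℤ, ¬ Real.exp j ≤ 0 := fun j => not_le.2 (Real.exp_pos _)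
    simp [this]
  set m := ⌊Real.log z⌋ with hm
  have hiff : ∀ j : ℤ, Real.exp j ≤ z ↔ j ≤ m := fun j => by
    rw [hm, Int.le_floor, Real.le_log_iff_exp_le hz]
  have hfun : ∀ j : ℤ, ENNReal.ofReal (if Real.exp j ≤ z then Real.exp (γ * j) else 0)
      = (Iic m).indicator (fun j : ℤ => ENNReal.ofReal (Real.exp (γ * j))) j := fun j => by
    simp only [hiff, indicator, mem_Iic]; split_ifs <;> simp
  simp_rw [hfun]
  rw [← tsum_subtype (Iic m) (fun j : ℤ => ENNReal.ofReal (Real.exp (γ * j)))]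
  let e : ℕ ≃ Iic m :=
    { toFun := fun n => ⟨m - n, by simp⟩
      invFun := fun j => (m - j.1).toNat
      left_inv := fun n => by simp
      right_inv := fun j => by
        have := j.2
        ext
        simp only [mem_Iic] at this
        simp only
        omega }
  rw [← e.tsum_eq]
  calc ∑' n : ℕ, ENNReal.ofReal (Real.exp (γ * ((e n : ℤ) : ℝ)))
      = ∑' n : ℕ, ENNReal.ofReal (Real.exp (γ * m)) * ENNReal.ofReal (Real.exp (-γ)) ^ n := by
        congr 1; ext n
        rw [← ENNReal.ofReal_pow (Real.exp_pos _).le, ← ENNReal.ofReal_mul (Real.exp_pos _).le,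
          ← Real.exp_nat_mul, ← Real.exp_add]
        congr 2
        simp only [e, Equiv.coe_fn_mk]; push_cast; ring
    _ = ENNReal.ofReal (Real.exp (γ * m)) * (1 - ENNReal.ofReal (Real.exp (-γ)))⁻¹ := by
        rw [ENNReal.tsum_mul_left, ENNReal.tsum_geometric]
    _ = ENNReal.ofReal ((1 - Real.exp (-γ))⁻¹ * Real.exp (γ * m)) := by
        rw [mul_comm, ENNReal.ofReal_mul (inv_nonneg.2 (by linarith)),
          ENNReal.ofReal_inv_of_pos (by linarith), ENNReal.ofReal_sub _ (Real.exp_pos _).le,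
          ENNReal.ofReal_one]
    _ ≤ _ := by
        refine ENNReal.ofReal_le_ofReal ?_
        have h1 : (m : ℝ) ≤ Real.log z := Int.floor_le _
        have h0 : 0 ≤ (1 - Real.exp (-γ))⁻¹ := inv_nonneg.2 (by linarith)
        gcongr
        rw [Real.rpow_def_of_pos hz, mul_comm]
        gcongr

end Potential

/-! ### The renewal equation: asymptotic invariance under the steps of the walk. -/

section Renewal

variable {Ω : Type*} [MeasurableSpace Ω] {P : Measure Ω} [IsProbabilityMeasure P] {R : Ω → ℝ}
  {F : Type*} [CommGroup F] [Finite F] [MeasurableSpace F] [MeasurableSingletonClass F]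
  {θ : Ω → F}

/-- Bounded uniformly continuous solutions `g` of the renewal equation
`g ε s = E R g (ε θ) (s - log R) + ψ ε s` with a charge `ψ` that vanishes at infinity. -/
structure IsRenewalSolution (P : Measure Ω) (R : Ω → ℝ) (θ : Ω → F) (g ψ : F → ℝ → ℝ) :
    Prop where
  bounded : ∃ C : ℝ, ∀ ε s, |g ε s| ≤ C
  uniformContinuous : ∀ ε, UniformContinuous (g ε)
  eq : ∀ ε s, g ε s = ∫ ω, R ω * g (ε * θ ω) (s - Real.log (R ω)) ∂P + ψ ε s
  vanish : ∀ ε, Tendsto (ψ ε) atTop (𝓝 0)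

/-- The essential values of `(log R, θ)` on `R > 0`. -/
def IsEssValue (P : Measure Ω) (R : Ω → ℝ) (θ : Ω → F) (a : ℝ) (η : F) : Prop :=
  ∀ ν > 0, 0 < P {ω | 0 < R ω ∧ |Real.log (R ω) - a| < ν ∧ θ ω = η}

namespace IsRenewalSolution

variable {g ψ : F → ℝ → ℝ}

lemma measurable_comp (h : ∀ ε, Continuous (g ε)) (hR : Measurable R) (hθ : Measurable θ)
    (ε : F) (s : ℝ) : Measurable fun ω => g (ε * θ ω) (s - Real.log (R ω)) := by
  have hm : Measurable fun p : F × ℝ => g (ε * p.1) (s - p.2) := by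
    refine measurable_from_prod_countable_right fun η => ?_
    exact ((h (ε * η)).comp (continuous_const.sub continuous_id)).measurable
  exact hm.comp (hθ.prodMk (Real.measurable_log.comp hR))

lemma integrable_comp (h : ∀ ε, Continuous (g ε)) {C : ℝ} (hC : ∀ ε s, |g ε s| ≤ C)
    (hR : Measurable R) (hRi : Integrable R P) (hθ : Measurable θ)
    (ε : F) (s : ℝ) : Integrable (fun ω => R ω * g (ε * θ ω) (s - Real.log (R ω))) P :=
  hRi.mul_bdd (measurable_comp h hR hθ ε s).aestronglyMeasurable
    (Eventually.of_forall fun _ => hC _ _)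

lemma neg (h : IsRenewalSolution P R θ g ψ) :
    IsRenewalSolution P R θ (fun ε s => - g ε s) (fun ε s => - ψ ε s) where
  bounded := by simpa using h.bounded
  uniformContinuous ε := (h.uniformContinuous ε).neg
  eq ε s := by
    rw [h.eq ε s]
    simp only [mul_neg, integral_neg]; ring
  vanish ε := by simpa using (h.vanish ε).neg

/-- The renewal operator commutes with the translations of F × ℝ, since F is commutative; the
translated charge still vanishes at infinity. -/
lemma sub_shift (h : IsRenewalSolution P R θ g ψ) (hR : Measurable R) (hRi : Integrable R P)
    (hθ : Measurable θ) (a : ℝ) (η : F) :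
    IsRenewalSolution P R θ (fun ε s => g ε s - g (ε * η) (s - a))
      (fun ε s => ψ ε s - ψ (ε * η) (s - a)) := by
  obtain ⟨C, hC⟩ := h.bounded
  have hc := fun ε => (h.uniformContinuous ε).continuous
  refine ⟨⟨C + C, fun ε s => (abs_sub _ _).trans (add_le_add (hC _ _) (hC _ _))⟩, fun ε => ?_,
    fun ε s => ?_, fun ε => ?_⟩
  · exact (h.uniformContinuous ε).sub ((h.uniformContinuous (ε * η)).comp
      (uniformContinuous_id.sub uniformContinuous_const))
  · have e : ∀ ω, R ω * (g (ε * θ ω) (s - Real.log (R ω))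
        - g (ε * θ ω * η) (s - Real.log (R ω) - a))
        = R ω * g (ε * θ ω) (s - Real.log (R ω))
          - R ω * g (ε * η * θ ω) (s - a - Real.log (R ω)) := fun ω => by
      rw [mul_sub, mul_right_comm ε, sub_right_comm]
    simp only [e]
    rw [integral_sub (integrable_comp hc hC hR hRi hθ ε s)
      (integrable_comp hc hC hR hRi hθ (ε * η) (s - a)), h.eq ε s, h.eq (ε * η) (s - a)]
    ring
  · have h2 : Tendsto (fun s : ℝ => s - a) atTop atTop := tendsto_atTop_add_const_right _ (-a) tendsto_id
    simpa using (h.vanish ε).sub ((h.vanish (ε * η)).comp h2)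

/-- If a solution approaches its upper limit along a sequence, it also does so along the sequence
shifted by an essential value. -/
lemma tendsto_shift (h : IsRenewalSolution P R θ g ψ) (hR : Measurable R) (hR0 : ∀ ω, 0 ≤ R ω)
    (hRi : Integrable R P) (hR1 : ∫ ω, R ω ∂P = 1) (hθ : Measurable θ) {a : ℝ} {η : F}
    (ha : IsEssValue P R θ a η) {m : ℝ} (hm : ∀ κ > 0, ∀ ε, ∀ᶠ s in atTop, g ε s ≤ m + κ)
    {u : ℕ → F} {v : ℕ → ℝ} (hv : Tendsto v atTop atTop)
    (huv : Tendsto (fun n => g (u n) (v n)) atTop (𝓝 m)) :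
    Tendsto (fun n => g (u n * η) (v n - a)) atTop (𝓝 m) := by
  obtain ⟨C, hC⟩ := h.bounded
  have hc := fun ε => (h.uniformContinuous ε).continuous
  have hinteg := integrable_comp (P := P) hc hC hR hRi hθ
  have hsh : ∀ b : ℝ, Tendsto (fun n => v n - b) atTop atTop :=
    fun b => tendsto_atTop_add_const_right _ (-b) hv
  set V : ℕ → Ω → ℝ := fun n ω => R ω * (m - g (u n * θ ω) (v n - Real.log (R ω))) with hV
  have hVe : ∀ n, V n = fun ω => R ω * m - R ω * g (u n * θ ω) (v n - Real.log (R ω)) :=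
    fun n => by ext ω; simp only [hV]; ring
  have hVi : ∀ n, Integrable (V n) P := fun n => by
    rw [hVe]; exact (hRi.mul_const m).sub (hinteg _ _)
  have hψ : Tendsto (fun n => ψ (u n) (v n)) atTop (𝓝 0) := by
    refine tendsto_iff_forall_eventually_mem.2 fun S hS => ?_
    filter_upwards [hv.eventually (eventually_all.2 fun ε => (h.vanish ε).eventually hS)]
      with n hn using hn _
  have hV0 : Tendsto (fun n => ∫ ω, V n ω ∂P) atTop (𝓝 0) := by
    have e : ∀ n, ∫ ω, V n ω ∂P = m - g (u n) (v n) + ψ (u n) (v n) := fun n => by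
      rw [hVe, integral_sub (hRi.mul_const m) (hinteg _ _), integral_mul_const, hR1,
        h.eq (u n) (v n)]; ring
    simp only [e]
    simpa using (tendsto_const_nhds (x := m)).sub huv |>.add hψ
  have hneg : Tendsto (fun n => ∫ ω, max (-V n ω) 0 ∂P) atTop (𝓝 0) := by
    have hlim := tendsto_integral_of_dominated_convergence (μ := P)
      (F := fun n ω => max (-V n ω) 0) (f := fun _ => (0 : ℝ)) (fun ω => R ω * (|m| + C))
      (fun n => ((hVi n).neg.sup (integrable_const 0)).aestronglyMeasurable)
      (hRi.mul_const _) (fun n => Eventually.of_forall fun ω => ?_)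
      (Eventually.of_forall fun ω => ?_)
    · simpa using hlim
    · have h1 : |V n ω| ≤ R ω * (|m| + C) := by
        simp only [hV]
        rw [abs_mul, abs_of_nonneg (hR0 ω)]
        have := hR0 ω
        gcongr
        exact (abs_sub _ _).trans (by gcongr; exact hC _ _)
      rw [Real.norm_of_nonneg (le_max_right _ _)]
      exact max_le ((neg_le_abs _).trans h1) ((abs_nonneg _).trans h1)
    · rw [Metric.tendsto_atTop']
      intro κ hκ
      have hκ' : 0 < κ / (R ω + 1) := div_pos hκ (by linarith [hR0 ω])
      obtain ⟨N, hN⟩ := eventually_atTop.1 ((hsh (Real.log (R ω))).eventually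
        (eventually_all.2 fun ε => hm (κ / (R ω + 1)) hκ' ε))
      refine ⟨N, fun n hn => ?_⟩
      have h2 := hN n hn.le (u n * θ ω)
      have h3 : R ω * (κ / (R ω + 1)) < κ := by
        rw [mul_div_assoc', div_lt_iff₀ (by linarith [hR0 ω])]; nlinarith
      have h4 : -V n ω < κ := by
        refine lt_of_le_of_lt ?_ h3
        simp only [hV]
        rw [← mul_neg]
        exact mul_le_mul_of_nonneg_left (by linarith) (hR0 ω)
      rw [Real.dist_eq, sub_zero, abs_of_nonneg (le_max_right _ _)]
      exact max_lt h4 hκ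
  have hpos : Tendsto (fun n => ∫ ω, max (V n ω) 0 ∂P) atTop (𝓝 0) := by
    have e : ∀ n, ∫ ω, max (V n ω) 0 ∂P = ∫ ω, V n ω ∂P + ∫ ω, max (-V n ω) 0 ∂P := fun n => by
      have hni : Integrable (fun ω => max (-V n ω) 0) P := (hVi n).neg.sup (integrable_const 0)
      rw [← integral_add (hVi n) hni]
      refine integral_congr_ae (Eventually.of_forall fun ω => ?_)
      dsimp only
      rcases le_total 0 (V n ω) with h | h
      · rw [max_eq_left h, max_eq_right (by linarith)]; ring
      · rw [max_eq_right h, max_eq_left (by linarith)]; ring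
    simp only [e]
    simpa using hV0.add hneg
  rw [Metric.tendsto_atTop']
  intro κ hκ
  obtain ⟨ν, hν, hνg⟩ : ∃ ν > 0, ∀ ε x y, |x - y| < ν → |g ε x - g ε y| < κ / 2 := by
    choose ν hν hνg using fun ε => Metric.uniformContinuous_iff.1 (h.uniformContinuous ε) (κ / 2)
      (by linarith)
    obtain ⟨ε₀, hε₀⟩ := Finite.exists_min ν
    exact ⟨ν ε₀, hν ε₀, fun ε x y hxy => by
      simpa [Real.dist_eq] using hνg ε (a := x) (b := y) (by
        rw [Real.dist_eq]; exact hxy.trans_le (hε₀ ε))⟩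
  -- If g at the shifted point were at most m - κ, uniform continuity would give V ≥ Rκ/2 on this
  -- event of positive probability, against the decay of the positive part.
  set E₀ := {ω | 0 < R ω ∧ |Real.log (R ω) - a| < ν ∧ θ ω = η} with hE₀
  have hE₀m : MeasurableSet E₀ := by
    refine (measurableSet_lt measurable_const hR).inter (MeasurableSet.inter ?_ ?_)
    · exact measurableSet_lt (continuous_abs.measurable.comp
        ((Real.measurable_log.comp hR).sub_const a)) measurable_const
    · exact hθ (measurableSet_singleton η)
  have hq : 0 < ∫ ω in E₀, R ω * (κ / 2) ∂P := by
    rw [integral_mul_const]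
    refine mul_pos ?_ (by linarith)
    rw [setIntegral_pos_iff_support_of_nonneg_ae (Eventually.of_forall hR0) hRi.integrableOn]
    refine (ha ν hν).trans_le (measure_mono fun ω hω => ⟨hω.1.ne', hω⟩)
  obtain ⟨N₁, hN₁⟩ := eventually_atTop.1 (hpos.eventually (gt_mem_nhds hq))
  obtain ⟨N₂, hN₂⟩ := eventually_atTop.1 ((hsh a).eventually
        (eventually_all.2 fun ε => hm (κ / 2) (by linarith) ε))
  refine ⟨max N₁ N₂, fun n hn => ?_⟩
  have hn1 := hN₁ n ((le_max_left _ _).trans hn.le)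
  have hn2 := hN₂ n ((le_max_right _ _).trans hn.le) (u n * η)
  rw [Real.dist_eq, abs_lt]
  refine ⟨?_, by linarith⟩
  by_contra hlow
  have hlow : g (u n * η) (v n - a) ≤ m - κ := by linarith
  refine absurd hn1 (not_lt.2 ?_)
  have hVpi : Integrable (fun ω => max (V n ω) 0) P := (hVi n).sup (integrable_const 0)
  calc ∫ ω in E₀, R ω * (κ / 2) ∂P ≤ ∫ ω in E₀, max (V n ω) 0 ∂P := by
        refine setIntegral_mono_on (hRi.mul_const _).integrableOn hVpi.integrableOn hE₀m ?_
        intro ω hω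
        refine le_max_of_le_left (mul_le_mul_of_nonneg_left ?_ (hR0 ω))
        have h5 := hνg (u n * η) (v n - Real.log (R ω)) (v n - a) (by
          rw [sub_sub_sub_cancel_left, abs_sub_comm]; exact hω.2.1)
        rw [hω.2.2]
        linarith [(abs_lt.1 h5).2]
    _ ≤ ∫ ω, max (V n ω) 0 ∂P :=
        setIntegral_le_integral hVpi (Eventually.of_forall fun ω => le_max_right _ _)

/-- Let k be the difference of g and its translate, and m the upper limit of k over all ε. As k
solves a renewal equation, closeness to m along a sequence propagates to all multiples of the shift.
The sum of J successive values of k telescopes to a difference of two values of g, so J m ≤ 2C for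
every J, and m ≤ 0. -/
lemma eventually_sub_shift_le (h : IsRenewalSolution P R θ g ψ) (hR : Measurable R)
    (hR0 : ∀ ω, 0 ≤ R ω) (hRi : Integrable R P) (hR1 : ∫ ω, R ω ∂P = 1) (hθ : Measurable θ)
    {a : ℝ} {η : F} (ha : IsEssValue P R θ a η) {κ : ℝ} (hκ : 0 < κ) (ε : F) :
    ∀ᶠ s in atTop, g ε s - g (ε * η) (s - a) ≤ κ := by
  obtain ⟨C, hC⟩ := h.bounded
  have hk := h.sub_shift hR hRi hθ a η
  set k : F → ℝ → ℝ := fun ε s => g ε s - g (ε * η) (s - a) with hkdef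
  have hkC : ∀ ε s, |k ε s| ≤ 2 * C := fun ε s =>
    (abs_sub _ _).trans (by linarith [hC ε s, hC (ε * η) (s - a)])
  set S : Set ℝ := {b | ∀ ε, ∀ᶠ s in atTop, k ε s ≤ b} with hS
  have hSne : (2 * C) ∈ S := fun ε => Eventually.of_forall fun s => (abs_le.1 (hkC ε s)).2
  have hSbdd : BddBelow S := ⟨-(2 * C), fun b hb => by
    obtain ⟨s, hs⟩ := (hb 1).exists
    exact (abs_le.1 (hkC 1 s)).1.trans hs⟩
  set m := sInf S with hm
  have hup : ∀ κ > 0, ∀ ε, ∀ᶠ s in atTop, k ε s ≤ m + κ := by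
    intro κ hκ ε
    obtain ⟨b, hb, hb'⟩ := exists_lt_of_csInf_lt ⟨_, hSne⟩ (lt_add_of_pos_right m hκ)
    exact (hb ε).mono fun s hs => hs.trans hb'.le
  -- A sequence going to infinity along which k approaches its upper limit; the group component may
  -- vary with n.
  have hex : ∀ n : ℕ, ∃ p : F × ℝ, (n : ℝ) ≤ p.2 ∧ m - 1 / ((n : ℝ) + 1) < k p.1 p.2 := by
    intro n
    have h1 : m - 1 / ((n : ℝ) + 1) ∉ S := fun hmem => by
      have := csInf_le hSbdd hmem
      have h2 : 0 < 1 / ((n : ℝ) + 1) := by positivity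
      linarith
    rw [hS, mem_ofPred_eq] at h1
    push Not at h1
    obtain ⟨ε, hε⟩ := h1
    obtain ⟨s, hs, hs'⟩ := (hε.and_eventually (eventually_ge_atTop (n : ℝ))).exists
    exact ⟨(ε, s), hs', hs⟩
  choose p hp1 hp2 using hex
  have hv : Tendsto (fun n => (p n).2) atTop atTop :=
    tendsto_atTop_mono hp1 tendsto_natCast_atTop_atTop
  have huv : Tendsto (fun n => k (p n).1 (p n).2) atTop (𝓝 m) := by
    rw [tendsto_order]
    constructor
    · intro b hb
      have h1 : Tendsto (fun n : ℕ => m - 1 / ((n : ℝ) + 1)) atTop (𝓝 (m - 0)) :=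
        tendsto_const_nhds.sub tendsto_one_div_add_atTop_nhds_zero_nat
      rw [sub_zero] at h1
      filter_upwards [h1.eventually (lt_mem_nhds hb)] with n hn using hn.trans (hp2 n)
    · intro b hb
      filter_upwards [hv.eventually (eventually_all.2 fun ε => hup ((b - m) / 2) (by linarith) ε)]
        with n hn
      linarith [hn (p n).1]
  have hiter : ∀ j : ℕ, Tendsto (fun n => k ((p n).1 * η ^ j) ((p n).2 - j * a)) atTop (𝓝 m) := by
    intro j
    induction j with
    | zero => simpa using huv
    | succ j ih =>
      have := hk.tendsto_shift hR hR0 hRi hR1 hθ ha hup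
        (tendsto_atTop_add_const_right _ (-(j * a)) hv) ih
      refine this.congr fun n => ?_
      congr 1
      · rw [pow_succ, mul_assoc]
      · push_cast; ring
  have htel : ∀ J : ℕ, (J : ℝ) * m ≤ 2 * C := by
    intro J
    have h1 : Tendsto (fun n => ∑ j ∈ Finset.range J, k ((p n).1 * η ^ j) ((p n).2 - j * a)) atTop
        (𝓝 (∑ _j ∈ Finset.range J, m)) := tendsto_finsetSum _ fun j _ => hiter j
    rw [Finset.sum_const, Finset.card_range, nsmul_eq_mul] at h1
    refine le_of_tendsto' h1 fun n => ?_
    have h2 : ∑ j ∈ Finset.range J, k ((p n).1 * η ^ j) ((p n).2 - j * a)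
        = g (p n).1 (p n).2 - g ((p n).1 * η ^ J) ((p n).2 - J * a) := by
      have := Finset.sum_range_sub' (fun j : ℕ => g ((p n).1 * η ^ j) ((p n).2 - j * a)) J
      simp only [pow_zero, mul_one, Nat.cast_zero, zero_mul, sub_zero] at this
      rw [← this]
      refine Finset.sum_congr rfl fun j _ => ?_
      simp only [hkdef]
      congr 2
      · rw [pow_succ, mul_assoc]
      · push_cast; ring
    rw [h2]
    linarith [(abs_le.1 (hC (p n).1 (p n).2)).2,
      (abs_le.1 (hC ((p n).1 * η ^ J) ((p n).2 - J * a))).1]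
  have hm0 : m ≤ 0 := by
    by_contra hpos
    push Not at hpos
    obtain ⟨J, hJ⟩ := exists_nat_gt (2 * C / m)
    rw [div_lt_iff₀ hpos] at hJ
    linarith [htel J]
  exact (hup κ hκ ε).mono fun s hs => by linarith

theorem tendsto_sub_shift (h : IsRenewalSolution P R θ g ψ) (hR : Measurable R)
    (hR0 : ∀ ω, 0 ≤ R ω) (hRi : Integrable R P) (hR1 : ∫ ω, R ω ∂P = 1) (hθ : Measurable θ)
    {a : ℝ} {η : F} (ha : IsEssValue P R θ a η) (ε : F) :
    Tendsto (fun s => g ε s - g (ε * η) (s - a)) atTop (𝓝 0) := by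
  rw [Metric.tendsto_nhds]
  intro κ hκ
  filter_upwards [h.eventually_sub_shift_le hR hR0 hRi hR1 hθ ha (half_pos hκ) ε,
    h.neg.eventually_sub_shift_le hR hR0 hRi hR1 hθ ha (half_pos hκ) ε] with s h1 h2
  rw [Real.dist_eq, sub_zero, abs_lt]
  constructor <;> linarith

end IsRenewalSolution

end Renewal

/-! ### The renewal theorem on the product of the line and a finite group. -/

section Renewal

variable {Ω : Type*} [MeasurableSpace Ω] {P : Measure Ω} [IsProbabilityMeasure P] {R : Ω → ℝ}

/-- For each of the finitely many η, the law of log R restricted to {R > 0, θ = η} is carried by its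
topological support. -/
lemma ae_isEssValue {F : Type*} [Finite F] [MeasurableSpace F] [MeasurableSingletonClass F]
    {θ : Ω → F} (hR : Measurable R) (hθ : Measurable θ) :
    ∀ᵐ ω ∂P, 0 < R ω → IsEssValue P R θ (Real.log (R ω)) (θ ω) := by
  have hlog : Measurable fun ω => Real.log (R ω) := Real.measurable_log.comp hR
  have key : ∀ η : F, ∀ᵐ ω ∂P, ω ∈ {ω | 0 < R ω ∧ θ ω = η} →
      IsEssValue P R θ (Real.log (R ω)) η := by
    intro η
    have hE : MeasurableSet {ω | 0 < R ω ∧ θ ω = η} :=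
      (measurableSet_lt measurable_const hR).inter (hθ (measurableSet_singleton η))
    rw [← ae_restrict_iff' hE]
    set μ := (P.restrict {ω | 0 < R ω ∧ θ ω = η}).map fun ω => Real.log (R ω) with hμ
    have h1 : ∀ᵐ x ∂μ, x ∈ μ.support := Measure.support_mem_ae
    have h2 := ae_of_ae_map hlog.aemeasurable h1
    filter_upwards [h2] with ω hω ν hν
    have h3 := Metric.nhds_basis_ball.mem_measureSupport.1 hω ν hν
    rw [hμ, Measure.map_apply hlog measurableSet_ball,
      Measure.restrict_apply (hlog measurableSet_ball)] at h3
    refine h3.trans_le (measure_mono fun ω' h => ?_)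
    exact ⟨h.2.1, by simpa [Real.dist_eq] using h.1, h.2.2⟩
  filter_upwards [eventually_countable_forall.2 key] with ω hω h0 using hω (θ ω) ⟨h0, rfl⟩

lemma setIntegral_comp_sub_right_Iic (s : ℝ) (g : ℝ → ℝ) (a : ℝ) :
    ∫ r in Iic s, g (r - a) = ∫ r in Iic (s - a), g r := by
  rw [← integral_indicator measurableSet_Iic, ← integral_indicator measurableSet_Iic,
    ← integral_sub_right_eq_self ((Iic (s - a)).indicator g) a]
  congr 1; ext r
  simp [indicator]

/-- The limit in the renewal equation, for solutions that are asymptotically shift invariant. -/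
lemma tendsto_of_asymptotically_invariant {g ψ : ℝ → ℝ} (hR : Measurable R) (hR0 : ∀ ω, 0 ≤ R ω)
    (hRi : Integrable R P) (hR1 : ∫ ω, R ω ∂P = 1) (hne : ¬ ∀ᵐ ω ∂P, R ω = 1)
    (hRl : Integrable (fun ω => R ω * Real.log (R ω)) P)
    (hgc : Continuous g) {C : ℝ} (hC : ∀ s, |g s| ≤ C) (hexp : ∀ s, |g s| ≤ C * Real.exp s)
    (heq : ∀ s, g s = ∫ ω, R ω * g (s - Real.log (R ω)) ∂P + ψ s)
    (hinv : ∀ a, Tendsto (fun s => g s - g (s - a)) atTop (𝓝 0))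
    (hψ : Integrable ψ) : ∃ L, Tendsto g atTop (𝓝 L) := by
  set m := ∫ ω, R ω * Real.log (R ω) ∂P with hm
  have hm0 : 0 < m := integral_mul_log_pos hR0 hRi hR1 hne hRl
  have hC0 : 0 ≤ C := (abs_nonneg _).trans (hC 0)
  have hlog : Measurable fun ω => Real.log (R ω) := Real.measurable_log.comp hR
  have hgI : ∀ s, IntegrableOn g (Iic s) := fun s =>
    ((integrableOn_exp_Iic s).const_mul C).mono' hgc.aestronglyMeasurable
      (Eventually.of_forall hexp)
  -- The primitive from -∞ exists because |g s| ≤ C e^s.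
  set G : ℝ → ℝ := fun s => ∫ r in Iic s, g r with hG
  have hGsub : ∀ s a, G s - G (s - a) = ∫ r in (s - a)..s, g r := fun s a =>
    intervalIntegral.integral_Iic_sub_Iic (hgI _) (hgI _)
  have hGc : Continuous G := by
    have : G = fun s => G 0 + ∫ r in (0 : ℝ)..s, g r := by
      ext s
      have := hGsub s s
      rw [sub_self] at this
      linarith
    rw [this]
    exact continuous_const.add (intervalIntegral.continuous_primitive
      (fun a b => hgc.intervalIntegrable a b) 0)
  have hGabs : ∀ s a, |G s - G (s - a)| ≤ C * |a| := fun s a => by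
    rw [hGsub]
    have := intervalIntegral.norm_integral_le_of_norm_le_const (f := g) (a := s - a) (b := s)
      (C := C) fun x _ => hC x
    simpa using this
  -- the integrated renewal equation
  have hinteg : ∀ s, ∫ ω, R ω * (G s - G (s - Real.log (R ω))) ∂P = ∫ r in Iic s, ψ r := by
    intro s
    have hFub : Integrable (fun p : ℝ × Ω => R p.2 * g (p.1 - Real.log (R p.2)))
        ((volume.restrict (Iic s)).prod P) := by
      have hdom : Integrable (fun p : ℝ × Ω => (C * Real.exp p.1) * (1 : ℝ))
          ((volume.restrict (Iic s)).prod P) :=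
        ((integrableOn_exp_Iic s).const_mul C).mul_prod (integrable_const (μ := P) (1 : ℝ))
      refine hdom.mono' (Measurable.aestronglyMeasurable ?_) (Eventually.of_forall fun p => ?_)
      · have := hgc.measurable
        fun_prop
      · rw [norm_mul, Real.norm_of_nonneg (hR0 _), Real.norm_eq_abs, mul_one]
        rcases (hR0 p.2).eq_or_lt with h | h
        · rw [← h, zero_mul]; positivity
        · refine (mul_le_mul_of_nonneg_left (hexp _) h.le).trans (le_of_eq ?_)
          rw [Real.exp_sub, Real.exp_log h]; field_simp
    have e1 : ∫ r in Iic s, ∫ ω, R ω * g (r - Real.log (R ω)) ∂P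
        = ∫ ω, R ω * G (s - Real.log (R ω)) ∂P := by
      rw [integral_integral_swap hFub]
      refine integral_congr_ae (Eventually.of_forall fun ω => ?_)
      dsimp only
      rw [integral_const_mul]
      congr 1
      have := setIntegral_comp_sub_right_Iic s g (Real.log (R ω))
      exact this
    have e2 : ∫ r in Iic s, ψ r = G s - ∫ ω, R ω * G (s - Real.log (R ω)) ∂P := by
      rw [← e1, hG]
      dsimp only
      rw [← integral_sub (hgI s) hFub.integral_prod_left]
      refine integral_congr_ae (Eventually.of_forall fun r => ?_)
      dsimp only
      linarith [heq r]
    have hGi : Integrable (fun ω => R ω * G (s - Real.log (R ω))) P := by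
      have h1 := hFub.integral_prod_right
      refine h1.congr (Eventually.of_forall fun ω => ?_)
      dsimp only
      rw [integral_const_mul]
      congr 1
      exact setIntegral_comp_sub_right_Iic s g (Real.log (R ω))
    have e3 : ∀ ω, R ω * (G s - G (s - Real.log (R ω)))
        = R ω * G s - R ω * G (s - Real.log (R ω)) := fun ω => mul_sub _ _ _
    simp only [e3]
    rw [integral_sub (hRi.mul_const _) hGi, integral_mul_const, hR1, one_mul, e2]
  -- Asymptotic invariance makes g nearly constant on [s - a, s] in the mean, so the increment of G
  -- is a g(s) + o(1).
  have hpt : ∀ a, Tendsto (fun s => G s - G (s - a) - a * g s) atTop (𝓝 0) := by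
    intro a
    have e : ∀ s, G s - G (s - a) - a * g s = ∫ v in (0 : ℝ)..a, (g (s - v) - g s) := fun s => by
      rw [hGsub, intervalIntegral.integral_sub
        (Continuous.intervalIntegrable (by fun_prop) _ _)
        (intervalIntegrable_const)]
      simp
    simp only [e]
    have := intervalIntegral.tendsto_integral_filter_of_dominated_convergence
      (μ := volume) (a := 0) (b := a) (l := (atTop : Filter ℝ))
      (F := fun s v => g (s - v) - g s) (f := fun _ => (0 : ℝ)) (fun _ => C + C)
      (Eventually.of_forall fun s => Continuous.aestronglyMeasurable (by fun_prop))
      (Eventually.of_forall fun s => Eventually.of_forall fun v _ =>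
        (abs_sub _ _).trans (add_le_add (hC _) (hC _)))
      intervalIntegrable_const
      (Eventually.of_forall fun v _ => by simpa using (hinv v).neg)
    simpa using this
  -- The increments of G over a length |a| are at most C|a|, so 2C|R log R| dominates.
  have hmain : Tendsto (fun s => ∫ ω, R ω * (G s - G (s - Real.log (R ω)) - Real.log (R ω) * g s) ∂P)
      atTop (𝓝 0) := by
    have := tendsto_integral_filter_of_dominated_convergence (μ := P) (l := (atTop : Filter ℝ))
      (F := fun s ω => R ω * (G s - G (s - Real.log (R ω)) - Real.log (R ω) * g s))
      (f := fun _ => (0 : ℝ)) (fun ω => 2 * C * |R ω * Real.log (R ω)|)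
      (Eventually.of_forall fun s => Measurable.aestronglyMeasurable (by
        have := hGc.measurable; fun_prop))
      (Eventually.of_forall fun s => Eventually.of_forall fun ω => ?_)
      (hRl.abs.const_mul _) (Eventually.of_forall fun ω => ?_)
    · simpa using this
    · rw [Real.norm_eq_abs, abs_mul, abs_mul, mul_left_comm]
      gcongr
      refine (abs_sub _ _).trans ?_
      rw [abs_mul]
      have h1 := hGabs s (Real.log (R ω))
      have h2 := mul_le_mul_of_nonneg_left (hC s) (abs_nonneg (Real.log (R ω)))
      linarith
    · simpa using (hpt (Real.log (R ω))).const_mul (R ω)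
  have hΨ : Tendsto (fun s => ∫ r in Iic s, ψ r) atTop (𝓝 (∫ r, ψ r)) := by
    exact (aecover_Iic tendsto_id).integral_tendsto_of_countably_generated hψ
  -- The left side of the integrated equation is m g(s) + o(1), and its right side tends to the
  -- total charge.
  refine ⟨m⁻¹ * ∫ r, ψ r, ?_⟩
  have e : ∀ s, g s = m⁻¹ * ((∫ r in Iic s, ψ r)
      - ∫ ω, R ω * (G s - G (s - Real.log (R ω)) - Real.log (R ω) * g s) ∂P) := fun s => by
    have hi1 : Integrable (fun ω => R ω * (G s - G (s - Real.log (R ω)))) P := by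
      refine (hRl.abs.const_mul C).mono' (Measurable.aestronglyMeasurable (by
        have := hGc.measurable; fun_prop)) (Eventually.of_forall fun ω => ?_)
      rw [Real.norm_eq_abs, abs_mul, abs_mul, mul_left_comm]
      gcongr
      exact hGabs _ _
    have e3 : ∀ ω, R ω * (G s - G (s - Real.log (R ω)) - Real.log (R ω) * g s)
        = R ω * (G s - G (s - Real.log (R ω))) - R ω * Real.log (R ω) * g s :=
      fun ω => by ring
    simp only [e3]
    rw [integral_sub hi1 (hRl.mul_const _), hinteg, integral_mul_const, ← hm, sub_sub_cancel,
      inv_mul_cancel_left₀ hm0.ne']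
  rw [funext e]
  simpa using (hΨ.sub hmain).const_mul m⁻¹

/-- Renewal theorem on the product of the line and a finite commutative group. -/
theorem IsRenewalSolution.exists_tendsto {F : Type*} [CommGroup F] [Finite F] [MeasurableSpace F]
    [MeasurableSingletonClass F] {θ : Ω → F} {g ψ : F → ℝ → ℝ}
    (h : IsRenewalSolution P R θ g ψ) (hR : Measurable R) (hR0 : ∀ ω, 0 ≤ R ω)
    (hRi : Integrable R P) (hR1 : ∫ ω, R ω ∂P = 1) (hθ : Measurable θ)
    (hRl : Integrable (fun ω => R ω * Real.log (R ω)) P)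
    (hna : ¬ ∃ b : ℝ, 0 < b ∧ ∀ᵐ ω ∂P, 0 < R ω → Real.log (R ω) ∈ AddSubgroup.zmultiples b)
    (hexp : ∃ C, ∀ ε s, |g ε s| ≤ C * Real.exp s) (hψ : ∀ ε, Integrable (ψ ε)) (ε : F) :
    ∃ L, Tendsto (g ε) atTop (𝓝 L) := by
  have hess := ae_isEssValue (P := P) hR hθ
  have hshift := fun {a : ℝ} {η : F} (ha : IsEssValue P R θ a η) =>
    h.tendsto_sub_shift hR hR0 hRi hR1 hθ ha
  have hne : ¬ ∀ᵐ ω ∂P, R ω = 1 := fun h1 => hna ⟨1, one_pos, h1.mono fun ω hω _ => by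
    rw [hω, Real.log_one]; exact zero_mem _⟩
  have hsh : ∀ a : ℝ, Tendsto (fun s : ℝ => s - a) atTop atTop :=
    fun a => tendsto_atTop_add_const_right _ (-a) tendsto_id
  have hsh' : ∀ a : ℝ, Tendsto (fun s : ℝ => s + a) atTop atTop :=
    fun a => tendsto_atTop_add_const_right _ a tendsto_id
  -- The real translations that are asymptotic periods for every ε; uniform continuity makes this
  -- subgroup closed.
  let H : AddSubgroup ℝ :=
    { carrier := {a | ∀ ε, Tendsto (fun s => g ε s - g ε (s - a)) atTop (𝓝 0)}
      zero_mem' := fun ε => by simp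
      add_mem' := fun {a b} ha hb ε => by
        have := (ha ε).add ((hb ε).comp (hsh a))
        simpa [Function.comp_def, sub_sub] using this
      neg_mem' := fun {a} ha ε => by
        have := ((ha ε).comp (hsh' a)).neg
        simpa [Function.comp_def] using this }
  have hHcl : IsClosed (H : Set ℝ) := by
    refine isClosed_of_closure_subset fun a ha ε => ?_
    rw [Metric.tendsto_nhds]
    intro κ hκ
    obtain ⟨ν, hν, hνg⟩ := Metric.uniformContinuous_iff.1 (h.uniformContinuous ε) (κ / 2)
      (by linarith)
    obtain ⟨b, hb, hab⟩ := Metric.mem_closure_iff.1 ha ν hν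
    filter_upwards [Metric.tendsto_nhds.1 (hb ε) (κ / 2) (by linarith)] with s hs
    have h1 := hνg (a := s - b) (b := s - a) (by
      rw [Real.dist_eq] at hab ⊢; simpa using hab)
    rw [Real.dist_eq] at h1 hs ⊢
    rw [sub_zero] at hs ⊢
    calc |g ε s - g ε (s - a)| = |(g ε s - g ε (s - b)) + (g ε (s - b) - g ε (s - a))| := by
          congr 1; ring
      _ ≤ _ := abs_add_le _ _
      _ < κ := by linarith
  have hpow : ∀ {a : ℝ} {η : F}, IsEssValue P R θ a η → ∀ (n : ℕ) (ε : F),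
      Tendsto (fun s => g ε s - g (ε * η ^ n) (s - n * a)) atTop (𝓝 0) := by
    intro a η ha n
    induction n with
    | zero => intro ε; simp
    | succ n ih =>
      intro ε
      have h1 := (ih ε).add ((hshift ha (ε * η ^ n)).comp (hsh (n * a)))
      rw [add_zero] at h1
      refine h1.congr fun s => ?_
      simp only [Function.comp_apply, pow_succ, mul_assoc]
      rw [sub_add_sub_cancel]
      congr 2
      push_cast; ring
  -- η raised to the order of F is 1, so that many steps (a, η) amount to a pure translation.
  have hcard : ∀ {a : ℝ} {η : F}, IsEssValue P R θ a η → (Nat.card F : ℝ) * a ∈ H := by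
    intro a η ha ε
    simpa using hpow ha (Nat.card F) ε
  have hcard0 : (0 : ℝ) < Nat.card F := by exact_mod_cast Nat.card_pos
  have hHtop : ∀ a, a ∈ H := by
    -- If H were cyclic, generated by b, then |F| log R would lie in bℤ almost surely on R > 0, so
    -- log R would be arithmetic with step |b|/|F|, or zero when b = 0.
    rcases H.dense_or_cyclic with hd | ⟨b, hb⟩
    · intro a
      have := hHcl.closure_eq ▸ hd a
      exact this
    · exfalso
      have hlogmem : ∀ᵐ ω ∂P, 0 < R ω → ∃ z : ℤ, (z : ℝ) * b = Nat.card F * Real.log (R ω) := by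
        filter_upwards [hess] with ω hω h0
        have h1 := hcard (hω h0)
        rw [hb, AddSubgroup.mem_closure_singleton] at h1
        simpa using h1
      rcases eq_or_ne b 0 with hb0 | hb0
      · refine hna ⟨1, one_pos, hlogmem.mono fun ω hω h0 => ?_⟩
        obtain ⟨z, hz⟩ := hω h0
        rw [hb0, mul_zero, eq_comm, mul_eq_zero, or_iff_right hcard0.ne'] at hz
        rw [hz]; exact zero_mem _
      · refine hna ⟨|b| / Nat.card F, by positivity, hlogmem.mono fun ω hω h0 => ?_⟩
        obtain ⟨z, hz⟩ := hω h0
        have h2 : Real.log (R ω) = z * (b / Nat.card F) := by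
          rw [mul_div_assoc', hz, mul_div_cancel_left₀ _ hcard0.ne']
        rcases abs_choice b with hab | hab
        · rw [hab, AddSubgroup.mem_zmultiples_iff]
          exact ⟨z, by rw [h2]; simp⟩
        · rw [hab, AddSubgroup.mem_zmultiples_iff]
          exact ⟨-z, by rw [h2]; simp; ring⟩
  -- With all translations now available, a step (a, η) can be stripped of its real part, and η
  -- alone is an asymptotic period.
  let K : Subgroup F :=
    { carrier := {η | ∀ ε, Tendsto (fun s => g ε s - g (ε * η) s) atTop (𝓝 0)}
      one_mem' := fun ε => by simp
      mul_mem' := fun {a b} ha hb ε => by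
        have := (ha ε).add (hb (ε * a))
        simpa [mul_assoc] using this
      inv_mem' := fun {a} ha ε => by
        have := (ha (ε * a⁻¹)).neg
        simpa using this }
  have hK : ∀ {a : ℝ} {η : F}, IsEssValue P R θ a η → η ∈ K := by
    intro a η ha ε
    have := (hshift ha ε).sub (hHtop a (ε * η))
    simpa using this
  have := Fintype.ofFinite K
  obtain ⟨C, hC⟩ := h.bounded
  obtain ⟨C', hC'⟩ := hexp
  have hc := fun ε => (h.uniformContinuous ε).continuous
  have hinteg := IsRenewalSolution.integrable_comp (P := P) hc hC hR hRi hθ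
  have hcardK : (0 : ℝ) < Fintype.card K := by exact_mod_cast Fintype.card_pos
  have hC'0 : 0 ≤ C' := by
    have := (abs_nonneg _).trans (hC' 1 0)
    simpa using this
  -- Almost surely on R > 0, multiplication by θ permutes the coset εK, so the sum over the coset
  -- solves a scalar renewal equation. Its terms are asymptotically equal, and each converges to the
  -- limit divided by |K|.
  have hex : ∃ L, Tendsto (fun s => ∑ η : K, g (ε * η) s) atTop (𝓝 L) := by
    refine tendsto_of_asymptotically_invariant (P := P) (R := R)
      (g := fun s => ∑ η : K, g (ε * η) s) (ψ := fun s => ∑ η : K, ψ (ε * η) s)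
      (C := Fintype.card K * max C C')
      hR hR0 hRi hR1 hne hRl (continuous_finsetSum _ fun η _ => hc _) (fun s => ?_) (fun s => ?_)
      (fun s => ?_) (fun a => ?_) (integrable_finsetSum _ fun η _ => hψ _)
    · refine (Finset.abs_sum_le_sum_abs _ _).trans ?_
      refine (Finset.sum_le_sum fun (η : K) _ => (hC (ε * η) s).trans (le_max_left C C')).trans ?_
      simp
    · refine (Finset.abs_sum_le_sum_abs _ _).trans ?_
      refine (Finset.sum_le_sum fun (η : K) _ => (hC' (ε * η) s).trans
        (mul_le_mul_of_nonneg_right (le_max_right C C') (Real.exp_pos _).le)).trans ?_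
      simp [mul_assoc]
    · have hsum := Finset.sum_congr (rfl : (Finset.univ : Finset K) = Finset.univ) fun (η : K) _ => h.eq (ε * η) s
      rw [hsum, Finset.sum_add_distrib,
        ← integral_finsetSum _ fun η _ => hinteg _ _]
      congr 1
      refine integral_congr_ae ?_
      filter_upwards [hess] with ω hω
      rcases (hR0 ω).eq_or_lt with h0 | h0
      · simp [← h0]
      · rw [← Finset.mul_sum]
        congr 1
        refine Fintype.sum_equiv (Equiv.mulRight (⟨θ ω, hK (hω h0)⟩ : K)) _ _ fun η => ?_
        simp [mul_assoc]
    · have h1 : Tendsto (fun s => ∑ η : K, (g (ε * η) s - g (ε * η) (s - a))) atTop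
          (𝓝 (∑ _η : K, (0 : ℝ))) := tendsto_finsetSum _ fun η _ => hHtop a _
      simpa [Finset.sum_sub_distrib] using h1
  obtain ⟨L, hL⟩ := hex
  refine ⟨(Fintype.card K : ℝ)⁻¹ * (L + 0), ?_⟩
  have h1 : Tendsto (fun s => ∑ η : K, (g ε s - g (ε * η) s)) atTop (𝓝 (∑ _η : K, (0 : ℝ))) :=
    tendsto_finsetSum _ fun η _ => η.2 ε
  rw [Finset.sum_const_zero] at h1
  refine ((hL.add h1).const_mul _).congr fun s => ?_
  rw [← Finset.sum_add_distrib]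
  simp

end Renewal

/-! ### Signs of the coordinates as a finite group. -/

section Signs

variable {ι : Type*} [Fintype ι] {α : ι → ℝ}

instance : MeasurableSingletonClass ℤˣ where
  measurableSet_singleton u := ⟨{(u : ℤ)}, measurableSet_singleton _, by
    ext v; simp [Units.ext_iff]⟩

/-- The sign of a real number, as a unit of `ℤ`. -/
def signUnit (a : ℝ) : ℤˣ := if a < 0 then -1 else 1

lemma measurable_signUnit : Measurable signUnit :=
  Measurable.ite measurableSet_Iio measurable_const measurable_const

lemma signUnit_mul_abs (a : ℝ) : ((signUnit a : ℤ) : ℝ) * |a| = a := by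
  unfold signUnit
  split_ifs with h
  · simp [abs_of_neg h]
  · simp [abs_of_nonneg (not_lt.1 h)]

lemma abs_intUnit_cast (u : ℤˣ) : |((u : ℤ) : ℝ)| = 1 := by
  rcases Int.units_eq_one_or u with h | h <;> simp [h]

/-- Change of the signs of the coordinates. -/
def flip (ε : ι → ℤˣ) (x : ι → ℝ) : ι → ℝ := fun i => ((ε i : ℤ) : ℝ) * x i

lemma continuous_flip (ε : ι → ℤˣ) : Continuous (flip ε) :=
  continuous_pi fun i => continuous_const.mul (continuous_apply i)

lemma anorm_flip (ε : ι → ℤˣ) (x : ι → ℝ) : anorm α (flip ε x) = anorm α x := by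
  simp [anorm, flip, abs_mul, abs_intUnit_cast]

lemma flip_flip (ε ε' : ι → ℤˣ) (x : ι → ℝ) : flip ε (flip ε' x) = flip (ε * ε') x := by
  ext i; simp [flip, mul_assoc]

lemma flip_sub (ε : ι → ℤˣ) (x y : ι → ℝ) : flip ε (x - y) = flip ε x - flip ε y := by
  ext i; simp [flip, mul_sub]

lemma flip_one (x : ι → ℝ) : flip 1 x = x := by ext i; simp [flip]

lemma dil_flip (t : ℝ) (ε : ι → ℤˣ) (x : ι → ℝ) : dil α t (flip ε x) = flip ε (dil α t x) :=
  dil_mul t _ x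

/-- Multiplication by a vector with a common value `R` of `|a_i| ^ α_i` is a dilation composed
with a change of signs. -/
lemma mul_eq_dil_flip (hα : ∀ i, 0 < α i) {a : ι → ℝ} {R : ℝ} (ha : ∀ i, |a i| ^ α i = R)
    (x : ι → ℝ) : (fun i => a i * x i) = dil α R (flip (fun i => signUnit (a i)) x) := by
  ext i
  simp only [dil, flip]
  rw [← ha i, ← Real.rpow_mul (abs_nonneg _), mul_one_div_cancel (hα i).ne', Real.rpow_one,
    ← mul_assoc, mul_comm |a i|, signUnit_mul_abs]

end Signs

/-! ### One block: rescaled means and moments of order below one. -/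

section Block

variable {Ω : Type*} [MeasurableSpace Ω] {P : Measure Ω} [IsProbabilityMeasure P]
  {ι : Type*} [Fintype ι] {α : ι → ℝ}

/-- A stochastic recursion `X = A X + B` in law, with a diagonal `A` for which the
`|A_i| ^ α_i` have a common value `R`. -/
structure IsBlockSRE (P : Measure Ω) (α : ι → ℝ) (X A B : Ω → ι → ℝ) (R : Ω → ℝ) : Prop where
  pos : ∀ i, 0 < α i
  measX : Measurable X
  measA : Measurable A
  measB : Measurable B
  measR : Measurable R
  law : P.map X = P.map fun ω => (fun i => A ω i * X ω i) + B ω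
  indep : IndepFun A X P
  indepR : IndepFun R X P
  nonneg : ∀ ω, 0 ≤ R ω
  eqR : ∀ᵐ ω ∂P, ∀ i, |A ω i| ^ α i = R ω
  integrable : Integrable R P
  mean : ∫ ω, R ω ∂P = 1
  integrable_log : Integrable (fun ω => R ω * Real.log (R ω)) P
  nonarith : ¬ ∃ b : ℝ, 0 < b ∧ ∀ᵐ ω ∂P, 0 < R ω → Real.log (R ω) ∈ AddSubgroup.zmultiples b
  moment : ∃ σ : ℝ, 0 < σ ∧ Integrable (fun ω => anorm α (B ω) ^ (1 + σ)) P

/-- Bounded continuous functions supported in `{|x|_α ≥ r}` and Hölder for `|·|_α`. -/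
structure IsHolderTest (α : ι → ℝ) (η C L r : ℝ) (f : (ι → ℝ) → ℝ) : Prop where
  continuous : Continuous f
  bound : ∀ x, |f x| ≤ C
  pos : 0 < r
  supp : ∀ x, f x ≠ 0 → r ≤ anorm α x
  holder : ∀ x y, |f x - f y| ≤ L * anorm α (x - y) ^ η

lemma IsHolderTest.flip {η C L r : ℝ} {f : (ι → ℝ) → ℝ} (hf : IsHolderTest α η C L r f)
    (ε : ι → ℤˣ) : IsHolderTest α η C L r fun x => f (flip ε x) where
  continuous := hf.continuous.comp (continuous_flip ε)
  bound x := hf.bound _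
  pos := hf.pos
  supp x hx := by simpa [anorm_flip] using hf.supp _ hx
  holder x y := by
    have := hf.holder (DiagonalSRE.flip ε x) (DiagonalSRE.flip ε y)
    rwa [← flip_sub, anorm_flip] at this

/-- The function `s ↦ e^s E f(δ_{e^{-s}} X)`. -/
def scaled (P : Measure Ω) (α : ι → ℝ) (X : Ω → ι → ℝ) (f : (ι → ℝ) → ℝ) (s : ℝ) : ℝ :=
  Real.exp s * ∫ ω, f (dil α (Real.exp (-s)) (X ω)) ∂P

lemma integrable_comp_dil {X : Ω → ι → ℝ} (hX : Measurable X) {f : (ι → ℝ) → ℝ}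
    (hf : Continuous f) {C : ℝ} (hC : ∀ x, |f x| ≤ C) (t : ℝ) :
    Integrable (fun ω => f (dil α t (X ω))) P :=
  Integrable.of_bound
    ((hf.measurable.comp (continuous_dil t).measurable).comp hX).aestronglyMeasurable C
    (Eventually.of_forall fun _ => hC _)

lemma abs_scaled_le_exp {X : Ω → ι → ℝ} {f : (ι → ℝ) → ℝ}
    {C : ℝ} (hC : ∀ x, |f x| ≤ C) (s : ℝ) : |scaled P α X f s| ≤ C * Real.exp s := by
  rw [scaled, abs_mul, abs_of_pos (Real.exp_pos s), mul_comm C]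
  gcongr
  have := norm_integral_le_of_norm_le_const (μ := P)
    (f := fun ω => f (dil α (Real.exp (-s)) (X ω))) (C := C) (Eventually.of_forall fun ω => hC _)
  simpa using this

lemma continuous_scaled {X : Ω → ι → ℝ} (hX : Measurable X) {f : (ι → ℝ) → ℝ}
    (hf : Continuous f) {C : ℝ} (hC : ∀ x, |f x| ≤ C) : Continuous (scaled P α X f) := by
  refine Real.continuous_exp.mul (continuous_of_dominated (bound := fun _ => C)
    (fun s => (integrable_comp_dil hX hf hC _).aestronglyMeasurable)
    (fun s => Eventually.of_forall fun ω => hC _) (integrable_const C)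
    (Eventually.of_forall fun ω => ?_))
  refine hf.comp (continuous_pi fun i => ?_)
  refine Continuous.mul ?_ continuous_const
  exact (Real.continuous_exp.comp continuous_neg).rpow_const fun s => Or.inl (Real.exp_ne_zero _)

/-- A function supported in `{|x|_α ≥ r}` is controlled by the tail of `|X|_α`. -/
lemma abs_scaled_le_tail {X : Ω → ι → ℝ} (hα : ∀ i, 0 < α i) (hX : Measurable X)
    {f : (ι → ℝ) → ℝ} {C r : ℝ} (hC : ∀ x, |f x| ≤ C) (hr : ∀ x, f x ≠ 0 → r ≤ anorm α x)
    (s : ℝ) :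
    |scaled P α X f s| ≤ C * (Real.exp s * P.real {ω | r * Real.exp s ≤ anorm α (X ω)}) := by
  have hC0 : 0 ≤ C := (abs_nonneg _).trans (hC 0)
  set E := {ω | r * Real.exp s ≤ anorm α (X ω)} with hE
  have hEm : MeasurableSet E := measurableSet_le measurable_const ((measurable_anorm hα).comp hX)
  rw [scaled, abs_mul, abs_of_pos (Real.exp_pos s), mul_left_comm]
  gcongr
  calc |∫ ω, f (dil α (Real.exp (-s)) (X ω)) ∂P|
      ≤ ∫ ω, E.indicator (fun _ => C) ω ∂P := by
        rw [← Real.norm_eq_abs]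
        refine norm_integral_le_of_norm_le ((integrable_const (μ := P) C).indicator hEm)
          (Eventually.of_forall fun ω => ?_)
        by_cases hω : ω ∈ E
        · rw [indicator_of_mem hω]; exact hC _
        · rw [indicator_of_notMem hω]
          have : f (dil α (Real.exp (-s)) (X ω)) = 0 := by
            by_contra hne
            apply hω
            have := hr _ hne
            rw [anorm_dil hα (Real.exp_pos _).le, Real.exp_neg, inv_mul_eq_div,
              le_div_iff₀ (Real.exp_pos _)] at this
            exact this
          simp [this]
    _ = C * P.real E := by
        rw [integral_indicator hEm, setIntegral_const, smul_eq_mul, mul_comm]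

namespace IsBlockSRE

variable {X A B : Ω → ι → ℝ} {R : Ω → ℝ}

lemma ne_one (h : IsBlockSRE P α X A B R) : ¬ ∀ᵐ ω ∂P, R ω = 1 := fun h1 =>
  h.nonarith ⟨1, one_pos, h1.mono fun ω hω _ => by rw [hω, Real.log_one]; exact zero_mem _⟩

lemma measAX (h : IsBlockSRE P α X A B R) : Measurable fun ω i => A ω i * X ω i :=
  measurable_pi_iff.2 fun i => (measurable_pi_iff.1 h.measA i).mul (measurable_pi_iff.1 h.measX i)

lemma measAXB (h : IsBlockSRE P α X A B R) : Measurable fun ω => (fun i => A ω i * X ω i) + B ω :=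
  h.measAX.add h.measB

lemma ae_anorm_mul (h : IsBlockSRE P α X A B R) :
    ∀ᵐ ω ∂P, anorm α (fun i => A ω i * X ω i) = R ω * anorm α (X ω) :=
  h.eqR.mono fun ω hω => anorm_mul_of_eq (h.nonneg ω) hω (X ω)

lemma integrable_anormB_rpow (h : IsBlockSRE P α X A B R) {β : ℝ} (hβ : 0 ≤ β) (hβ1 : β ≤ 1) :
    Integrable (fun ω => anorm α (B ω) ^ β) P := by
  obtain ⟨σ, hσ, hi⟩ := h.moment
  refine ((integrable_const (1 : ℝ)).add hi).mono'
    (((measurable_anorm h.pos).comp h.measB).pow_const _).aestronglyMeasurable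
    (Eventually.of_forall fun ω => ?_)
  have h0 := anorm_nonneg α (B ω)
  rw [Real.norm_of_nonneg (Real.rpow_nonneg h0 _)]
  simp only [Pi.add_apply]
  rcases le_total (anorm α (B ω)) 1 with h1 | h1
  · have := Real.rpow_le_one h0 h1 hβ
    have := Real.rpow_nonneg h0 (1 + σ)
    linarith
  · have := Real.rpow_le_rpow_of_exponent_le h1 (show β ≤ 1 + σ by linarith)
    linarith

/-- Moments of order below the critical one. -/
theorem integrable_rpow (h : IsBlockSRE P α X A B R) {β : ℝ} (hβ : 0 < β) (hβ1 : β < 1) :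
    Integrable (fun ω => anorm α (X ω) ^ β) P := by
  obtain ⟨hRβ, hRβ1⟩ := integral_rpow_lt_one h.measR h.nonneg h.integrable h.mean h.ne_one hβ hβ1
  set ρ := ∫ ω, R ω ^ β ∂P with hρ
  have hρ0 : 0 ≤ ρ := integral_nonneg fun ω => Real.rpow_nonneg (h.nonneg ω) _
  -- With this choice (1 + (1 - ρ)/2) ρ < 1, because (1 - ρ)(2 - ρ) > 0.
  obtain ⟨C, hC0, hC⟩ := exists_anorm_add_le h.pos (ε := (1 - ρ) / 2) (by linarith)
  have hN := measurable_anorm h.pos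
  refine integrable_of_le_mul_add (P := P) (U := fun ω => anorm α (X ω) ^ β)
    (U' := fun ω => anorm α ((fun i => A ω i * X ω i) + B ω) ^ β)
    (R := fun ω => (1 + (1 - ρ) / 2) * R ω ^ β) (V := fun ω => C ^ β * anorm α (B ω) ^ β)
    ((hN.comp h.measX).pow_const _) ((hN.comp h.measAXB).pow_const _)
    ((h.measR.pow_const _).const_mul _) (((hN.comp h.measB).pow_const _).const_mul _)
    (fun ω => Real.rpow_nonneg (anorm_nonneg _ _) _)
    (fun ω => mul_nonneg (by linarith) (Real.rpow_nonneg (h.nonneg ω) _))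
    (fun ω => mul_nonneg (Real.rpow_nonneg hC0 _) (Real.rpow_nonneg (anorm_nonneg _ _) _))
    ?_ ?_ ?_ (hRβ.const_mul _) ?_ ((h.integrable_anormB_rpow hβ.le hβ1.le).const_mul _)
  · have hm : Measurable fun x : ι → ℝ => anorm α x ^ β := hN.pow_const _
    have e1 := Measure.map_map (μ := P) hm h.measX
    have e2 := Measure.map_map (μ := P) hm h.measAXB
    rw [h.law, e2] at e1
    exact e1.symm
  · exact h.indepR.comp (φ := fun r => (1 + (1 - ρ) / 2) * r ^ β) (ψ := fun x => anorm α x ^ β)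
      ((measurable_id.pow_const _).const_mul _) (hN.pow_const _)
  · filter_upwards [h.ae_anorm_mul] with ω hω
    have h1 := hC (fun i => A ω i * X ω i) (B ω)
    rw [hω] at h1
    have hx := anorm_nonneg α (X ω)
    have hb := anorm_nonneg α (B ω)
    have hr := h.nonneg ω
    have hc : 1 ≤ 1 + (1 - ρ) / 2 := by linarith
    calc anorm α ((fun i => A ω i * X ω i) + B ω) ^ β
        ≤ ((1 + (1 - ρ) / 2) * (R ω * anorm α (X ω)) + C * anorm α (B ω)) ^ β :=
          Real.rpow_le_rpow (anorm_nonneg _ _) h1 hβ.le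
      _ ≤ ((1 + (1 - ρ) / 2) * (R ω * anorm α (X ω))) ^ β + (C * anorm α (B ω)) ^ β :=
          Real.rpow_add_le_add_rpow (by positivity) (by positivity) hβ.le hβ1.le
      _ = (1 + (1 - ρ) / 2) ^ β * (R ω ^ β * anorm α (X ω) ^ β) + C ^ β * anorm α (B ω) ^ β := by
          rw [Real.mul_rpow (by linarith) (by positivity), Real.mul_rpow hr hx,
            Real.mul_rpow hC0 hb]
      _ ≤ (1 + (1 - ρ) / 2) * (R ω ^ β * anorm α (X ω) ^ β) + C ^ β * anorm α (B ω) ^ β := by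
          gcongr
          calc (1 + (1 - ρ) / 2) ^ β ≤ (1 + (1 - ρ) / 2) ^ (1 : ℝ) :=
                Real.rpow_le_rpow_of_exponent_le hc hβ1.le
            _ = _ := Real.rpow_one _
      _ = _ := by ring
  · rw [integral_const_mul, ← hρ]; nlinarith

/-- The moments of order below one of `|A X|_α`. -/
lemma integrable_mul_rpow (h : IsBlockSRE P α X A B R) {β : ℝ} (hβ : 0 < β) (hβ1 : β < 1) :
    Integrable (fun ω => (R ω * anorm α (X ω)) ^ β) P := by
  have hi := IndepFun.integrable_mul (X := fun ω => R ω ^ β) (Y := fun ω => anorm α (X ω) ^ β)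
    (h.indepR.comp (φ := fun r => r ^ β) (ψ := fun x => anorm α x ^ β)
      (measurable_id.pow_const _) ((measurable_anorm h.pos).pow_const _))
    (integral_rpow_lt_one h.measR h.nonneg h.integrable h.mean h.ne_one hβ hβ1).1
    (h.integrable_rpow hβ hβ1)
  refine hi.congr (Eventually.of_forall fun ω => ?_)
  simp only [Pi.mul_apply]
  rw [Real.mul_rpow (h.nonneg ω) (anorm_nonneg _ _)]

end IsBlockSRE

end Block

/-! ### One block: the renewal equation and its charge. -/

section Block

variable {Ω : Type*} [MeasurableSpace Ω] {P : Measure Ω} [IsProbabilityMeasure P]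
  {ι : Type*} [Fintype ι] {α : ι → ℝ}

/-- A bound, uniform over unit intervals of `s`, for
`e^s |f(δ_{e^{-s}} (x + y)) - f(δ_{e^{-s}} x)|` in terms of `w = |x|_α` and `z = |y|_α`. -/
def incrBound (η C L r : ℝ) (j : ℤ) (w z : ℝ) : ℝ :=
  2 * C * Real.exp 1 * (if Real.exp j ≤ z / r then Real.exp (1 * j) else 0)
    + L * Real.exp 1 * z ^ η * (if Real.exp j ≤ w / r then Real.exp ((1 - η) * j) else 0)

lemma measurable_incrBound {η C L r : ℝ} (j : ℤ) :
    Measurable fun p : ℝ × ℝ => incrBound η C L r j p.1 p.2 := by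
  unfold incrBound
  refine Measurable.add (Measurable.const_mul (Measurable.ite ?_ measurable_const
    measurable_const) _) (Measurable.mul (by fun_prop) (Measurable.ite ?_ measurable_const
    measurable_const))
  · exact measurableSet_le measurable_const (by fun_prop)
  · exact measurableSet_le measurable_const (by fun_prop)

/-- Each condition cuts a geometric series at the level z/r or w/r, leaving sums of order z and
w^{1-η}. The mixed term has total degree one, which `integrable_rpow_mul_rpow` can integrate. -/
lemma tsum_incrBound_le {η C L r : ℝ} (hη1 : η < 1) (hC : 0 ≤ C) (hL : 0 ≤ L)
    (hr : 0 < r) :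
    ∃ K : ℝ, ∀ w z : ℝ, 0 ≤ w → 0 ≤ z → ∑' j : ℤ, ENNReal.ofReal (incrBound η C L r j w z)
      ≤ ENNReal.ofReal (K * (z + z ^ η * w ^ (1 - η))) := by
  obtain ⟨K₁, hK₁, h1⟩ := tsum_exp_indicator_le one_pos
  obtain ⟨K₂, hK₂, h2⟩ := tsum_exp_indicator_le (sub_pos.2 hη1)
  refine ⟨2 * C * Real.exp 1 * K₁ / r + L * Real.exp 1 * K₂ / r ^ (1 - η), fun w z hw hz => ?_⟩
  have hzη := Real.rpow_nonneg hz η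
  have hwη := Real.rpow_nonneg hw (1 - η)
  have e : ∀ j : ℤ, ENNReal.ofReal (incrBound η C L r j w z)
      = ENNReal.ofReal (2 * C * Real.exp 1)
          * ENNReal.ofReal (if Real.exp j ≤ z / r then Real.exp (1 * j) else 0)
        + ENNReal.ofReal (L * Real.exp 1 * z ^ η)
          * ENNReal.ofReal (if Real.exp j ≤ w / r then Real.exp ((1 - η) * j) else 0) := by
    intro j
    have n1 : 0 ≤ 2 * C * Real.exp 1 * (if Real.exp j ≤ z / r then Real.exp (1 * j) else 0) := by
      refine mul_nonneg (by positivity) ?_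
      split_ifs <;> positivity
    have n2 : 0 ≤ L * Real.exp 1 * z ^ η
        * (if Real.exp j ≤ w / r then Real.exp ((1 - η) * j) else 0) := by
      refine mul_nonneg (by positivity) ?_
      split_ifs <;> positivity
    rw [incrBound, ENNReal.ofReal_add n1 n2,
      ENNReal.ofReal_mul (p := 2 * C * Real.exp 1) (by positivity),
      ENNReal.ofReal_mul (p := L * Real.exp 1 * z ^ η) (by positivity)]
  simp only [e]
  rw [ENNReal.tsum_add, ENNReal.tsum_mul_left, ENNReal.tsum_mul_left]
  calc _ ≤ ENNReal.ofReal (2 * C * Real.exp 1) * ENNReal.ofReal (K₁ * (z / r) ^ (1 : ℝ))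
        + ENNReal.ofReal (L * Real.exp 1 * z ^ η) * ENNReal.ofReal (K₂ * (w / r) ^ (1 - η)) := by
        gcongr
        · exact h1 _ (by positivity)
        · exact h2 _ (by positivity)
    _ ≤ _ := by
        rw [← ENNReal.ofReal_mul (by positivity), ← ENNReal.ofReal_mul (by positivity),
          ← ENNReal.ofReal_add (by positivity) (by positivity)]
        refine ENNReal.ofReal_le_ofReal ?_
        rw [Real.rpow_one, Real.div_rpow hw hr.le]
        have hrη : 0 < r ^ (1 - η) := by positivity
        have a1 : 0 ≤ 2 * C * Real.exp 1 * K₁ / r * (z ^ η * w ^ (1 - η)) := by positivity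
        have a2 : 0 ≤ L * Real.exp 1 * K₂ / r ^ (1 - η) * z := by positivity
        have e3 : 2 * C * Real.exp 1 * (K₁ * (z / r))
            + L * Real.exp 1 * z ^ η * (K₂ * (w ^ (1 - η) / r ^ (1 - η)))
            = 2 * C * Real.exp 1 * K₁ / r * z
              + L * Real.exp 1 * K₂ / r ^ (1 - η) * (z ^ η * w ^ (1 - η)) := by
          ring
        rw [e3]
        nlinarith

/-- The increments of Hölder test functions are controlled by `incrBound`. -/
lemma exists_incrBound (hα : ∀ i, 0 < α i) {η C L r : ℝ} (hη : 0 < η) (hη1 : η < 1) (hL : 0 ≤ L)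
    (hr : 0 < r) :
    ∃ r' : ℝ, 0 < r' ∧ ∀ f : (ι → ℝ) → ℝ, IsHolderTest α η C L r f → ∀ (s : ℝ) (x y : ι → ℝ),
      Real.exp s * |f (dil α (Real.exp (-s)) (x + y)) - f (dil α (Real.exp (-s)) x)|
        ≤ incrBound η C L r' ⌊s⌋ (anorm α x) (anorm α y) := by
  obtain ⟨c, hc0, hc⟩ := exists_anorm_add_le hα one_pos
  -- If |x|_α and |y|_α are both below r' e^s, then |x + y|_α ≤ 2|x|_α + c|y|_α < r e^s, so both
  -- values of f vanish.
  refine ⟨r / (2 + c), by positivity, fun f hf s x y => ?_⟩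
  set r' := r / (2 + c) with hr'
  have hr'0 : 0 < r' := by positivity
  have hrr' : r' * (2 + c) = r := by rw [hr']; field_simp
  have hr'r : r' ≤ r := by nlinarith
  have hC : 0 ≤ C := (abs_nonneg _).trans (hf.bound 0)
  have hx := anorm_nonneg α x
  have hy := anorm_nonneg α y
  have hyη := Real.rpow_nonneg hy η
  have hj : Real.exp (⌊s⌋ : ℝ) ≤ Real.exp s := Real.exp_le_exp.2 (Int.floor_le s)
  have hj1 : s ≤ ⌊s⌋ + 1 := (Int.lt_floor_add_one s).le
  have hEs := Real.exp_pos s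
  have hsc : ∀ v : ι → ℝ, f (dil α (Real.exp (-s)) v) ≠ 0 → r * Real.exp s ≤ anorm α v := by
    intro v hv
    have := hf.supp _ hv
    rwa [anorm_dil hα (Real.exp_pos _).le, Real.exp_neg, inv_mul_eq_div,
      le_div_iff₀ (Real.exp_pos _)] at this
  have t1 : 0 ≤ 2 * C * Real.exp 1 * (if Real.exp (⌊s⌋ : ℝ) ≤ anorm α y / r'
      then Real.exp (1 * (⌊s⌋ : ℝ)) else 0) := by
    refine mul_nonneg (by positivity) ?_
    split_ifs <;> positivity
  have t2 : 0 ≤ L * Real.exp 1 * anorm α y ^ η * (if Real.exp (⌊s⌋ : ℝ) ≤ anorm α x / r'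
      then Real.exp ((1 - η) * (⌊s⌋ : ℝ)) else 0) := by
    refine mul_nonneg (by positivity) ?_
    split_ifs <;> positivity
  unfold incrBound
  -- For y large the difference is at most 2C; for y small and x large the Hölder bound is used. The
  -- factors e pay for replacing s by ⌊s⌋.
  by_cases hyb : r' * Real.exp s ≤ anorm α y
  · have hif : Real.exp (⌊s⌋ : ℝ) ≤ anorm α y / r' := by
      rw [le_div_iff₀ hr'0]; nlinarith
    rw [if_pos hif] at t1 ⊢
    refine le_trans ?_ (le_add_of_nonneg_right t2)
    have h1 : |f (dil α (Real.exp (-s)) (x + y)) - f (dil α (Real.exp (-s)) x)| ≤ 2 * C :=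
      (abs_sub _ _).trans ((add_le_add (hf.bound _) (hf.bound _)).trans (two_mul C).ge)
    have h2 : Real.exp s ≤ Real.exp 1 * Real.exp (1 * (⌊s⌋ : ℝ)) := by
      rw [← Real.exp_add]; exact Real.exp_le_exp.2 (by linarith)
    calc _ ≤ (Real.exp 1 * Real.exp (1 * (⌊s⌋ : ℝ))) * (2 * C) := by gcongr
      _ = _ := by ring
  push Not at hyb
  by_cases hxb : r' * Real.exp s ≤ anorm α x
  · have hif : Real.exp (⌊s⌋ : ℝ) ≤ anorm α x / r' := by
      rw [le_div_iff₀ hr'0]; nlinarith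
    rw [if_pos hif] at t2 ⊢
    refine le_trans ?_ (le_add_of_nonneg_left t1)
    have h1 := hf.holder (dil α (Real.exp (-s)) (x + y)) (dil α (Real.exp (-s)) x)
    rw [dil_add, add_sub_cancel_left, anorm_dil hα (Real.exp_pos _).le,
      Real.mul_rpow (Real.exp_pos _).le hy, ← Real.exp_mul] at h1
    have h2 : Real.exp s * Real.exp (-s * η) ≤ Real.exp 1 * Real.exp ((1 - η) * (⌊s⌋ : ℝ)) := by
      rw [← Real.exp_add, ← Real.exp_add]
      refine Real.exp_le_exp.2 ?_
      have : (1 - η) * s ≤ (1 - η) * (⌊s⌋ + 1) := mul_le_mul_of_nonneg_left hj1 (by linarith)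
      nlinarith
    rw [dil_add]
    calc _ ≤ Real.exp s * (L * (Real.exp (-s * η) * anorm α y ^ η)) := by gcongr
      _ = (Real.exp s * Real.exp (-s * η)) * (L * anorm α y ^ η) := by ring
      _ ≤ (Real.exp 1 * Real.exp ((1 - η) * (⌊s⌋ : ℝ))) * (L * anorm α y ^ η) := by gcongr
      _ = _ := by ring
  push Not at hxb
  have hz1 : f (dil α (Real.exp (-s)) x) = 0 := by
    by_contra hne
    have := hsc _ hne
    nlinarith
  have hz2 : f (dil α (Real.exp (-s)) (x + y)) = 0 := by
    by_contra hne
    have := hsc _ hne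
    have h3 := hc x y
    nlinarith
  rw [hz1, hz2, sub_zero, abs_zero, mul_zero]
  exact add_nonneg t1 t2

namespace IsBlockSRE

variable {X A B : Ω → ι → ℝ} {R : Ω → ℝ}

/-- The charge of the renewal equation. -/
def charge (P : Measure Ω) (α : ι → ℝ) (X A B : Ω → ι → ℝ) (f : (ι → ℝ) → ℝ) (s : ℝ) : ℝ :=
  Real.exp s * ∫ ω, (f (dil α (Real.exp (-s)) ((fun i => A ω i * X ω i) + B ω))
    - f (dil α (Real.exp (-s)) fun i => A ω i * X ω i)) ∂P

/-- The sequence depends on f through the constants only, so it serves all sign changes of f at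
once. Its sum is controlled by the mean of |B|_α + |B|_α^η |AX|_α^{1-η}, finite without any
independence of B and X. -/
lemma exists_charge_bound (h : IsBlockSRE P α X A B R) {η C L r : ℝ} (hη : 0 < η) (hη1 : η < 1)
    (hC : 0 ≤ C) (hL : 0 ≤ L) (hr : 0 < r) :
    ∃ d : ℤ → ℝ≥0∞, ∑' j, d j ≠ ∞ ∧ ∀ f, IsHolderTest α η C L r f →
      ∀ s, ENNReal.ofReal |charge P α X A B f s| ≤ d ⌊s⌋ := by
  obtain ⟨r', hr', hincr⟩ := exists_incrBound (C := C) (ι := ι) h.pos hη hη1 hL hr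
  obtain ⟨K, hK⟩ := tsum_incrBound_le hη1 hC hL hr'
  have hN := measurable_anorm h.pos
  have hNA := hN.comp h.measAX
  have hNB := hN.comp h.measB
  refine ⟨fun j => ∫⁻ ω, ENNReal.ofReal (incrBound η C L r' j (anorm α fun i => A ω i * X ω i)
    (anorm α (B ω))) ∂P, ?_, fun f hf s => ?_⟩
  · have hmeas : ∀ j : ℤ, Measurable fun ω => ENNReal.ofReal
        (incrBound η C L r' j (anorm α fun i => A ω i * X ω i) (anorm α (B ω))) := fun j =>
      ((measurable_incrBound j).comp (hNA.prodMk hNB)).ennreal_ofReal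
    rw [← lintegral_tsum fun j => (hmeas j).aemeasurable]
    obtain ⟨σ, hσ, hi⟩ := h.moment
    have hmix := integrable_rpow_mul_rpow (P := P) (Z := fun ω => anorm α (B ω))
      (W := fun ω => R ω * anorm α (X ω)) hNB (h.measR.mul (hN.comp h.measX))
      (fun ω => anorm_nonneg _ _) (fun ω => mul_nonneg (h.nonneg ω) (anorm_nonneg _ _)) hσ hη hη1
      hi (fun β h0 h1 => h.integrable_mul_rpow h0 h1)
    have hB1 := h.integrable_anormB_rpow zero_le_one le_rfl
    simp only [Real.rpow_one] at hB1
    have hfin := ((hB1.add hmix).const_mul K).lintegral_lt_top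
    refine (lt_of_le_of_lt (lintegral_mono_ae ?_) hfin).ne
    filter_upwards [h.ae_anorm_mul] with ω hω
    rw [hω]
    exact hK _ _ (mul_nonneg (h.nonneg ω) (anorm_nonneg _ _)) (anorm_nonneg _ _)
  · rw [charge, abs_mul, abs_of_pos (Real.exp_pos s), ENNReal.ofReal_mul (Real.exp_pos s).le]
    calc _ ≤ ENNReal.ofReal (Real.exp s) * ∫⁻ ω, ENNReal.ofReal
          |f (dil α (Real.exp (-s)) ((fun i => A ω i * X ω i) + B ω))
            - f (dil α (Real.exp (-s)) fun i => A ω i * X ω i)| ∂P := by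
          gcongr
          rw [← Real.enorm_eq_ofReal_abs]
          refine (enorm_integral_le_lintegral_enorm _).trans (le_of_eq ?_)
          simp only [Real.enorm_eq_ofReal_abs]
      _ = ∫⁻ ω, ENNReal.ofReal (Real.exp s) * ENNReal.ofReal
          |f (dil α (Real.exp (-s)) ((fun i => A ω i * X ω i) + B ω))
            - f (dil α (Real.exp (-s)) fun i => A ω i * X ω i)| ∂P :=
          (lintegral_const_mul' _ _ ENNReal.ofReal_ne_top).symm
      _ ≤ _ := by
          refine lintegral_mono fun ω => ?_
          rw [← ENNReal.ofReal_mul (Real.exp_pos s).le]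
          exact ENNReal.ofReal_le_ofReal (hincr f hf s _ _)

/-- The renewal equation. -/
lemma scaled_eq (h : IsBlockSRE P α X A B R) {f : (ι → ℝ) → ℝ} (hf : Continuous f) {C : ℝ}
    (hC : ∀ x, |f x| ≤ C) (hf0 : f 0 = 0) (s : ℝ) :
    scaled P α X f s = ∫ ω, R ω * scaled P α X (fun x => f (flip (fun i => signUnit (A ω i)) x))
      (s - Real.log (R ω)) ∂P + charge P α X A B f s := by
  have hlaw : ∫ ω, f (dil α (Real.exp (-s)) (X ω)) ∂P
      = ∫ ω, f (dil α (Real.exp (-s)) ((fun i => A ω i * X ω i) + B ω)) ∂P := by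
    have hm : AEStronglyMeasurable (fun x => f (dil α (Real.exp (-s)) x))
        (P.map X) := (hf.comp (continuous_dil _)).aestronglyMeasurable
    rw [← integral_map h.measX.aemeasurable hm]
    rw [h.law] at hm ⊢
    rw [integral_map h.measAXB.aemeasurable hm]
  have hind : ∫ ω, f (dil α (Real.exp (-s)) fun i => A ω i * X ω i) ∂P
      = ∫ ω, ∫ ω', f (dil α (Real.exp (-s)) fun i => A ω i * X ω' i) ∂P ∂P := by
    refine integral_indep (f := fun a x => f (dil α (Real.exp (-s)) fun i => a i * x i))
      h.measA h.measX h.indep (Continuous.measurable ?_) fun _ _ => hC _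
    refine hf.comp ((continuous_dil _).comp (continuous_pi fun i => ?_))
    fun_prop
  have hterm : Real.exp s * ∫ ω, f (dil α (Real.exp (-s)) fun i => A ω i * X ω i) ∂P
      = ∫ ω, R ω * scaled P α X (fun x => f (flip (fun i => signUnit (A ω i)) x))
      (s - Real.log (R ω)) ∂P := by
    rw [hind, ← integral_const_mul]
    refine integral_congr_ae ?_
    filter_upwards [h.eqR] with ω hω
    simp only [mul_eq_dil_flip h.pos hω]
    -- For R = 0 the weight on one side and `f 0` on the other are zero.
    rcases (h.nonneg ω).eq_or_lt with h0 | h0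
    · rw [← h0, zero_mul]
      have : ∀ x : ι → ℝ, dil α 0 x = 0 := fun x => by
        ext i; simp [dil, Real.zero_rpow (inv_ne_zero (h.pos i).ne')]
      simp [this, dil_zero_right, hf0]
    · rw [scaled, Real.exp_sub, Real.exp_log h0, ← mul_assoc, mul_div_cancel₀ _ h0.ne']
      congr 2
      ext ω'
      rw [dil_dil (Real.exp_pos _).le h0.le, dil_flip, neg_sub, Real.exp_sub, Real.exp_log h0,
        Real.exp_neg, mul_comm, div_eq_mul_inv]
  rw [← hterm, charge, integral_sub (integrable_comp_dil h.measAXB hf hC _)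
    (integrable_comp_dil h.measAX hf hC _), ← hlaw, scaled]
  ring

end IsBlockSRE

end Block

/-! ### One block: the tail bound and the convergence of rescaled means. -/

section Block

variable {Ω : Type*} [MeasurableSpace Ω] {P : Measure Ω} [IsProbabilityMeasure P]
  {ι : Type*} [Fintype ι] {α : ι → ℝ}

/-- A continuous substitute for the indicator of `{|x|_α ≥ 1}`. -/
lemma isHolderTest_clamp (hα : ∀ i, 0 < α i) {η : ℝ} (hη : 0 < η) (hηα : ∀ i, η * α i ≤ 1) :
    IsHolderTest α η 1 1 1 fun x : ι → ℝ => max 0 (min 1 (anorm α x ^ η - 1)) where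
  continuous := by
    have := (continuous_anorm hα).rpow_const (p := η) fun x => Or.inr hη.le
    fun_prop
  bound x := by
    rw [abs_of_nonneg (le_max_left _ _)]
    exact max_le zero_le_one (min_le_left _ _)
  pos := one_pos
  supp x hx := by
    by_contra hlt
    push Not at hlt
    refine hx (max_eq_left ((min_le_right _ _).trans ?_))
    linarith [Real.rpow_le_one (anorm_nonneg α x) hlt.le hη.le]
  holder x y := by
    rw [one_mul]
    refine le_trans ?_ (abs_anorm_rpow_sub_le hη hηα hα x y)
    refine (abs_max_sub_max_le_max _ _ _ _).trans ?_
    rw [sub_self, abs_zero, max_eq_right (abs_nonneg _)]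
    refine (abs_min_sub_min_le_max _ _ _ _).trans ?_
    rw [sub_self, abs_zero, max_eq_right (abs_nonneg _), sub_sub_sub_cancel_right]

lemma measurableSet_tail (hα : ∀ i, 0 < α i) {X : Ω → ι → ℝ} (hX : Measurable X) (t : ℝ) :
    MeasurableSet {ω | t ≤ anorm α (X ω)} :=
  measurableSet_le measurable_const ((measurable_anorm hα).comp hX)

namespace IsBlockSRE

variable {X A B : Ω → ι → ℝ} {R : Ω → ℝ}

/-- The tail of `|X|_α` is at most of order `1 / t`. -/
theorem exists_tail_bound (h : IsBlockSRE P α X A B R) :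
    ∃ C : ℝ, 0 ≤ C ∧ ∀ t : ℝ, 0 < t → t * P.real {ω | t ≤ anorm α (X ω)} ≤ C := by
  obtain ⟨η, hη, hη1, hηα⟩ := exists_holder_exponent h.pos
  have hN := measurable_anorm h.pos
  set f : (ι → ℝ) → ℝ := fun x => max 0 (min 1 (anorm α x ^ η - 1)) with hfdef
  have hf : IsHolderTest α η 1 1 1 f := isHolderTest_clamp h.pos hη hηα
  have hf0 : f 0 = 0 := by
    by_contra hne
    have := hf.supp _ hne
    rw [anorm_zero h.pos] at this
    linarith
  have hfn : ∀ x, 0 ≤ f x := fun x => le_max_left _ _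
  -- This f depends on |x|_α only, so the signs drop out and the renewal equation is scalar.
  have hflip : ∀ ε : ι → ℤˣ, (fun x => f (flip ε x)) = f := fun ε => by
    ext x; simp only [hfdef, anorm_flip]
  obtain ⟨d, hd, hdb⟩ := h.exists_charge_bound hη hη1 zero_le_one zero_le_one one_pos
  set g := scaled P α X f with hg
  have hgn : ∀ s, 0 ≤ g s := fun s =>
    mul_nonneg (Real.exp_pos s).le (integral_nonneg fun ω => hfn _)
  have hgc : Continuous g := continuous_scaled h.measX hf.continuous hf.bound
  obtain ⟨hh, hh1⟩ := integral_rpow_lt_one h.measR h.nonneg h.integrable h.mean h.ne_one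
    (β := 1 - 1 / 2) (by norm_num) (by norm_num)
  have hmom := h.integrable_rpow (β := 1 / 2) (by norm_num) (by norm_num)
  set m := ∫ ω, anorm α (X ω) ^ (1 / 2 : ℝ) ∂P with hm
  have hm0 : 0 ≤ m := integral_nonneg fun ω => Real.rpow_nonneg (anorm_nonneg _ _) _
  -- Markov's inequality for the moment of order 1/2 supplies the a priori exponential growth, with
  -- δ = 1/2, which the maximum principle needs.
  have hgm : ∀ s, g s ≤ m * Real.exp (1 / 2 * s) := by
    intro s
    refine (le_abs_self _).trans ((abs_scaled_le_tail h.pos h.measX hf.bound hf.supp s).trans ?_)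
    rw [one_mul, one_mul]
    have hmk := mul_meas_ge_le_integral_of_nonneg
      (Eventually.of_forall fun ω => Real.rpow_nonneg (anorm_nonneg α (X ω)) (1 / 2 : ℝ)) hmom
      (Real.exp (1 / 2 * s))
    have hsub : P.real {ω | Real.exp s ≤ anorm α (X ω)}
        ≤ P.real {ω | Real.exp (1 / 2 * s) ≤ anorm α (X ω) ^ (1 / 2 : ℝ)} := by
      refine measureReal_mono fun ω hω => ?_
      have : Real.exp (1 / 2 * s) = Real.exp s ^ (1 / 2 : ℝ) := by
        rw [← Real.exp_mul, mul_comm]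
      show Real.exp (1 / 2 * s) ≤ anorm α (X ω) ^ (1 / 2 : ℝ)
      rw [this]
      exact Real.rpow_le_rpow (Real.exp_pos _).le hω (by norm_num)
    have e : Real.exp s = Real.exp (1 / 2 * s) * Real.exp (1 / 2 * s) := by
      rw [← Real.exp_add]; congr 1; ring
    have hpos := Real.exp_pos (1 / 2 * s)
    calc Real.exp s * P.real {ω | Real.exp s ≤ anorm α (X ω)}
        ≤ Real.exp s * P.real {ω | Real.exp (1 / 2 * s) ≤ anorm α (X ω) ^ (1 / 2 : ℝ)} := by
          gcongr
      _ = Real.exp (1 / 2 * s) * (Real.exp (1 / 2 * s)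
          * P.real {ω | Real.exp (1 / 2 * s) ≤ anorm α (X ω) ^ (1 / 2 : ℝ)}) := by
          rw [e, mul_assoc]
      _ ≤ Real.exp (1 / 2 * s) * m := by gcongr
      _ = _ := mul_comm _ _
  have hsub : ∀ s, ENNReal.ofReal (g s) ≤ tilt P R (fun s => ENNReal.ofReal (g s)) s
      + ENNReal.ofReal |charge P α X A B f s| := by
    intro s
    have heq := h.scaled_eq hf.continuous hf.bound hf0 s
    simp only [hflip] at heq
    rw [← hg] at heq
    have hi : ENNReal.ofReal (∫ ω, R ω * g (s - Real.log (R ω)) ∂P)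
        ≤ tilt P R (fun s => ENNReal.ofReal (g s)) s := by
      refine ENNReal.ofReal_le_of_le_toReal ?_ |>.trans le_rfl
      have hmeas : Measurable fun ω => R ω * g (s - Real.log (R ω)) :=
        h.measR.mul (hgc.measurable.comp
          (measurable_const.sub (Real.measurable_log.comp h.measR)))
      rw [integral_eq_lintegral_of_nonneg_ae
        (Eventually.of_forall fun ω => mul_nonneg (h.nonneg ω) (hgn _)) hmeas.aestronglyMeasurable]
      refine le_of_eq (congrArg _ (lintegral_congr fun ω => ?_))
      rw [ENNReal.ofReal_mul (h.nonneg ω)]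
    calc ENNReal.ofReal (g s)
        ≤ ENNReal.ofReal (∫ ω, R ω * g (s - Real.log (R ω)) ∂P + |charge P α X A B f s|) := by
          refine ENNReal.ofReal_le_ofReal ?_
          linarith [le_abs_self (charge P α X A B f s)]
      _ ≤ _ := ENNReal.ofReal_add_le
      _ ≤ _ := by gcongr
  have hρ : ∫⁻ ω, ENNReal.ofReal (R ω ^ (1 - 1 / 2 : ℝ)) ∂P < 1 := by
    rw [← ofReal_integral_eq_lintegral_ofReal hh
      (Eventually.of_forall fun ω => Real.rpow_nonneg (h.nonneg ω) _)]
    exact ENNReal.ofReal_lt_one.2 hh1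
  have hbd := le_of_le_tilt_add (P := P) (R := R) h.measR h.nonneg
    (by rw [← ofReal_integral_eq_lintegral_ofReal h.integrable (Eventually.of_forall h.nonneg),
          h.mean, ENNReal.ofReal_one])
    (δ := 1 / 2) (by norm_num) hρ (d := d) (g := fun s => ENNReal.ofReal (g s))
    (D := fun s => ENNReal.ofReal |charge P α X A B f s|) (C := ENNReal.ofReal m)
    ENNReal.ofReal_ne_top
    (fun s => by
      rw [← ENNReal.ofReal_mul hm0]; exact ENNReal.ofReal_le_ofReal (hgm s))
    (hdb f hf) hsub
  set M := (∑' j, d j) * (ENNReal.ofReal (Real.exp (1 / 2))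
        * (1 - ∫⁻ ω, ENNReal.ofReal (R ω ^ (1 - 1 / 2 : ℝ)) ∂P)⁻¹) with hM
  have hMtop : M ≠ ∞ := ENNReal.mul_ne_top hd (ENNReal.mul_ne_top ENNReal.ofReal_ne_top
    (ENNReal.inv_ne_top.2 (tsub_pos_of_lt hρ).ne'))
  have hgM : ∀ s, g s ≤ M.toReal := fun s => (ENNReal.ofReal_le_iff_le_toReal hMtop).1 (hbd s)
  -- pass from the continuous substitute to the tail
  set b : ℝ := 2 ^ (1 / η) with hb
  have hb0 : 0 < b := by positivity
  refine ⟨b * M.toReal, by positivity, fun t ht => ?_⟩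
  set s := Real.log (t / b) with hs
  have hes : Real.exp s = t / b := Real.exp_log (by positivity)
  have hlow : Real.exp s * P.real {ω | t ≤ anorm α (X ω)} ≤ g s := by
    rw [hg, scaled]
    gcongr
    have hE := measurableSet_tail h.pos h.measX t
    calc P.real {ω | t ≤ anorm α (X ω)}
        = ∫ ω, {ω | t ≤ anorm α (X ω)}.indicator (fun _ => (1 : ℝ)) ω ∂P := by
          rw [integral_indicator hE, setIntegral_const]; simp
      _ ≤ _ := by
          refine integral_mono ((integrable_const (1 : ℝ)).indicator hE)
            (integrable_comp_dil h.measX hf.continuous hf.bound _) fun ω => ?_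
          by_cases hω : ω ∈ {ω | t ≤ anorm α (X ω)}
          · rw [indicator_of_mem hω]
            have h1 : b ≤ anorm α (dil α (Real.exp (-s)) (X ω)) := by
              rw [anorm_dil h.pos (Real.exp_pos _).le, Real.exp_neg, hes, inv_div,
                div_mul_eq_mul_div, le_div_iff₀ ht]
              exact mul_le_mul_of_nonneg_left hω hb0.le
            have h2 : (2 : ℝ) ≤ anorm α (dil α (Real.exp (-s)) (X ω)) ^ η := by
              have := Real.rpow_le_rpow hb0.le h1 hη.le
              rwa [hb, ← Real.rpow_mul (by norm_num), one_div_mul_cancel hη.ne',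
                Real.rpow_one] at this
            exact le_max_of_le_right (le_min le_rfl (by linarith))
          · rw [indicator_of_notMem hω]; exact hfn _
  have := hlow.trans (hgM s)
  rw [hes, div_mul_eq_mul_div, div_le_iff₀ hb0] at this
  linarith

/-- The rescaled means of a compactly supported function are uniformly continuous in the
logarithmic scale. -/
lemma uniformContinuous_scaled {f : (ι → ℝ) → ℝ} (hα : ∀ i, 0 < α i) (hX : Measurable X)
    {C₀ : ℝ} (hC₀ : ∀ t : ℝ, 0 < t → t * P.real {ω | t ≤ anorm α (X ω)} ≤ C₀)
    (hf : Continuous f) {C r K : ℝ} (hC : ∀ x, |f x| ≤ C) (hr0 : 0 < r)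
    (hr : ∀ x, f x ≠ 0 → r ≤ anorm α x) (hK : ∀ x, f x ≠ 0 → anorm α x ≤ K) :
    UniformContinuous (scaled P α X f) := by
  -- The increment of the rescaled mean over u is the rescaled mean of Φ u. For small u this
  -- function is uniformly small and supported off zero, so the tail bound controls it uniformly in
  -- s.
  set Φ : ℝ → (ι → ℝ) → ℝ := fun u y => Real.exp u * f (dil α (Real.exp (-u)) y) - f y with hΦ
  have hΦc : Continuous (Function.uncurry Φ) := by
    refine (((Real.continuous_exp.comp continuous_fst).mul (hf.comp ?_))).sub
      (hf.comp continuous_snd)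
    refine continuous_pi fun i => ?_
    refine Continuous.mul ?_ ((continuous_apply i).comp continuous_snd)
    exact (Real.continuous_exp.comp (continuous_neg.comp continuous_fst)).rpow_const
      fun s => Or.inl (Real.exp_ne_zero _)
  have hC₀0 : 0 ≤ C₀ := by
    have := hC₀ 1 one_pos
    rw [one_mul] at this
    exact measureReal_nonneg.trans this
  have hsmall : ∀ κ > 0, ∃ ν > 0, ν ≤ 1 ∧ ∀ u, |u| < ν → ∀ y, |Φ u y| ≤ κ := by
    intro κ hκ
    have hev : ∀ᶠ u in 𝓝 (0 : ℝ), ∀ y ∈ {y : ι → ℝ | anorm α y ≤ Real.exp 1 * K}, |Φ u y| < κ := by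
      refine (isCompact_anorm_le hα _).eventually_forall_of_forall_eventually fun y _ => ?_
      have h0 : |Function.uncurry Φ (0, y)| < κ := by
        simp [hΦ, dil_one, hκ]
      have := (continuous_abs.comp hΦc).continuousAt.eventually (gt_mem_nhds h0)
      exact this
    obtain ⟨ν, hν, hνs⟩ := Metric.eventually_nhds_iff.1 hev
    refine ⟨min ν 1, by positivity, min_le_right _ _, fun u hu y => ?_⟩
    by_cases hy : anorm α y ≤ Real.exp 1 * K
    · exact (hνs (by simpa using hu.trans_le (min_le_left _ _)) y hy).le
    · have hu1 : |u| < 1 := hu.trans_le (min_le_right _ _)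
      have z1 : f y = 0 := by
        by_contra hne
        have h1 := hK y hne
        have h2 : 0 ≤ K := (anorm_nonneg _ _).trans h1
        have h3 : 1 ≤ Real.exp 1 := Real.one_le_exp zero_le_one
        exact hy (h1.trans (le_mul_of_one_le_left h2 h3))
      have z2 : f (dil α (Real.exp (-u)) y) = 0 := by
        by_contra hne
        have h1 := hK _ hne
        have h2 : 0 ≤ K := (anorm_nonneg _ _).trans h1
        rw [anorm_dil hα (Real.exp_pos _).le, Real.exp_neg, inv_mul_le_iff₀ (Real.exp_pos _)] at h1
        have h3 : Real.exp u ≤ Real.exp 1 := Real.exp_le_exp.2 ((le_abs_self u).trans hu1.le)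
        exact hy (h1.trans (mul_le_mul_of_nonneg_right h3 h2))
      simp [hΦ, z1, z2, hκ.le]
  have hdiff : ∀ s u, scaled P α X f (s + u) - scaled P α X f s = scaled P α X (Φ u) s := by
    intro s u
    simp only [scaled, hΦ]
    have e : ∀ ω, dil α (Real.exp (-(s + u))) (X ω)
        = dil α (Real.exp (-u)) (dil α (Real.exp (-s)) (X ω)) := fun ω => by
      rw [dil_dil (Real.exp_pos _).le (Real.exp_pos _).le, ← Real.exp_add]
      congr 2; ring
    simp only [e]
    rw [integral_sub, integral_const_mul, Real.exp_add]
    · ring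
    · exact (integrable_comp_dil (f := fun x => f (dil α (Real.exp (-u)) x)) hX
        (hf.comp (continuous_dil _)) (fun x => hC _) _).const_mul _
    · exact integrable_comp_dil hX hf hC _
  rw [Metric.uniformContinuous_iff]
  intro κ hκ
  set q := C₀ * Real.exp 1 / r + 1 with hq
  have hq0 : 0 < q := by positivity
  obtain ⟨ν, hν, hν1, hνs⟩ := hsmall (κ / (2 * q)) (by positivity)
  refine ⟨ν, hν, fun {a b} hab => ?_⟩
  rw [Real.dist_eq] at hab ⊢
  have h1 := hdiff b (a - b)
  rw [add_sub_cancel] at h1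
  rw [h1]
  have hsupp : ∀ x, Φ (a - b) x ≠ 0 → r / Real.exp 1 ≤ anorm α x := by
    intro x hx
    by_contra hlt
    push Not at hlt
    have hu1 : |a - b| < 1 := hab.trans_le hν1
    have e1 : 1 ≤ Real.exp 1 := Real.one_le_exp zero_le_one
    rw [lt_div_iff₀ (Real.exp_pos _)] at hlt
    have hx0 := anorm_nonneg α x
    have z1 : f x = 0 := by
      by_contra hne
      have := hr x hne
      nlinarith
    have z2 : f (dil α (Real.exp (-(a - b))) x) = 0 := by
      by_contra hne
      have h2 := hr _ hne
      rw [anorm_dil hα (Real.exp_pos _).le] at h2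
      have h3 : Real.exp (-(a - b)) ≤ Real.exp 1 :=
        Real.exp_le_exp.2 ((neg_le_abs _).trans hu1.le)
      nlinarith
    refine hx ?_
    show Real.exp (a - b) * f (dil α (Real.exp (-(a - b))) x) - f x = 0
    rw [z1, z2, mul_zero, sub_zero]
  have h2 := abs_scaled_le_tail (P := P) hα hX (hνs _ hab) hsupp b
  have h3 := hC₀ (r / Real.exp 1 * Real.exp b) (by positivity)
  have h4 : Real.exp b * P.real {ω | r / Real.exp 1 * Real.exp b ≤ anorm α (X ω)} ≤ q := by
    have e2 : C₀ * Real.exp 1 / r = C₀ / (r / Real.exp 1) := by field_simp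
    have : Real.exp b * P.real {ω | r / Real.exp 1 * Real.exp b ≤ anorm α (X ω)}
        ≤ C₀ / (r / Real.exp 1) := by
      rw [le_div_iff₀ (by positivity)]; linarith
    linarith
  calc _ ≤ _ := h2
    _ ≤ κ / (2 * q) * q := by gcongr
    _ = κ / 2 := by field_simp
    _ < κ := by linarith

/-- Convergence of the rescaled means of Lipschitz functions with compact support off zero. -/
theorem exists_tendsto_scaled (h : IsBlockSRE P α X A B R) {f : (ι → ℝ) → ℝ} {Lf : NNReal}
    (hfL : LipschitzWith Lf f) {C r K : ℝ} (hC : ∀ x, |f x| ≤ C) (hr0 : 0 < r)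
    (hr : ∀ x, f x ≠ 0 → r ≤ anorm α x) (hK : ∀ x, f x ≠ 0 → anorm α x ≤ K) :
    ∃ l, Tendsto (scaled P α X f) atTop (𝓝 l) := by
  obtain ⟨η, hη, hη1, hηα⟩ := exists_holder_exponent h.pos
  obtain ⟨C₀, hC₀0, hC₀⟩ := h.exists_tail_bound
  have hC0 : 0 ≤ C := (abs_nonneg _).trans (hC 0)
  have hf : IsHolderTest α η C (2 * C + Lf) r f :=
    ⟨hfL.continuous, hC, hr0, hr, abs_sub_le_anorm_rpow hη hηα h.pos hC hfL⟩
  have hf0 : ∀ ε : ι → ℤˣ, f (flip ε 0) = 0 := fun ε => by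
    by_contra hne
    have := hr _ hne
    rw [anorm_flip, anorm_zero h.pos] at this
    linarith
  obtain ⟨d, hd, hdb⟩ := h.exists_charge_bound (C := C) (L := 2 * C + Lf) hη hη1 hC0
    (by positivity) hr0
  -- The group variable ε records a change of signs of the argument of f, and one step of the
  -- recursion multiplies it by the signs of A.
  set θ : Ω → ι → ℤˣ := fun ω i => signUnit (A ω i) with hθdef
  have hθ : Measurable θ := measurable_pi_iff.2 fun i =>
    measurable_signUnit.comp (measurable_pi_iff.1 h.measA i)
  set g : (ι → ℤˣ) → ℝ → ℝ := fun ε => scaled P α X fun x => f (flip ε x) with hg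
  set ψ : (ι → ℤˣ) → ℝ → ℝ := fun ε => charge P α X A B fun x => f (flip ε x) with hψ
  have heq : ∀ ε s, g ε s = ∫ ω, R ω * g (ε * θ ω) (s - Real.log (R ω)) ∂P + ψ ε s := by
    intro ε s
    have := h.scaled_eq (hf.flip ε).continuous (hf.flip ε).bound (hf0 ε) s
    simp only [flip_flip] at this
    exact this
  have hbound : ∃ C', ∀ ε s, |g ε s| ≤ C' := by
    refine ⟨C * (C₀ / r), fun ε s => (abs_scaled_le_tail h.pos h.measX (hf.flip ε).bound
      (hf.flip ε).supp s).trans ?_⟩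
    gcongr
    rw [le_div_iff₀ hr0]
    linarith [hC₀ (r * Real.exp s) (by positivity)]
  have huc : ∀ ε, UniformContinuous (g ε) := fun ε =>
    uniformContinuous_scaled h.pos h.measX hC₀ (hf.flip ε).continuous (hf.flip ε).bound hr0
      (hf.flip ε).supp (fun x hx => by simpa [anorm_flip] using hK _ hx)
  have hdfin : ∀ j, d j ≠ ∞ := fun j => ENNReal.ne_top_of_tsum_ne_top hd j
  have hdsum : Summable fun j => (d j).toReal := ENNReal.summable_toReal hd
  have hψd : ∀ ε s, |ψ ε s| ≤ (d ⌊s⌋).toReal := fun ε s =>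
    (ENNReal.ofReal_le_iff_le_toReal (hdfin _)).1 (hdb _ (hf.flip ε) s)
  have hvanish : ∀ ε, Tendsto (ψ ε) atTop (𝓝 0) := by
    intro ε
    have h1 : Tendsto (fun j => (d j).toReal) atTop (𝓝 0) :=
      hdsum.tendsto_cofinite_zero.mono_left (by
        rw [Int.cofinite_eq]; exact le_sup_right)
    exact squeeze_zero_norm (hψd ε) (h1.comp tendsto_floor_atTop)
  have hsol : IsRenewalSolution P R θ g ψ := ⟨hbound, huc, heq, hvanish⟩
  have hψm : ∀ ε, Measurable (ψ ε) := by
    intro ε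
    have e : ψ ε = fun s => g ε s - ∫ ω, R ω * g (ε * θ ω) (s - Real.log (R ω)) ∂P := by
      ext s; linarith [heq ε s]
    rw [e]
    refine (huc ε).continuous.measurable.sub ?_
    refine StronglyMeasurable.measurable (StronglyMeasurable.integral_prod_right'
      (f := fun p : ℝ × Ω => R p.2 * g (ε * θ p.2) (p.1 - Real.log (R p.2))) ?_)
    refine Measurable.stronglyMeasurable ((h.measR.comp measurable_snd).mul ?_)
    have hm : Measurable fun p : (ι → ℤˣ) × ℝ => g (ε * p.1) p.2 :=
      measurable_from_prod_countable_right fun η => (huc (ε * η)).continuous.measurable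
    exact hm.comp ((hθ.comp measurable_snd).prodMk
      (measurable_fst.sub (Real.measurable_log.comp (h.measR.comp measurable_snd))))
  have hψi : ∀ ε, Integrable (ψ ε) := by
    intro ε
    refine ⟨(hψm ε).aestronglyMeasurable, ?_⟩
    rw [hasFiniteIntegral_iff_enorm]
    calc ∫⁻ s, ‖ψ ε s‖ₑ ≤ ∫⁻ s, ∑' j, d j * unitBox j s := by
          refine lintegral_mono fun s => ?_
          rw [Real.enorm_eq_ofReal_abs]
          refine (hdb _ (hf.flip ε) s).trans (le_trans (le_of_eq ?_) (ENNReal.le_tsum ⌊s⌋))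
          have : s ∈ Ico ((⌊s⌋ : ℤ) : ℝ) (⌊s⌋ + 1) := ⟨Int.floor_le s, Int.lt_floor_add_one s⟩
          rw [unitBox, indicator_of_mem this]; simp
      _ = ∑' j, d j := by
          rw [lintegral_tsum fun j => ((measurable_unitBox j).const_mul _).aemeasurable]
          congr 1; ext j
          rw [lintegral_const_mul _ (measurable_unitBox j), unitBox,
            lintegral_indicator_one measurableSet_Ico]
          simp
      _ < ∞ := lt_top_iff_ne_top.2 hd
  obtain ⟨l, hl⟩ := hsol.exists_tendsto h.measR h.nonneg h.integrable h.mean hθ h.integrable_log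
    h.nonarith ⟨C, fun ε s => abs_scaled_le_exp (hf.flip ε).bound s⟩ hψi 1
  refine ⟨l, ?_⟩
  simpa [hg, flip_one] using hl

end IsBlockSRE

end Block

open scoped CompactlySupported

/-! ### Construction of the limit measure on the punctured space. -/

section Limit

variable {Ω : Type*} [MeasurableSpace Ω] {P : Measure Ω} [IsProbabilityMeasure P]
  {ι : Type*} [Fintype ι] {α : ι → ℝ} {X : Ω → ι → ℝ}

/-- The rescaled mean `t E f(δ_{1/t} X)`. -/
def tmean (P : Measure Ω) (α : ι → ℝ) (X : Ω → ι → ℝ) (f : (ι → ℝ) → ℝ) (t : ℝ) : ℝ :=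
  t * ∫ ω, f (dil α t⁻¹ (X ω)) ∂P

lemma tmean_eq_scaled {f : (ι → ℝ) → ℝ} {t : ℝ} (ht : 0 < t) :
    tmean P α X f t = scaled P α X f (Real.log t) := by
  rw [tmean, scaled, Real.exp_neg, Real.exp_log ht]

/-- The tail of `|X|_α` is at most `C₀ / t`. -/
structure IsTailBounded (P : Measure Ω) (α : ι → ℝ) (X : Ω → ι → ℝ) (C₀ : ℝ) : Prop where
  pos : ∀ i, 0 < α i
  meas : Measurable X
  nonneg : 0 ≤ C₀
  tail : ∀ t : ℝ, 0 < t → t * P.real {ω | t ≤ anorm α (X ω)} ≤ C₀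

/-- Continuous functions with a support bounded and bounded away from zero. -/
structure IsShellFun (α : ι → ℝ) (r K : ℝ) (f : (ι → ℝ) → ℝ) : Prop where
  continuous : Continuous f
  pos : 0 < r
  supp : ∀ x, f x ≠ 0 → r ≤ anorm α x ∧ anorm α x ≤ K

lemma IsShellFun.hasCompactSupport {r K : ℝ} {f : (ι → ℝ) → ℝ} (hf : IsShellFun α r K f)
    (hα : ∀ i, 0 < α i) : HasCompactSupport f :=
  HasCompactSupport.of_support_subset_isCompact (isCompact_anorm_le hα K)
    fun x hx => (hf.supp x hx).2

lemma IsShellFun.exists_bound {r K : ℝ} {f : (ι → ℝ) → ℝ} (hf : IsShellFun α r K f)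
    (hα : ∀ i, 0 < α i) : ∃ C, ∀ x, |f x| ≤ C :=
  (hf.hasCompactSupport hα).exists_bound_of_continuous hf.continuous

namespace IsTailBounded

variable {C₀ : ℝ}

lemma abs_tmean_le (h : IsTailBounded P α X C₀) {f : (ι → ℝ) → ℝ} {C r : ℝ}
    (hC : ∀ x, |f x| ≤ C) (hr0 : 0 < r) (hr : ∀ x, f x ≠ 0 → r ≤ anorm α x) {t : ℝ} (ht : 0 < t) :
    |tmean P α X f t| ≤ C * (C₀ / r) := by
  have hC0 : 0 ≤ C := (abs_nonneg _).trans (hC 0)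
  rw [tmean_eq_scaled ht]
  refine (abs_scaled_le_tail h.pos h.meas hC hr _).trans ?_
  gcongr
  rw [Real.exp_log ht, le_div_iff₀ hr0]
  linarith [h.tail (r * t) (by positivity)]

lemma tmean_sub (h : IsTailBounded P α X C₀) {f g : (ι → ℝ) → ℝ} (hf : Continuous f)
    (hg : Continuous g) {C D : ℝ} (hC : ∀ x, |f x| ≤ C) (hD : ∀ x, |g x| ≤ D) (t : ℝ) :
    tmean P α X f t - tmean P α X g t = tmean P α X (fun x => f x - g x) t := by
  rw [tmean, tmean, tmean, integral_sub (integrable_comp_dil h.meas hf hC _)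
    (integrable_comp_dil h.meas hg hD _)]
  ring

lemma tmean_add (h : IsTailBounded P α X C₀) {f g : (ι → ℝ) → ℝ} (hf : Continuous f)
    (hg : Continuous g) {C D : ℝ} (hC : ∀ x, |f x| ≤ C) (hD : ∀ x, |g x| ≤ D) (t : ℝ) :
    tmean P α X (fun x => f x + g x) t = tmean P α X f t + tmean P α X g t := by
  rw [tmean, tmean, tmean, integral_add (integrable_comp_dil h.meas hf hC _)
    (integrable_comp_dil h.meas hg hD _)]
  ring

/-- Convergence for Lipschitz functions extends to continuous functions. -/
lemma exists_tendsto_tmean (h : IsTailBounded P α X C₀)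
    (hlip : ∀ (f : (ι → ℝ) → ℝ) (L : NNReal) (r K : ℝ), LipschitzWith L f → IsShellFun α r K f →
      ∃ l, Tendsto (tmean P α X f) atTop (𝓝 l))
    {f : (ι → ℝ) → ℝ} {r K : ℝ} (hf : IsShellFun α r K f) :
    ∃ l, Tendsto (tmean P α X f) atTop (𝓝 l) := by
  refine cauchySeq_tendsto_of_complete ?_
  rw [Metric.cauchySeq_iff']
  intro κ hκ
  set q := C₀ / r + 1 with hq
  have hC₀ := h.nonneg
  have hr := hf.pos
  have hq0 : 0 < q := by positivity
  obtain ⟨C, hC⟩ := hf.exists_bound h.pos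
  -- A C¹ approximation vanishing wherever f does, hence Lipschitz. As the error is at most κ/(8q)
  -- and lives off the origin, the tail bound keeps the two means within κ/8 for all t > 0.
  obtain ⟨g, hg, hgf, hgs⟩ := hf.continuous.exists_contDiff_approx 1
    (ε := fun _ => κ / (8 * q)) continuous_const (fun _ => by positivity)
  have hgshell : IsShellFun α r K g := ⟨hg.continuous, hr, fun x hx => hf.supp x (hgs hx)⟩
  obtain ⟨D, hD⟩ := hgshell.exists_bound h.pos
  obtain ⟨L, hL⟩ := ContDiff.lipschitzWith_of_hasCompactSupport
    (hgshell.hasCompactSupport h.pos) hg (by simp)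
  obtain ⟨l, hl⟩ := hlip g L r K hL hgshell
  have hclose : ∀ t, 0 < t → |tmean P α X f t - tmean P α X g t| ≤ κ / 8 := by
    intro t ht
    rw [h.tmean_sub hf.continuous hg.continuous hC hD]
    refine (h.abs_tmean_le (C := κ / (8 * q)) (fun x => ?_) hr (fun x hx => ?_) ht).trans ?_
    · have := hgf x
      rw [Real.dist_eq, abs_sub_comm] at this
      exact this.le
    · by_contra hne
      have z1 : f x = 0 := by
        by_contra h1; exact hne (hf.supp x h1).1
      have z2 : g x = 0 := by
        by_contra h1; exact hne (hgshell.supp x h1).1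
      exact hx (by rw [z1, z2, sub_zero])
    · calc κ / (8 * q) * (C₀ / r) ≤ κ / (8 * q) * q := by gcongr; linarith
        _ = κ / 8 := by field_simp
  obtain ⟨T, hT⟩ := eventually_atTop.1 (Metric.tendsto_nhds.1 hl (κ / 8) (by positivity))
  refine ⟨max T 1, fun t ht => ?_⟩
  have ht0 : 0 < t := lt_of_lt_of_le one_pos ((le_max_right _ _).trans ht)
  have hN0 : 0 < max T 1 := lt_of_lt_of_le one_pos (le_max_right _ _)
  have a1 := hclose t ht0
  have a2 := hclose _ hN0
  have a3 := hT t ((le_max_left _ _).trans ht)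
  have a4 := hT (max T 1) (le_max_left _ _)
  rw [Real.dist_eq] at a3 a4 ⊢
  rw [abs_le] at a1 a2
  rw [abs_lt] at a3 a4 ⊢
  constructor <;> linarith

end IsTailBounded

/-- The space `ℝ^ι` without the origin. -/
abbrev Punctured (ι : Type*) : Type _ := {x : ι → ℝ // x ≠ 0}

instance : LocallyCompactSpace (Punctured ι) :=
  (isOpen_compl_singleton (x := (0 : ι → ℝ))).locallyCompactSpace

lemma isCompact_shell (hα : ∀ i, 0 < α i) {r K : ℝ} (hr : 0 < r) :
    IsCompact {x : Punctured ι | r ≤ anorm α x.1 ∧ anorm α x.1 ≤ K} := by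
  rw [Subtype.isCompact_iff]
  have hset : Subtype.val '' {x : Punctured ι | r ≤ anorm α x.1 ∧ anorm α x.1 ≤ K}
      = {x | anorm α x ≤ K} ∩ {x | r ≤ anorm α x} := by
    ext x
    constructor
    · rintro ⟨y, hy, rfl⟩; exact ⟨hy.2, hy.1⟩
    · rintro ⟨h1, h2⟩
      exact ⟨⟨x, (anorm_pos_iff hα).1 (lt_of_lt_of_le hr h2)⟩, ⟨h2, h1⟩, rfl⟩
  rw [hset]
  exact (isCompact_anorm_le hα K).inter_right (isClosed_le continuous_const (continuous_anorm hα))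

/-- The restriction to the punctured space of a function supported in a shell. -/
def IsShellFun.restrict (hα : ∀ i, 0 < α i) {r K : ℝ} {f : (ι → ℝ) → ℝ}
    (hf : IsShellFun α r K f) : C_c(Punctured ι, ℝ) where
  toFun x := f x.1
  continuous_toFun := hf.continuous.comp continuous_subtype_val
  hasCompactSupport' := HasCompactSupport.of_support_subset_isCompact
    (isCompact_shell (K := K) hα hf.pos) fun x hx => hf.supp x.1 hx

/-- Extension by zero to the origin. -/
def extendZero (φ : C_c(Punctured ι, ℝ)) : (ι → ℝ) → ℝ := Function.extend Subtype.val φ 0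

lemma extendZero_apply (φ : C_c(Punctured ι, ℝ)) (x : Punctured ι) : extendZero φ x.1 = φ x :=
  Subtype.val_injective.extend_apply _ _ _

lemma extendZero_zero (φ : C_c(Punctured ι, ℝ)) : extendZero φ 0 = 0 := by
  refine Function.extend_apply' _ _ _ ?_
  rintro ⟨x, hx⟩
  exact x.2 hx

lemma extendZero_restrict (hα : ∀ i, 0 < α i) {r K : ℝ} {f : (ι → ℝ) → ℝ}
    (hf : IsShellFun α r K f) : extendZero (hf.restrict hα) = f := by
  ext x
  by_cases hx : x = 0
  · rw [hx, extendZero_zero]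
    by_contra hne
    have h1 := (hf.supp 0 (Ne.symm hne)).1
    rw [anorm_zero hα] at h1
    linarith [hf.pos]
  · exact extendZero_apply _ ⟨x, hx⟩

/-- On a compact subset of the punctured space the gauge attains its extrema, and its minimum is
positive. -/
lemma isShellFun_extendZero (hα : ∀ i, 0 < α i) (φ : C_c(Punctured ι, ℝ)) :
    ∃ r K, IsShellFun α r K (extendZero φ) := by
  have hcomp := φ.hasCompactSupport
  have hN : Continuous fun x : Punctured ι => anorm α x.1 :=
    (continuous_anorm hα).comp continuous_subtype_val
  have hcont : Continuous (extendZero φ) :=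
    HasCompactSupport.continuous_extend_zero (U := {x | x ≠ 0}) isOpen_compl_singleton φ.continuous hcomp
  rcases (tsupport φ).eq_empty_or_nonempty with he | hne
  · refine ⟨1, 1, hcont, one_pos, fun x hx => absurd ?_ hx⟩
    by_cases hx0 : x = 0
    · rw [hx0, extendZero_zero]
    · rw [extendZero_apply φ ⟨x, hx0⟩]
      have : (⟨x, hx0⟩ : Punctured ι) ∉ tsupport φ := by rw [he]; exact notMem_empty _
      exact image_eq_zero_of_notMem_tsupport this
  · obtain ⟨a, ha, hamin⟩ := hcomp.isCompact.exists_isMinOn hne hN.continuousOn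
    obtain ⟨b, hb, hbmax⟩ := hcomp.isCompact.exists_isMaxOn hne hN.continuousOn
    refine ⟨anorm α a.1, anorm α b.1, hcont, (anorm_pos_iff hα).2 a.2, fun x hx => ?_⟩
    have hx0 : x ≠ 0 := by
      rintro rfl; exact hx (extendZero_zero φ)
    rw [extendZero_apply φ ⟨x, hx0⟩] at hx
    have hmem : (⟨x, hx0⟩ : Punctured ι) ∈ tsupport φ := subset_tsupport _ hx
    exact ⟨hamin hmem, hbmax hmem⟩

/-- The limit measure of the rescaled laws on the punctured space. -/
theorem IsTailBounded.exists_measure {C₀ : ℝ} (h : IsTailBounded P α X C₀)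
    (hlip : ∀ (f : (ι → ℝ) → ℝ) (L : NNReal) (r K : ℝ), LipschitzWith L f → IsShellFun α r K f →
      ∃ l, Tendsto (tmean P α X f) atTop (𝓝 l)) :
    ∃ Λ : Measure (Punctured ι), Λ.Regular ∧ ∀ (f : (ι → ℝ) → ℝ) (r K : ℝ), IsShellFun α r K f →
      Tendsto (tmean P α X f) atTop (𝓝 (∫ x, f x.1 ∂Λ)) := by
  have hex : ∀ φ : C_c(Punctured ι, ℝ), ∃ l, Tendsto (tmean P α X (extendZero φ)) atTop (𝓝 l) := by
    intro φ
    obtain ⟨r, K, hφ⟩ := isShellFun_extendZero h.pos φ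
    exact h.exists_tendsto_tmean hlip hφ
  choose ℓ hℓ using hex
  have hcb : ∀ φ : C_c(Punctured ι, ℝ), Continuous (extendZero φ) ∧
      ∃ C, ∀ x, |extendZero φ x| ≤ C := by
    intro φ
    obtain ⟨r, K, hφ⟩ := isShellFun_extendZero h.pos φ
    exact ⟨hφ.continuous, hφ.exists_bound h.pos⟩
  have hadd : ∀ φ χ : C_c(Punctured ι, ℝ), extendZero (φ + χ)
      = fun x => extendZero φ x + extendZero χ x := by
    intro φ χ
    ext x
    by_cases hx : x = 0
    · simp [hx, extendZero_zero]
    · have := extendZero_apply (φ + χ) ⟨x, hx⟩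
      rw [this]
      exact congrArg₂ _ (extendZero_apply φ ⟨x, hx⟩).symm (extendZero_apply χ ⟨x, hx⟩).symm
  have hsmul : ∀ (c : ℝ) (φ : C_c(Punctured ι, ℝ)), extendZero (c • φ)
      = fun x => c * extendZero φ x := by
    intro c φ
    ext x
    by_cases hx : x = 0
    · simp [hx, extendZero_zero]
    · have := extendZero_apply (c • φ) ⟨x, hx⟩
      rw [this]
      exact congrArg _ (extendZero_apply φ ⟨x, hx⟩).symm
  -- Limits of the rescaled means are linear and positive in φ, so the Riesz–Markov–Kakutani theorem
  -- represents them by a regular measure.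
  let lin : C_c(Punctured ι, ℝ) →ₗ[ℝ] ℝ :=
    { toFun := ℓ
      map_add' := fun φ χ => by
        refine tendsto_nhds_unique (hℓ (φ + χ)) (((hℓ φ).add (hℓ χ)).congr fun t => ?_)
        obtain ⟨c1, C, hC⟩ := hcb φ
        obtain ⟨c2, D, hD⟩ := hcb χ
        rw [hadd, h.tmean_add c1 c2 hC hD]
      map_smul' := fun c φ => by
        refine tendsto_nhds_unique (hℓ (c • φ)) (((hℓ φ).const_mul c).congr fun t => ?_)
        rw [hsmul, tmean, tmean, integral_const_mul]
        ring }
  let pos : C_c(Punctured ι, ℝ) →ₚ[ℝ] ℝ := PositiveLinearMap.mk₀ lin fun φ hφ => by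
    refine ge_of_tendsto (hℓ φ) ?_
    filter_upwards [eventually_ge_atTop 0] with t ht
    refine mul_nonneg ht (integral_nonneg fun ω => ?_)
    by_cases hx : dil α t⁻¹ (X ω) = 0
    · simp [hx, extendZero_zero]
    · have := extendZero_apply φ ⟨_, hx⟩
      simp only at this
      show 0 ≤ extendZero φ (dil α t⁻¹ (X ω))
      rw [this]
      exact hφ _
  refine ⟨RealRMK.rieszMeasure pos, inferInstance, fun f r K hf => ?_⟩
  have h1 := RealRMK.integral_rieszMeasure pos (hf.restrict h.pos)
  have h2 := hℓ (hf.restrict h.pos)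
  rw [extendZero_restrict h.pos hf] at h2
  have h3 : ∫ x, f x.1 ∂(RealRMK.rieszMeasure pos) = ℓ (hf.restrict h.pos) := h1
  rw [h3]
  exact h2

end Limit

/-! ### Test functions with unbounded support. -/

section TailMeasure

variable {Ω : Type*} [MeasurableSpace Ω] {P : Measure Ω} [IsProbabilityMeasure P]
  {ι : Type*} [Fintype ι] {α : ι → ℝ} {X : Ω → ι → ℝ}

/-- `Λ` is the limit of the rescaled laws of `X` on the punctured space. -/
structure IsTailMeasure (P : Measure Ω) (α : ι → ℝ) (X : Ω → ι → ℝ) (C₀ : ℝ)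
    (Λ : Measure (Punctured ι)) : Prop where
  tailBounded : IsTailBounded P α X C₀
  regular : Λ.Regular
  tendsto_shell : ∀ (f : (ι → ℝ) → ℝ) (r K : ℝ), IsShellFun α r K f →
    Tendsto (tmean P α X f) atTop (𝓝 (∫ x, f x.1 ∂Λ))

lemma IsTestFun.exists_supp {f : (ι → ℝ) → ℝ} (hf : IsTestFun α f) :
    ∃ r, 0 < r ∧ ∀ x, f x ≠ 0 → r ≤ anorm α x := by
  obtain ⟨r, hr, hs⟩ := hf.support_away
  exact ⟨r, hr, fun x hx => hs (subset_tsupport f hx)⟩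

lemma isTestFun_of_supp (hα : ∀ i, 0 < α i) {f : (ι → ℝ) → ℝ} (hf : Continuous f) {C r : ℝ}
    (hC : ∀ x, |f x| ≤ C) (hr : 0 < r) (hs : ∀ x, f x ≠ 0 → r ≤ anorm α x) : IsTestFun α f :=
  ⟨hf, ⟨C, hC⟩, r, hr, closure_minimal (fun x hx => hs x hx)
    (isClosed_le continuous_const (continuous_anorm hα))⟩

/-- A trapezoidal function of one variable. -/
def trapezoid (u v z : ℝ) : ℝ := max 0 (min 1 (min (2 * z / u - 1) (2 - z / v)))

lemma continuous_trapezoid (u v : ℝ) : Continuous (trapezoid u v) := by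
  unfold trapezoid; fun_prop

lemma trapezoid_nonneg (u v z : ℝ) : 0 ≤ trapezoid u v z := le_max_left _ _

lemma trapezoid_le_one (u v z : ℝ) : trapezoid u v z ≤ 1 :=
  max_le zero_le_one (min_le_left _ _)

lemma abs_trapezoid_le (u v z : ℝ) : |trapezoid u v z| ≤ 1 := by
  rw [abs_of_nonneg (trapezoid_nonneg u v z)]; exact trapezoid_le_one u v z

lemma trapezoid_eq_one {u v z : ℝ} (hu : 0 < u) (hv : 0 < v) (h1 : u ≤ z) (h2 : z ≤ v) :
    trapezoid u v z = 1 := by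
  have a1 : 1 ≤ 2 * z / u - 1 := by
    have : 2 ≤ 2 * z / u := by rw [le_div_iff₀ hu]; linarith
    linarith
  have a2 : 1 ≤ 2 - z / v := by
    have : z / v ≤ 1 := by rw [div_le_one hv]; exact h2
    linarith
  rw [trapezoid, min_eq_left (le_min a1 a2), max_eq_right zero_le_one]

lemma trapezoid_supp {u v z : ℝ} (hu : 0 < u) (hv : 0 < v) (h : trapezoid u v z ≠ 0) :
    u / 2 ≤ z ∧ z ≤ 2 * v := by
  have hpos : 0 < min (2 * z / u - 1) (2 - z / v) := by
    by_contra hle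
    push Not at hle
    exact h (max_eq_left ((min_le_right _ _).trans hle))
  obtain ⟨h1, h2⟩ := lt_min_iff.1 hpos
  constructor
  · have : 1 < 2 * z / u := by linarith
    rw [lt_div_iff₀ hu] at this
    linarith
  · have : z / v < 2 := by linarith
    rw [div_lt_iff₀ hv] at this
    linarith

lemma isShellFun_trapezoid (hα : ∀ i, 0 < α i) {u v : ℝ} (hu : 0 < u) (hv : 0 < v) :
    IsShellFun α (u / 2) (2 * v) fun x : ι → ℝ => trapezoid u v (anorm α x) :=
  ⟨(continuous_trapezoid u v).comp (continuous_anorm hα), by positivity,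
    fun _ hx => trapezoid_supp hu hv hx⟩

lemma measurable_anorm_val (hα : ∀ i, 0 < α i) :
    Measurable fun x : Punctured ι => anorm α x.1 :=
  (measurable_anorm hα).comp measurable_subtype_coe

namespace IsTailMeasure

variable {C₀ : ℝ} {Λ : Measure (Punctured ι)}

lemma integrable_shell (h : IsTailMeasure P α X C₀ Λ) {f : (ι → ℝ) → ℝ} {r K : ℝ}
    (hf : IsShellFun α r K f) : Integrable (fun x : Punctured ι => f x.1) Λ := by
  have := h.regular
  exact (hf.restrict h.tailBounded.pos).continuous.integrable_of_hasCompactSupport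
    (hf.restrict h.tailBounded.pos).hasCompactSupport

/-- Trapezoids dominate the indicators of the shells u ≤ |x|_α ≤ n, and their integrals are limits
of means controlled by the tail bound. The factor 2 appears because their supports start at u/2. -/
lemma measure_tail_le (h : IsTailMeasure P α X C₀ Λ) {u : ℝ} (hu : 0 < u) :
    Λ {x | u ≤ anorm α x.1} ≤ ENNReal.ofReal (2 * C₀ / u) := by
  have hα := h.tailBounded.pos
  have hset : {x : Punctured ι | u ≤ anorm α x.1}
      = ⋃ n : ℕ, {x : Punctured ι | u ≤ anorm α x.1 ∧ anorm α x.1 ≤ n} := by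
    ext x
    simp only [mem_iUnion, mem_ofPred_eq]
    constructor
    · intro hx
      obtain ⟨n, hn⟩ := exists_nat_ge (anorm α x.1)
      exact ⟨n, hx, hn⟩
    · rintro ⟨n, hn⟩; exact hn.1
  have hmono : Monotone fun n : ℕ => {x : Punctured ι | u ≤ anorm α x.1 ∧ anorm α x.1 ≤ n} :=
    fun m n hmn x hx => ⟨hx.1, hx.2.trans (by exact_mod_cast hmn)⟩
  rw [hset, hmono.measure_iUnion]
  refine iSup_le fun n => ?_
  have hv : (0 : ℝ) < n + 1 := by positivity
  have hf := isShellFun_trapezoid (ι := ι) hα hu hv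
  have hi := h.integrable_shell hf
  have hle : ∫ x : Punctured ι, trapezoid u (n + 1) (anorm α x.1) ∂Λ ≤ 2 * C₀ / u := by
    refine le_of_tendsto (h.tendsto_shell _ _ _ hf) ?_
    filter_upwards [eventually_gt_atTop 0] with t ht
    refine (le_abs_self _).trans ((h.tailBounded.abs_tmean_le (C := 1) (fun x =>
      abs_trapezoid_le _ _ _) hf.pos (fun x hx => (hf.supp x hx).1) ht).trans (le_of_eq ?_))
    field_simp
  calc Λ {x | u ≤ anorm α x.1 ∧ anorm α x.1 ≤ n}
      = ∫⁻ x in {x | u ≤ anorm α x.1 ∧ anorm α x.1 ≤ n}, 1 ∂Λ := by simp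
    _ ≤ ∫⁻ x in {x | u ≤ anorm α x.1 ∧ anorm α x.1 ≤ n},
        ENNReal.ofReal (trapezoid u (n + 1) (anorm α x.1)) ∂Λ := by
        have hm : MeasurableSet {x : Punctured ι | u ≤ anorm α x.1 ∧ anorm α x.1 ≤ n} :=
          (measurableSet_le measurable_const (measurable_anorm_val hα)).inter
            (measurableSet_le (measurable_anorm_val hα) measurable_const)
        refine setLIntegral_mono' hm fun x hx => ?_
        rw [trapezoid_eq_one hu hv hx.1 (hx.2.trans (by linarith))]
        simp
    _ ≤ ∫⁻ x, ENNReal.ofReal (trapezoid u (n + 1) (anorm α x.1)) ∂Λ :=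
        setLIntegral_le_lintegral _ _
    _ = ENNReal.ofReal (∫ x : Punctured ι, trapezoid u (n + 1) (anorm α x.1) ∂Λ) :=
        (ofReal_integral_eq_lintegral_ofReal hi
          (Eventually.of_forall fun x => trapezoid_nonneg _ _ _)).symm
    _ ≤ _ := ENNReal.ofReal_le_ofReal hle

lemma measurableSet_le_anorm (hα : ∀ i, 0 < α i) (u : ℝ) :
    MeasurableSet {x : Punctured ι | u ≤ anorm α x.1} :=
  measurableSet_le measurable_const (measurable_anorm_val hα)

/-- Bounded measurable functions supported away from the origin are integrable. -/
lemma integrable_of_supp (h : IsTailMeasure P α X C₀ Λ) {f : (ι → ℝ) → ℝ} (hf : Measurable f)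
    {C r : ℝ} (hC : ∀ x, |f x| ≤ C) (hr : 0 < r) (hs : ∀ x, f x ≠ 0 → r ≤ anorm α x) :
    Integrable (fun x : Punctured ι => f x.1) Λ ∧
      |∫ x : Punctured ι, f x.1 ∂Λ| ≤ C * (2 * C₀ / r) := by
  have hα := h.tailBounded.pos
  have hE := measurableSet_le_anorm hα r
  have hC0 : 0 ≤ C := (abs_nonneg _).trans (hC 0)
  have hfin := (h.measure_tail_le hr).trans_lt ENNReal.ofReal_lt_top
  have hdom : Integrable ({x : Punctured ι | r ≤ anorm α x.1}.indicator fun _ => C) Λ :=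
    (integrable_indicator_iff hE).2 (integrableOn_const hfin.ne)
  have hle : ∀ x : Punctured ι,
      ‖f x.1‖ ≤ {x : Punctured ι | r ≤ anorm α x.1}.indicator (fun _ => C) x := by
    intro x
    by_cases hx : r ≤ anorm α x.1
    · rw [indicator_of_mem (show x ∈ {x : Punctured ι | r ≤ anorm α x.1} from hx)]; exact hC _
    · rw [indicator_of_notMem (show x ∉ {x : Punctured ι | r ≤ anorm α x.1} from hx)]
      have : f x.1 = 0 := by
        by_contra hne; exact hx (hs _ hne)
      simp [this]
  refine ⟨hdom.mono' (hf.comp measurable_subtype_coe).aestronglyMeasurable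
    (Eventually.of_forall hle), ?_⟩
  rw [← Real.norm_eq_abs]
  refine (norm_integral_le_of_norm_le hdom (Eventually.of_forall hle)).trans ?_
  rw [integral_indicator hE, setIntegral_const, smul_eq_mul, mul_comm]
  gcongr
  refine ENNReal.toReal_le_of_le_ofReal ?_ (h.measure_tail_le hr)
  have := h.tailBounded.nonneg
  positivity

lemma integrable (h : IsTailMeasure P α X C₀ Λ) {f : (ι → ℝ) → ℝ} (hf : IsTestFun α f) :
    Integrable (fun x : Punctured ι => f x.1) Λ := by
  obtain ⟨C, hC⟩ := hf.bounded
  obtain ⟨r, hr, hs⟩ := hf.exists_supp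
  exact (h.integrable_of_supp hf.continuous.measurable hC hr hs).1

/-- Convergence of the rescaled means of all test functions. -/
theorem tendsto_tmean (h : IsTailMeasure P α X C₀ Λ) {f : (ι → ℝ) → ℝ} (hf : IsTestFun α f) :
    Tendsto (tmean P α X f) atTop (𝓝 (∫ x, f x.1 ∂Λ)) := by
  have hα := h.tailBounded.pos
  obtain ⟨C, hC⟩ := hf.bounded
  obtain ⟨r, hr, hs⟩ := hf.exists_supp
  have hC0 : 0 ≤ C := (abs_nonneg _).trans (hC 0)
  have hC₀ := h.tailBounded.nonneg
  rw [Metric.tendsto_nhds]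
  intro κ hκ
  -- Beyond the level v the mean of the remainder is at most C C₀/v ≤ κ/8 and its integral at most
  -- twice that.
  set v := max r (8 * (C * C₀ + 1) / κ) with hv
  have hv0 : 0 < v := lt_of_lt_of_le hr (le_max_left _ _)
  set fv : (ι → ℝ) → ℝ := fun x => f x * trapezoid r v (anorm α x) with hfv
  have hfvc : Continuous fv := hf.continuous.mul
    ((continuous_trapezoid r v).comp (continuous_anorm hα))
  have hshell : IsShellFun α (r / 2) (2 * v) fv :=
    ⟨hfvc, by positivity, fun x hx => trapezoid_supp hr hv0 (right_ne_zero_of_mul hx)⟩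
  have hfvC : ∀ x, |fv x| ≤ C := fun x => by
    rw [hfv, abs_mul]
    exact (mul_le_of_le_one_right (abs_nonneg _) (abs_trapezoid_le _ _ _)).trans (hC x)
  set df : (ι → ℝ) → ℝ := fun x => f x - fv x with hdf
  have hdfC : ∀ x, |df x| ≤ C := fun x => by
    have : df x = f x * (1 - trapezoid r v (anorm α x)) := by simp only [hdf, hfv]; ring
    rw [this, abs_mul]
    refine (mul_le_of_le_one_right (abs_nonneg _) ?_).trans (hC x)
    rw [abs_of_nonneg (sub_nonneg.2 (trapezoid_le_one _ _ _))]
    linarith [trapezoid_nonneg r v (anorm α x)]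
  have hdfs : ∀ x, df x ≠ 0 → v ≤ anorm α x := by
    intro x hx
    by_contra hlt
    push Not at hlt
    refine hx ?_
    by_cases h0 : f x = 0
    · simp [hdf, hfv, h0]
    · simp only [hdf, hfv]
      rw [trapezoid_eq_one hr hv0 (hs x h0) hlt.le]; ring
  have hdfm : Measurable df := (hf.continuous.sub hfvc).measurable
  obtain ⟨hdi, hdle⟩ := h.integrable_of_supp hdfm hdfC hv0 hdfs
  have hCv : C * C₀ / v ≤ κ / 8 := by
    rw [div_le_iff₀ hv0]
    have h1 : 8 * (C * C₀ + 1) / κ ≤ v := le_max_right _ _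
    rw [div_le_iff₀ hκ] at h1
    nlinarith
  have e1 : ∫ x : Punctured ι, f x.1 ∂Λ = ∫ x : Punctured ι, fv x.1 ∂Λ
      + ∫ x : Punctured ι, df x.1 ∂Λ := by
    rw [← integral_add (h.integrable_shell hshell) hdi]
    congr 1; ext x; simp only [hdf]; ring
  filter_upwards [Metric.tendsto_nhds.1 (h.tendsto_shell _ _ _ hshell) (κ / 4) (by positivity),
    eventually_gt_atTop 0] with t h1 ht
  have h2 := h.tailBounded.tmean_sub hf.continuous hfvc hC hfvC t
  have h3 := h.tailBounded.abs_tmean_le hdfC hv0 hdfs ht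
  rw [← h2] at h3
  rw [Real.dist_eq] at h1 ⊢
  have e2 : C * (2 * C₀ / v) = 2 * (C * C₀ / v) := by ring
  have e3 : C * (C₀ / v) = C * C₀ / v := by ring
  rw [e2] at hdle
  rw [e3] at h3
  rw [abs_le] at h3 hdle
  rw [abs_lt] at h1 ⊢
  constructor <;> linarith

end IsTailMeasure

end TailMeasure

/-! ### Homogeneity and polar coordinates. -/

section Polar

variable {Ω : Type*} [MeasurableSpace Ω] {P : Measure Ω} [IsProbabilityMeasure P]
  {ι : Type*} [Fintype ι] {α : ι → ℝ} {X : Ω → ι → ℝ}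

lemma dil_ne_zero {u : ℝ} (hu : 0 < u) {x : ι → ℝ} (hx : x ≠ 0) : dil α u x ≠ 0 := by
  intro h
  refine hx ?_
  rw [← dil_one (α := α) x, ← inv_mul_cancel₀ hu.ne', ← dil_dil (inv_nonneg.2 hu.le) hu.le, h,
    dil_zero_right]

/-- Dilations of the punctured space. -/
def puncturedDil (α : ι → ℝ) {u : ℝ} (hu : 0 < u) : Punctured ι ≃ₜ Punctured ι where
  toFun x := ⟨dil α u x.1, dil_ne_zero hu x.2⟩
  invFun x := ⟨dil α u⁻¹ x.1, dil_ne_zero (inv_pos.2 hu) x.2⟩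
  left_inv x := Subtype.ext (by
    simp only [dil_dil (inv_nonneg.2 hu.le) hu.le, inv_mul_cancel₀ hu.ne', dil_one])
  right_inv x := Subtype.ext (by
    simp only [dil_dil hu.le (inv_nonneg.2 hu.le), mul_inv_cancel₀ hu.ne', dil_one])
  continuous_toFun := ((continuous_dil u).comp continuous_subtype_val).subtype_mk _
  continuous_invFun := ((continuous_dil u⁻¹).comp continuous_subtype_val).subtype_mk _

/-- The direction `δ_{1/|x|_α} x` of a nonzero vector. -/
def direction (hα : ∀ i, 0 < α i) (x : Punctured ι) : asphere α :=
  ⟨dil α (anorm α x.1)⁻¹ x.1, by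
    have h := (anorm_pos_iff hα).2 x.2
    show anorm α _ = 1
    rw [anorm_dil hα (inv_nonneg.2 h.le), inv_mul_cancel₀ h.ne']⟩

lemma continuous_direction (hα : ∀ i, 0 < α i) : Continuous (direction hα) := by
  refine Continuous.subtype_mk (continuous_pi fun i => ?_) _
  refine Continuous.mul ?_ ((continuous_apply i).comp continuous_subtype_val)
  refine Continuous.rpow_const ?_ fun x => Or.inl (inv_ne_zero ((anorm_pos_iff hα).2 x.2).ne')
  exact ((continuous_anorm hα).comp continuous_subtype_val).inv₀
    fun x => ((anorm_pos_iff hα).2 x.2).ne'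

lemma direction_puncturedDil (hα : ∀ i, 0 < α i) {u : ℝ} (hu : 0 < u) (x : Punctured ι) :
    direction hα (puncturedDil α hu x) = direction hα x := by
  have h := (anorm_pos_iff hα).2 x.2
  refine Subtype.ext ?_
  show dil α (anorm α (dil α u x.1))⁻¹ (dil α u x.1) = dil α (anorm α x.1)⁻¹ x.1
  rw [anorm_dil hα hu.le, dil_dil (by positivity) hu.le]
  congr 1
  field_simp

lemma dil_direction (hα : ∀ i, 0 < α i) (x : Punctured ι) :
    dil α (anorm α x.1) (direction hα x).1 = x.1 := by
  have h := (anorm_pos_iff hα).2 x.2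
  show dil α (anorm α x.1) (dil α (anorm α x.1)⁻¹ x.1) = x.1
  rw [dil_dil h.le (inv_nonneg.2 h.le), mul_inv_cancel₀ h.ne', dil_one]

/-- The angular part of a measure on the punctured space. -/
def angular (hα : ∀ i, 0 < α i) (Λ : Measure (Punctured ι)) : Measure (asphere α) :=
  (Λ.restrict {x | 1 < anorm α x.1}).map (direction hα)

lemma measurableSet_lt_anorm (hα : ∀ i, 0 < α i) (u : ℝ) :
    MeasurableSet {x : Punctured ι | u < anorm α x.1} :=
  measurableSet_lt measurable_const (measurable_anorm_val hα)

lemma angular_apply (hα : ∀ i, 0 < α i) (Λ : Measure (Punctured ι)) {U : Set (asphere α)}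
    (hU : MeasurableSet U) :
    angular hα Λ U = Λ {x | 1 < anorm α x.1 ∧ direction hα x ∈ U} := by
  rw [angular, Measure.map_apply (continuous_direction hα).measurable hU,
    Measure.restrict_apply ((continuous_direction hα).measurable hU), inter_comm]
  rfl

namespace IsTailMeasure

variable {C₀ : ℝ} {Λ : Measure (Punctured ι)}

/-- The limit measure is homogeneous of degree `-1` under dilations. -/
theorem map_puncturedDil (h : IsTailMeasure P α X C₀ Λ) {u : ℝ} (hu : 0 < u) :
    Λ.map (puncturedDil α hu) = ENNReal.ofReal u • Λ := by
  have hα := h.tailBounded.pos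
  haveI := h.regular
  haveI := Measure.Regular.map (μ := Λ) (puncturedDil α hu)
  haveI := Measure.Regular.smul (μ := Λ) (ENNReal.ofReal_ne_top (r := u))
  refine Measure.ext_of_integral_eq_on_compactlySupported fun φ => ?_
  rw [integral_map (puncturedDil α hu).continuous.aemeasurable
    (map_continuous φ).aestronglyMeasurable, integral_smul_measure, ENNReal.toReal_ofReal hu.le,
    smul_eq_mul]
  obtain ⟨r, K, hφ⟩ := isShellFun_extendZero hα φ
  have hshell : IsShellFun α (u⁻¹ * r) (u⁻¹ * K) fun x => extendZero φ (dil α u x) := by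
    refine ⟨hφ.continuous.comp (continuous_dil u), mul_pos (inv_pos.2 hu) hφ.pos, fun x hx => ?_⟩
    have := hφ.supp _ hx
    rw [anorm_dil hα hu.le] at this
    rw [inv_mul_le_iff₀ hu, le_inv_mul_iff₀ hu]
    exact this
  -- The rescaled mean of φ ∘ δ_u at t is u times the rescaled mean of φ at t/u; both are passed to
  -- the limit.
  have h1 := h.tendsto_shell _ _ _ hshell
  have h2 := ((h.tendsto_shell _ _ _ hφ).comp
    (tendsto_id.atTop_mul_const (inv_pos.2 hu))).const_mul u
  have e1 : ∫ x : Punctured ι, extendZero φ (dil α u x.1) ∂Λ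
      = ∫ x, φ (puncturedDil α hu x) ∂Λ :=
    integral_congr_ae (Eventually.of_forall fun x => extendZero_apply φ (puncturedDil α hu x))
  have e2 : ∫ x : Punctured ι, extendZero φ x.1 ∂Λ = ∫ x, φ x ∂Λ :=
    integral_congr_ae (Eventually.of_forall fun x => extendZero_apply φ x)
  rw [← e1, ← e2]
  refine tendsto_nhds_unique h1 (h2.congr' ?_)
  filter_upwards [eventually_gt_atTop 0] with t ht
  simp only [Function.comp, tmean, id]
  rw [← mul_assoc, mul_left_comm, mul_inv_cancel₀ hu.ne', mul_one]
  congr 2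
  ext ω
  rw [dil_dil hu.le (inv_nonneg.2 ht.le), mul_inv, inv_inv, mul_comm u]

/-- δ_a carries the part of a cone with |x|_α > a⁻¹ onto the part with |x|_α > 1. The parameter a is
a value of 1/|x|_α, the radial variable of the polar decomposition. -/
lemma measure_cone (h : IsTailMeasure P α X C₀ Λ) {a : ℝ} (ha : 0 < a) {U : Set (asphere α)}
    (hU : MeasurableSet U) :
    Λ {x | a⁻¹ < anorm α x.1 ∧ direction h.tailBounded.pos x ∈ U}
      = ENNReal.ofReal a * angular h.tailBounded.pos Λ U := by
  have hα := h.tailBounded.pos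
  rw [angular_apply hα Λ hU]
  have hm : MeasurableSet {x : Punctured ι | 1 < anorm α x.1 ∧ direction hα x ∈ U} :=
    (measurableSet_lt_anorm hα 1).inter ((continuous_direction hα).measurable hU)
  have key := congrArg (fun m => m {x : Punctured ι | 1 < anorm α x.1 ∧ direction hα x ∈ U})
    (h.map_puncturedDil ha)
  simp only [Measure.smul_apply, smul_eq_mul] at key
  rw [← key, Measure.map_apply (puncturedDil α ha).continuous.measurable hm]
  congr 1
  ext x
  simp only [mem_ofPred_eq, mem_preimage, direction_puncturedDil]
  refine and_congr_left fun _ => ?_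
  show _ ↔ 1 < anorm α (dil α a x.1)
  rw [anorm_dil hα ha.le, inv_lt_iff_one_lt_mul₀' ha]

lemma isFiniteMeasure_angular (h : IsTailMeasure P α X C₀ Λ) :
    IsFiniteMeasure (angular h.tailBounded.pos Λ) := by
  refine ⟨?_⟩
  rw [angular_apply _ _ MeasurableSet.univ]
  refine (measure_mono ?_).trans_lt ((h.measure_tail_le one_pos).trans_lt ENNReal.ofReal_lt_top)
  exact fun x hx => hx.1.le

/-- The polar decomposition of the limit measure. -/
theorem map_polar (h : IsTailMeasure P α X C₀ Λ) :
    Λ.map (fun x => ((anorm α x.1)⁻¹, direction h.tailBounded.pos x))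
      = (volume.restrict (Ioi (0 : ℝ))).prod (angular h.tailBounded.pos Λ) := by
  have hα := h.tailBounded.pos
  haveI := h.isFiniteMeasure_angular
  have hT : Measurable fun x : Punctured ι => ((anorm α x.1)⁻¹, direction hα x) :=
    (measurable_anorm_val hα).inv.prodMk (continuous_direction hα).measurable
  have hvol : ∀ a : ℝ, (volume.restrict (Ioi (0 : ℝ))) (Iio a) = ENNReal.ofReal a := by
    intro a
    rw [Measure.restrict_apply measurableSet_Iio, inter_comm, Ioi_inter_Iio, Real.volume_Ioo,
      sub_zero]
  -- In the variable 1/|x|_α the radial measure is Lebesgue measure on (0, ∞), and it is enough to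
  -- compare masses on the products (-∞, a) × U.
  refine (Measure.prod_eq_generateFrom (C := range Iio) (D := {U | MeasurableSet U})
    ?_ MeasurableSpace.generateFrom_measurableSet ?_ MeasurableSpace.isPiSystem_measurableSet
    ?_ ?_ ?_).symm
  · rw [← borel_eq_generateFrom_Iio]
    exact (BorelSpace.measurable_eq (α := ℝ)).symm
  · rintro _ ⟨a, rfl⟩ _ ⟨b, rfl⟩ _
    exact ⟨a ⊓ b, Iio_inter_Iio.symm⟩
  · exact
      { set := fun n => Iio (n : ℝ)
        set_mem := fun n => ⟨n, rfl⟩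
        finite := fun n => by rw [hvol]; exact ENNReal.ofReal_lt_top
        spanning := by
          refine eq_univ_of_forall fun x => ?_
          obtain ⟨n, hn⟩ := exists_nat_gt x
          exact mem_iUnion.2 ⟨n, hn⟩ }
  · exact Measure.toFiniteSpanningSetsIn _
  · rintro _ ⟨a, rfl⟩ U hU
    rw [hvol, Measure.map_apply hT (measurableSet_Iio.prod hU)]
    rcases le_or_gt a 0 with ha | ha
    · rw [ENNReal.ofReal_of_nonpos ha, zero_mul]
      convert measure_empty (μ := Λ)
      refine eq_empty_of_forall_notMem fun x hx => ?_
      have h1 : (anorm α x.1)⁻¹ < a := hx.1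
      have := inv_pos.2 ((anorm_pos_iff hα).2 x.2)
      linarith
    · rw [← h.measure_cone ha hU]
      congr 1
      ext x
      have h0 := (anorm_pos_iff hα).2 x.2
      show ((anorm α x.1)⁻¹ < a ∧ _) ↔ _
      rw [inv_lt_comm₀ h0 ha]
      rfl

/-- Integration in polar coordinates. -/
theorem integral_polar (h : IsTailMeasure P α X C₀ Λ) {f : (ι → ℝ) → ℝ} (hf : Measurable f)
    (hfi : Integrable (fun x : Punctured ι => f x.1) Λ) :
    ∫ x, f x.1 ∂Λ
      = ∫ r in Ioi (0 : ℝ), (∫ w, f (dil α r w.1) ∂(angular h.tailBounded.pos Λ)) / r ^ 2 := by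
  have hα := h.tailBounded.pos
  haveI := h.isFiniteMeasure_angular
  have hT : Measurable fun x : Punctured ι => ((anorm α x.1)⁻¹, direction hα x) :=
    (measurable_anorm_val hα).inv.prodMk (continuous_direction hα).measurable
  set g : ℝ × asphere α → ℝ := fun p => f (dil α p.1⁻¹ p.2.1) with hg
  have hgm : Measurable g := hf.comp (measurable_dil_uncurry.comp
    (measurable_fst.inv.prodMk (measurable_subtype_coe.comp measurable_snd)))
  have hgT : ∀ x : Punctured ι, g ((anorm α x.1)⁻¹, direction hα x) = f x.1 := fun x => by
    simp only [hg, inv_inv, dil_direction]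
  have hgi : Integrable g ((volume.restrict (Ioi (0 : ℝ))).prod (angular hα Λ)) := by
    rw [← h.map_polar, integrable_map_measure hgm.aestronglyMeasurable hT.aemeasurable]
    exact hfi.congr (Eventually.of_forall fun x => (hgT x).symm)
  have e1 : ∫ x, f x.1 ∂Λ = ∫ p, g p ∂((volume.restrict (Ioi (0 : ℝ))).prod (angular hα Λ)) := by
    rw [← h.map_polar, integral_map hT.aemeasurable hgm.aestronglyMeasurable]
    exact integral_congr_ae (Eventually.of_forall fun x => (hgT x).symm)
  -- The substitution r ↦ 1/r produces the density r⁻².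
  rw [e1, integral_prod _ hgi, ← integral_comp_rpow_Ioi _ (neg_ne_zero.2 one_ne_zero)]
  refine setIntegral_congr_fun measurableSet_Ioi fun r hr => ?_
  have hr0 : (0 : ℝ) < r := hr
  simp only [hg, smul_eq_mul]
  rw [abs_neg, abs_one, one_mul, Real.rpow_neg_one, inv_inv, div_eq_inv_mul]
  congr 1
  rw [show (-1 - 1 : ℝ) = -((2 : ℕ) : ℝ) by norm_num, Real.rpow_neg hr0.le, Real.rpow_natCast]

end IsTailMeasure

end Polar

/-! ### Tails of the gauge and convergence of the angular laws. -/

section Angular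

variable {Ω : Type*} [MeasurableSpace Ω] {P : Measure Ω} [IsProbabilityMeasure P]
  {ι : Type*} [Fintype ι] {α : ι → ℝ} {X : Ω → ι → ℝ}

/-- The piecewise linear function which vanishes before `a` and is `1` after `b`. -/
def ramp (a b z : ℝ) : ℝ := max 0 (min 1 ((z - a) / (b - a)))

lemma continuous_ramp (a b : ℝ) : Continuous (ramp a b) := by unfold ramp; fun_prop

lemma ramp_nonneg (a b z : ℝ) : 0 ≤ ramp a b z := le_max_left _ _

lemma ramp_le_one (a b z : ℝ) : ramp a b z ≤ 1 := max_le zero_le_one (min_le_left _ _)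

lemma ramp_eq_zero {a b z : ℝ} (hab : a < b) (hz : z ≤ a) : ramp a b z = 0 :=
  max_eq_left ((min_le_right _ _).trans
    (div_nonpos_of_nonpos_of_nonneg (by linarith) (by linarith)))

lemma ramp_eq_one {a b z : ℝ} (hab : a < b) (hz : b ≤ z) : ramp a b z = 1 := by
  rw [ramp, min_eq_left, max_eq_right zero_le_one]
  rw [le_div_iff₀ (by linarith)]; linarith

/-- A function of the direction, extended to a function on `ℝ^ι` which is constant on the orbits
of the dilations. -/
def radial (α : ι → ℝ) (φ : asphere α → ℝ) (x : ι → ℝ) : ℝ :=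
  Function.extend Subtype.val φ 0 (dil α (anorm α x)⁻¹ x)

lemma radial_val (hα : ∀ i, 0 < α i) (φ : asphere α → ℝ) (x : Punctured ι) :
    radial α φ x.1 = φ (direction hα x) :=
  Subtype.val_injective.extend_apply φ 0 (direction hα x)

lemma abs_radial_le {φ : asphere α → ℝ} {C : ℝ} (hC0 : 0 ≤ C) (hC : ∀ w, |φ w| ≤ C) (x : ι → ℝ) :
    |radial α φ x| ≤ C := by
  unfold radial Function.extend
  split_ifs with h
  · exact hC _
  · simpa using hC0

lemma measurableSet_asphere (hα : ∀ i, 0 < α i) : MeasurableSet (asphere α) :=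
  (measurable_anorm hα) (measurableSet_singleton 1)

lemma measurable_extend_asphere (hα : ∀ i, 0 < α i) {φ : asphere α → ℝ} (hφ : Measurable φ) :
    Measurable (Function.extend Subtype.val φ (0 : (ι → ℝ) → ℝ)) :=
  (MeasurableEmbedding.subtype_coe (measurableSet_asphere hα)).measurable_extend hφ
    measurable_const

lemma measurable_normalize (hα : ∀ i, 0 < α i) :
    Measurable fun x : ι → ℝ => dil α (anorm α x)⁻¹ x :=
  measurable_dil_uncurry.comp ((measurable_anorm hα).inv.prodMk measurable_id)

lemma measurable_radial (hα : ∀ i, 0 < α i) {φ : asphere α → ℝ} (hφ : Measurable φ) :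
    Measurable (radial α φ) :=
  (measurable_extend_asphere hα hφ).comp (measurable_normalize hα)

lemma radial_dil (hα : ∀ i, 0 < α i) (φ : asphere α → ℝ) {u : ℝ} (hu : 0 < u) {x : ι → ℝ}
    (hx : x ≠ 0) : radial α φ (dil α u x) = radial α φ x := by
  have h1 := radial_val hα φ (puncturedDil α hu ⟨x, hx⟩)
  rw [direction_puncturedDil, ← radial_val hα φ] at h1
  exact h1

lemma continuousAt_radial (hα : ∀ i, 0 < α i) {φ : asphere α → ℝ} (hφ : Continuous φ) {x : ι → ℝ}
    (hx : x ≠ 0) : ContinuousAt (radial α φ) x := by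
  have hopen : IsOpen {x : ι → ℝ | x ≠ 0} := isOpen_compl_singleton
  have := hopen.isOpenEmbedding_subtypeVal.continuousAt_iff (g := radial α φ) (x := ⟨x, hx⟩)
  refine this.1 (Continuous.continuousAt ?_)
  exact (hφ.comp (continuous_direction hα)).congr fun y => (radial_val hα φ y).symm

/-- The approximation of the indicator of `{|x|_α > 1}` from below. -/
lemma isTestFun_radial_mul_ramp (hα : ∀ i, 0 < α i) {φ : asphere α → ℝ} (hφ : Continuous φ)
    {C : ℝ} (hC0 : 0 ≤ C) (hC : ∀ w, |φ w| ≤ C) {ε : ℝ} (hε : 0 < ε) :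
    IsTestFun α fun x => radial α φ x * ramp 1 (1 + ε) (anorm α x) := by
  have hr : Continuous fun x : ι → ℝ => ramp 1 (1 + ε) (anorm α x) :=
    (continuous_ramp _ _).comp (continuous_anorm hα)
  refine isTestFun_of_supp hα (C := C) (r := 1) ?_ (fun x => ?_) one_pos fun x hx => ?_
  · rw [continuous_iff_continuousAt]
    intro x
    by_cases hx : x = 0
    -- The radial factor may be discontinuous at the origin, but the ramp vanishes in a
    -- neighbourhood of it.
    · have hev : (fun x => radial α φ x * ramp 1 (1 + ε) (anorm α x)) =ᶠ[𝓝 x] fun _ => 0 := by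
        have h1 : ∀ᶠ y in 𝓝 x, anorm α y < 1 :=
          (continuous_anorm hα).continuousAt.eventually_lt continuousAt_const
            (by rw [hx, anorm_zero hα]; exact one_pos)
        filter_upwards [h1] with y hy
        rw [ramp_eq_zero (by linarith) hy.le, mul_zero]
      exact continuousAt_const.congr hev.symm
    · exact (continuousAt_radial hα hφ hx).mul hr.continuousAt
  · rw [abs_mul, abs_of_nonneg (ramp_nonneg _ _ _)]
    exact (mul_le_of_le_one_right (abs_nonneg _) (ramp_le_one _ _ _)).trans
      (abs_radial_le hC0 hC x)
  · by_contra hlt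
    exact hx (by rw [ramp_eq_zero (by linarith) (not_le.1 hlt).le, mul_zero])

/-- A bump around `|x|_α = 1`. -/
def bump (ε z : ℝ) : ℝ := ramp (1 - ε) 1 z - ramp 1 (1 + ε) z

lemma bump_bounds {ε : ℝ} (hε : 0 < ε) (z : ℝ) : 0 ≤ bump ε z ∧ bump ε z ≤ 1 := by
  have h1 := ramp_nonneg (1 - ε) 1 z
  have h2 := ramp_le_one 1 (1 + ε) z
  have h3 := ramp_nonneg 1 (1 + ε) z
  have h4 := ramp_le_one (1 - ε) 1 z
  refine ⟨?_, by unfold bump; linarith⟩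
  unfold bump
  rcases le_total z 1 with h | h
  · rw [ramp_eq_zero (a := 1) (by linarith) h]; linarith
  · rw [ramp_eq_one (b := 1) (by linarith) h]; linarith

lemma isShellFun_bump (hα : ∀ i, 0 < α i) {ε : ℝ} (hε : 0 < ε) (hε1 : ε < 1) :
    IsShellFun α (1 - ε) (1 + ε) fun x : ι → ℝ => bump ε (anorm α x) := by
  refine ⟨((continuous_ramp _ _).sub (continuous_ramp _ _)).comp (continuous_anorm hα),
    by linarith, fun x hx => ⟨?_, ?_⟩⟩
  · by_contra hlt
    refine hx ?_
    rw [bump, ramp_eq_zero (by linarith) (not_le.1 hlt).le,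
      ramp_eq_zero (by linarith) (by linarith), sub_zero]
  · by_contra hlt
    refine hx ?_
    rw [bump, ramp_eq_one (by linarith) (by linarith),
      ramp_eq_one (by linarith) (not_le.1 hlt).le, sub_self]

/-- The restriction of a radial function to `{|x|_α > 1}`. -/
def radialTail (α : ι → ℝ) (φ : asphere α → ℝ) (x : ι → ℝ) : ℝ :=
  {y | 1 < anorm α y}.indicator (radial α φ) x

lemma abs_radialTail_sub_le {φ : asphere α → ℝ} {C : ℝ} (hC0 : 0 ≤ C)
    (hC : ∀ w, |φ w| ≤ C) {ε : ℝ} (hε : 0 < ε) (x : ι → ℝ) :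
    |radialTail α φ x - radial α φ x * ramp 1 (1 + ε) (anorm α x)|
      ≤ C * bump ε (anorm α x) := by
  have h0 := (bump_bounds hε (anorm α x)).1
  have h1 := abs_radial_le hC0 hC x
  have h2 := ramp_le_one 1 (1 + ε) (anorm α x)
  unfold radialTail
  by_cases hx : 1 < anorm α x
  · rw [indicator_of_mem (show x ∈ {y | 1 < anorm α y} from hx)]
    have e : radial α φ x - radial α φ x * ramp 1 (1 + ε) (anorm α x)
        = radial α φ x * bump ε (anorm α x) := by
      rw [bump, ramp_eq_one (b := 1) (by linarith) hx.le]; ring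
    rw [e, abs_mul, abs_of_nonneg h0]
    gcongr
  · rw [indicator_of_notMem (show x ∉ {y | 1 < anorm α y} from hx),
      ramp_eq_zero (by linarith) (not_lt.1 hx)]
    simp only [mul_zero, sub_zero, abs_zero]
    positivity

lemma measurable_radialTail (hα : ∀ i, 0 < α i) {φ : asphere α → ℝ} (hφ : Measurable φ) :
    Measurable (radialTail α φ) :=
  (measurable_radial hα hφ).indicator (measurableSet_lt measurable_const (measurable_anorm hα))

lemma abs_radialTail_le {φ : asphere α → ℝ} {C : ℝ} (hC0 : 0 ≤ C) (hC : ∀ w, |φ w| ≤ C)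
    (x : ι → ℝ) : |radialTail α φ x| ≤ C := by
  unfold radialTail
  by_cases hx : x ∈ {y | 1 < anorm α y}
  · rw [indicator_of_mem hx]; exact abs_radial_le hC0 hC x
  · rw [indicator_of_notMem hx]; simpa using hC0

lemma radialTail_supp {φ : asphere α → ℝ} {x : ι → ℝ} (hx : radialTail α φ x ≠ 0) :
    1 ≤ anorm α x := by
  have : x ∈ {y | 1 < anorm α y} := mem_of_indicator_ne_zero hx
  exact le_of_lt this

lemma radialTail_dil (hα : ∀ i, 0 < α i) (φ : asphere α → ℝ) {t : ℝ} (ht : 0 < t) (x : ι → ℝ) :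
    radialTail α φ (dil α t⁻¹ x) = {y | t < anorm α y}.indicator (radial α φ) x := by
  unfold radialTail
  have hiff : 1 < anorm α (dil α t⁻¹ x) ↔ t < anorm α x := by
    rw [anorm_dil hα (inv_nonneg.2 ht.le), lt_inv_mul_iff₀ ht, mul_one]
  by_cases hx : t < anorm α x
  · rw [indicator_of_mem (show x ∈ {y | t < anorm α y} from hx),
      indicator_of_mem (show dil α t⁻¹ x ∈ {y | 1 < anorm α y} from hiff.2 hx)]
    exact radial_dil hα φ (inv_pos.2 ht) ((anorm_pos_iff hα).1 (ht.trans hx))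
  · rw [indicator_of_notMem (show x ∉ {y | t < anorm α y} from hx),
      indicator_of_notMem (show dil α t⁻¹ x ∉ {y | 1 < anorm α y} from fun h => hx (hiff.1 h))]

namespace IsTailMeasure

variable {C₀ : ℝ} {Λ : Measure (Punctured ι)}

/-- By homogeneity {|x|_α > a} has mass m/a, so a shell of width of order ε around the unit sphere
has mass of order ε. This makes the discontinuity of the indicator of {|x|_α > 1} harmless. -/
lemma integral_bump_le (h : IsTailMeasure P α X C₀ Λ) {ε : ℝ} (hε : 0 < ε) (hε2 : ε ≤ 1 / 2) :
    ∫ x : Punctured ι, bump ε (anorm α x.1) ∂Λ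
      ≤ 4 * ε * (angular h.tailBounded.pos Λ).real univ := by
  have hα := h.tailBounded.pos
  set m := (angular hα Λ).real univ with hm
  have hm0 : 0 ≤ m := measureReal_nonneg
  have hmeas : ∀ a : ℝ, 0 < a → Λ.real {x : Punctured ι | a < anorm α x.1} = a⁻¹ * m := by
    intro a ha
    have := h.measure_cone (inv_pos.2 ha) MeasurableSet.univ
    simp only [inv_inv, mem_univ, and_true] at this
    rw [measureReal_def, this, ENNReal.toReal_mul, ENNReal.toReal_ofReal (by positivity)]
    rfl
  have hfin : ∀ a : ℝ, 0 < a → Λ {x : Punctured ι | a < anorm α x.1} ≠ ∞ := fun a ha =>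
    ((measure_mono (t := {x : Punctured ι | a ≤ anorm α x.1})
      fun x (hx : a < anorm α x.1) => hx.le).trans_lt
      ((h.measure_tail_le ha).trans_lt ENNReal.ofReal_lt_top)).ne
  have hind : ∀ a : ℝ, 0 < a → Integrable
      ({x : Punctured ι | a < anorm α x.1}.indicator fun _ => (1 : ℝ)) Λ := fun a ha =>
    (integrable_indicator_iff (measurableSet_lt_anorm hα a)).2 (integrableOn_const (hfin a ha))
  have hvalue : ∀ a : ℝ, 0 < a →
      ∫ x, {x : Punctured ι | a < anorm α x.1}.indicator (fun _ => (1 : ℝ)) x ∂Λ = a⁻¹ * m := by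
    intro a ha
    rw [integral_indicator (measurableSet_lt_anorm hα a), setIntegral_const, smul_eq_mul, mul_one,
      hmeas a ha]
  have hle : ∫ x : Punctured ι, bump ε (anorm α x.1) ∂Λ
      ≤ (1 - ε)⁻¹ * m - (1 + ε)⁻¹ * m := by
    rw [← hvalue _ (by linarith : (0 : ℝ) < 1 - ε), ← hvalue _ (by linarith : (0 : ℝ) < 1 + ε),
      ← integral_sub (hind _ (by linarith)) (hind _ (by linarith))]
    refine integral_mono (h.integrable_shell (isShellFun_bump hα hε (by linarith)))
      ((hind _ (by linarith)).sub (hind _ (by linarith))) fun x => ?_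
    simp only [bump, indicator, mem_ofPred_eq]
    have b1 := ramp_le_one (1 - ε) 1 (anorm α x.1)
    have b2 := ramp_nonneg 1 (1 + ε) (anorm α x.1)
    split_ifs with c1 c2 c2
    · rw [ramp_eq_one (a := 1) (by linarith) c2.le]; linarith
    · linarith
    · linarith
    · rw [ramp_eq_zero (b := 1) (by linarith) (not_lt.1 c1)]; linarith
  refine hle.trans ?_
  have e : (1 - ε)⁻¹ * m - (1 + ε)⁻¹ * m = (2 * ε / ((1 - ε) * (1 + ε))) * m := by
    have : 1 - ε ≠ 0 := by linarith
    have : 1 + ε ≠ 0 := by linarith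
    field_simp; ring
  rw [e]
  gcongr
  have hhalf : 1 / 2 ≤ (1 - ε) * (1 + ε) := by nlinarith
  rw [div_le_iff₀ (by linarith)]
  nlinarith

/-- Convergence of the unnormalised angular laws. -/
theorem tendsto_radial (h : IsTailMeasure P α X C₀ Λ) {φ : asphere α → ℝ} (hφ : Continuous φ)
    {C : ℝ} (hC0 : 0 ≤ C) (hC : ∀ w, |φ w| ≤ C) :
    Tendsto (fun t => t * ∫ ω in {ω | t < anorm α (X ω)}, radial α φ (X ω) ∂P) atTop
      (𝓝 (∫ w, φ w ∂(angular h.tailBounded.pos Λ))) := by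
  have hα := h.tailBounded.pos
  have hX := h.tailBounded.meas
  have hlim : ∫ w, φ w ∂(angular hα Λ) = ∫ x : Punctured ι, radialTail α φ x.1 ∂Λ := by
    rw [angular, integral_map (continuous_direction hα).aemeasurable hφ.aestronglyMeasurable,
      ← integral_indicator (measurableSet_lt_anorm hα 1)]
    refine integral_congr_ae (Eventually.of_forall fun x => ?_)
    simp only [radialTail, indicator, mem_ofPred_eq, radial_val hα]
  have hpre : ∀ t, 0 < t → t * ∫ ω in {ω | t < anorm α (X ω)}, radial α φ (X ω) ∂P
      = tmean P α X (radialTail α φ) t := by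
    intro t ht
    have hE : MeasurableSet {ω | t < anorm α (X ω)} :=
      measurableSet_lt measurable_const ((measurable_anorm hα).comp hX)
    rw [tmean, ← integral_indicator hE]
    congr 2
    ext ω
    rw [radialTail_dil hα φ ht]
    rfl
  rw [hlim]
  set m := (angular hα Λ).real univ with hm
  have hm0 : 0 ≤ m := measureReal_nonneg
  obtain ⟨hGi, -⟩ := h.integrable_of_supp (measurable_radialTail hα hφ.measurable)
    (abs_radialTail_le hC0 hC) one_pos fun x hx => radialTail_supp hx
  rw [Metric.tendsto_nhds]
  intro κ hκ
  -- The factor 32 brings C · 4εm below κ/8.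
  set q := 32 * (C + 1) * (m + 1) with hq
  have hq0 : 0 < q := by positivity
  set ε := min (1 / 2) (κ / q) with hεdef
  have hε : 0 < ε := lt_min (by norm_num) (by positivity)
  have hε2 : ε ≤ 1 / 2 := min_le_left _ _
  have hεq : C * (4 * ε * m) ≤ κ / 8 := by
    have h1 : ε * q ≤ κ := (le_div_iff₀ hq0).1 (min_le_right _ _)
    have h2 : C * m ≤ (C + 1) * (m + 1) := by nlinarith
    have h3 : ε * (C * m) ≤ ε * ((C + 1) * (m + 1)) := by gcongr
    rw [hq] at h1
    nlinarith
  -- The sharp cut at |x|_α = 1 becomes a ramp. The error is at most C times a bump, a shell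
  -- function, so it is small for Λ and, for large t, for the rescaled law of X.
  set g : (ι → ℝ) → ℝ := fun x => radial α φ x * ramp 1 (1 + ε) (anorm α x) with hg
  have hgt : IsTestFun α g := isTestFun_radial_mul_ramp hα hφ hC0 hC hε
  obtain ⟨D, hD⟩ := hgt.bounded
  obtain ⟨r, hr, hrs⟩ := hgt.exists_supp
  obtain ⟨hgi, -⟩ := h.integrable_of_supp hgt.continuous.measurable hD hr hrs
  have hb := isShellFun_bump (ι := ι) hα hε (by linarith)
  have hbi := h.integrable_shell hb
  have hI := h.integral_bump_le hε hε2
  have hmeasure : |∫ x : Punctured ι, radialTail α φ x.1 ∂Λ - ∫ x : Punctured ι, g x.1 ∂Λ|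
      ≤ C * ∫ x : Punctured ι, bump ε (anorm α x.1) ∂Λ := by
    rw [← integral_sub hGi hgi, ← integral_const_mul, ← Real.norm_eq_abs]
    exact norm_integral_le_of_norm_le (hbi.const_mul C)
      (Eventually.of_forall fun x => abs_radialTail_sub_le hC0 hC hε x.1)
  have hprob : ∀ t, 0 < t → |tmean P α X (radialTail α φ) t - tmean P α X g t|
      ≤ C * tmean P α X (fun x => bump ε (anorm α x)) t := by
    intro t ht
    have i1 : Integrable (fun ω => radialTail α φ (dil α t⁻¹ (X ω))) P :=
      Integrable.of_bound ((measurable_radialTail hα hφ.measurable).comp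
        ((continuous_dil t⁻¹).measurable.comp hX)).aestronglyMeasurable C
        (Eventually.of_forall fun ω => abs_radialTail_le hC0 hC _)
    have i2 := integrable_comp_dil (P := P) (α := α) hX hgt.continuous hD t⁻¹
    have i3 := integrable_comp_dil (P := P) (α := α) hX hb.continuous (C := 1)
      (fun x => abs_le.2 ⟨by linarith [(bump_bounds hε (anorm α x)).1],
        (bump_bounds hε (anorm α x)).2⟩) t⁻¹
    rw [tmean, tmean, tmean, ← mul_sub, abs_mul, abs_of_pos ht, ← integral_sub i1 i2,
      mul_left_comm, ← integral_const_mul, ← Real.norm_eq_abs]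
    gcongr
    exact norm_integral_le_of_norm_le (i3.const_mul C)
      (Eventually.of_forall fun ω => abs_radialTail_sub_le hC0 hC hε _)
  have hκ' : 0 < κ / (8 * (C + 1)) := by positivity
  filter_upwards [Metric.tendsto_nhds.1 (h.tendsto_tmean hgt) (κ / 8) (by positivity),
    Metric.tendsto_nhds.1 (h.tendsto_shell _ _ _ hb) (κ / (8 * (C + 1))) hκ',
    eventually_gt_atTop 0] with t h1 h2 ht
  rw [hpre t ht]
  have h3 := hprob t ht
  rw [Real.dist_eq] at h1 h2 ⊢
  have h4 : tmean P α X (fun x => bump ε (anorm α x)) t ≤ 4 * ε * m + κ / (8 * (C + 1)) := by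
    linarith [(abs_lt.1 h2).2]
  have h5 : C * tmean P α X (fun x => bump ε (anorm α x)) t ≤ κ / 8 + κ / 8 := by
    calc C * tmean P α X (fun x => bump ε (anorm α x)) t
        ≤ C * (4 * ε * m + κ / (8 * (C + 1))) := by gcongr
      _ = C * (4 * ε * m) + C * (κ / (8 * (C + 1))) := by ring
      _ ≤ κ / 8 + (C + 1) * (κ / (8 * (C + 1))) := by gcongr; linarith
      _ = κ / 8 + κ / 8 := by field_simp
  have h6 : C * ∫ x : Punctured ι, bump ε (anorm α x.1) ∂Λ ≤ κ / 8 :=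
    (mul_le_mul_of_nonneg_left hI hC0).trans hεq
  rw [abs_le] at h3 hmeasure
  rw [abs_lt] at h1 ⊢
  constructor <;> linarith

/-- The tail of `|X|_α`. -/
theorem tendsto_tail (h : IsTailMeasure P α X C₀ Λ) :
    Tendsto (fun t => t * P.real {ω | t < anorm α (X ω)}) atTop
      (𝓝 ((angular h.tailBounded.pos Λ).real univ)) := by
  have hα := h.tailBounded.pos
  have h1 := h.tendsto_radial (φ := fun _ => 1) continuous_const zero_le_one (by simp)
  simp only [integral_const, smul_eq_mul, mul_one] at h1
  refine h1.congr' ?_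
  filter_upwards [eventually_gt_atTop 0] with t ht
  congr 1
  have hE : MeasurableSet {ω | t < anorm α (X ω)} :=
    measurableSet_lt measurable_const ((measurable_anorm hα).comp h.tailBounded.meas)
  rw [setIntegral_congr_fun (g := fun _ => (1 : ℝ)) hE fun ω hω => ?_]
  · simp
  · exact radial_val hα (fun _ => 1) ⟨X ω, (anorm_pos_iff hα).1 (ht.trans hω)⟩

end IsTailMeasure

/-- The `comap` to the sphere loses no mass: on |X|_α > t > 0 the normalised vector lies on the
sphere. -/
lemma integral_angularLaw {d : ℕ} {α : Fin d → ℝ} {X : Ω → Fin d → ℝ} (hα : ∀ i, 0 < α i)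
    (hX : Measurable X) {φ : asphere α → ℝ} (hφ : Measurable φ) {t : ℝ} (ht : 0 < t) :
    ∫ w, φ w ∂(angularLaw P α X t) = (P.real {ω | t < anorm α (X ω)})⁻¹ *
      ∫ ω in {ω | t < anorm α (X ω)}, radial α φ (X ω) ∂P := by
  have hS := measurableSet_asphere hα
  have hT : Measurable fun ω => dil α (anorm α (X ω))⁻¹ (X ω) := (measurable_normalize hα).comp hX
  have hE : MeasurableSet {ω | t < anorm α (X ω)} :=
    measurableSet_lt measurable_const ((measurable_anorm hα).comp hX)
  have e1 : ∫ w, φ w ∂(angularLaw P α X t) = ∫ w : asphere α,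
      Function.extend Subtype.val φ (0 : (Fin d → ℝ) → ℝ) w.1 ∂(angularLaw P α X t) :=
    integral_congr_ae (Eventually.of_forall fun w =>
      (Subtype.val_injective.extend_apply φ 0 w).symm)
  rw [e1, angularLaw, integral_subtype_comap hS, setIntegral_map hS
    (measurable_extend_asphere hα hφ).aestronglyMeasurable hT.aemeasurable,
    ← integral_indicator (hT hS), ProbabilityTheory.cond, integral_smul_measure,
    ENNReal.toReal_inv, smul_eq_mul]
  congr 1
  refine setIntegral_congr_fun hE fun ω hω => ?_
  refine indicator_of_mem (s := _ ⁻¹' asphere α) ?_ _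
  exact (direction hα ⟨X ω, (anorm_pos_iff hα).1 (ht.trans hω)⟩).2

/-- Weak convergence of the angular laws. -/
theorem IsTailMeasure.tendsto_angularLaw {d : ℕ} {α : Fin d → ℝ} {X : Ω → Fin d → ℝ} {C₀ : ℝ}
    {Λ : Measure (Punctured (Fin d))} (h : IsTailMeasure P α X C₀ Λ)
    (hpos : 0 < (angular h.tailBounded.pos Λ).real univ)
    (φ : BoundedContinuousFunction (asphere α) ℝ) :
    Tendsto (fun t => ∫ w, φ w ∂(angularLaw P α X t)) atTop
      (𝓝 (((angular h.tailBounded.pos Λ).real univ)⁻¹ *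
        ∫ w, φ w ∂(angular h.tailBounded.pos Λ))) := by
  have h1 := h.tendsto_radial φ.continuous (norm_nonneg φ) φ.norm_coe_le_norm
  refine ((h.tendsto_tail.inv₀ hpos.ne').mul h1).congr' ?_
  filter_upwards [eventually_gt_atTop 0] with t ht
  rw [integral_angularLaw h.tailBounded.pos h.tailBounded.meas φ.continuous.measurable ht, mul_inv,
    mul_mul_mul_comm, inv_mul_cancel₀ ht.ne', one_mul]

end Angular

/-! ### Two components with different multipliers. -/

section Independence

variable {Ω : Type*} [MeasurableSpace Ω] {P : Measure Ω} [IsProbabilityMeasure P]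

/-- If `R₁`, `R₂` have mean one and differ, their geometric mean has mean less than one. -/
lemma integral_sqrt_mul_lt_one {R₁ R₂ : Ω → ℝ} (h₁ : Measurable R₁) (h₂ : Measurable R₂)
    (h₁0 : ∀ ω, 0 ≤ R₁ ω) (h₂0 : ∀ ω, 0 ≤ R₂ ω) (i₁ : Integrable R₁ P) (i₂ : Integrable R₂ P)
    (m₁ : ∫ ω, R₁ ω ∂P = 1) (m₂ : ∫ ω, R₂ ω ∂P = 1) (hne : ¬ ∀ᵐ ω ∂P, R₁ ω = R₂ ω) :
    Integrable (fun ω => √(R₁ ω * R₂ ω)) P ∧ ∫ ω, √(R₁ ω * R₂ ω) ∂P < 1 := by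
  -- Taking means, E(√R₁ - √R₂)² = 2 - 2 E√(R₁R₂), and the left side is positive unless R₁ = R₂
  -- almost surely.
  have hid : ∀ ω, (√(R₁ ω) - √(R₂ ω)) ^ 2 = R₁ ω + R₂ ω - 2 * √(R₁ ω * R₂ ω) := by
    intro ω
    rw [Real.sqrt_mul (h₁0 ω), sub_sq, Real.sq_sqrt (h₁0 ω), Real.sq_sqrt (h₂0 ω)]
    ring
  have hi : Integrable (fun ω => √(R₁ ω * R₂ ω)) P := by
    refine (i₁.add i₂).mono' (h₁.mul h₂).sqrt.aestronglyMeasurable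
      (Eventually.of_forall fun ω => ?_)
    rw [Real.norm_of_nonneg (Real.sqrt_nonneg _)]
    have := hid ω
    have h0 := Real.sqrt_nonneg (R₁ ω * R₂ ω)
    have h2 := sq_nonneg (√(R₁ ω) - √(R₂ ω))
    simp only [Pi.add_apply]
    linarith
  have hsq : Integrable (fun ω => (√(R₁ ω) - √(R₂ ω)) ^ 2) P := by
    simp_rw [hid]
    exact (i₁.add i₂).sub (hi.const_mul 2)
  have hval : ∫ ω, (√(R₁ ω) - √(R₂ ω)) ^ 2 ∂P = 2 - 2 * ∫ ω, √(R₁ ω * R₂ ω) ∂P := by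
    simp_rw [hid]
    rw [integral_sub (f := fun ω => R₁ ω + R₂ ω) (i₁.add i₂) (hi.const_mul 2), integral_add i₁ i₂, m₁, m₂, integral_const_mul]
    norm_num
  have hpos : 0 < ∫ ω, (√(R₁ ω) - √(R₂ ω)) ^ 2 ∂P := by
    refine lt_of_le_of_ne (integral_nonneg fun ω => sq_nonneg _) fun h0 => hne ?_
    have := (integral_eq_zero_iff_of_nonneg (fun ω => sq_nonneg _) hsq).1 h0.symm
    filter_upwards [this] with ω hω
    have h3 : √(R₁ ω) - √(R₂ ω) = 0 := pow_eq_zero_iff two_ne_zero |>.1 hω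
    exact (Real.sqrt_inj (h₁0 ω) (h₂0 ω)).1 (sub_eq_zero.1 h3)
  exact ⟨hi, by linarith⟩

lemma sqrt_add_le {x y : ℝ} (hx : 0 ≤ x) (hy : 0 ≤ y) : √(x + y) ≤ √x + √y := by
  refine Real.sqrt_le_iff.2 ⟨by positivity, ?_⟩
  rw [add_sq, Real.sq_sqrt hx, Real.sq_sqrt hy]
  have := mul_nonneg (Real.sqrt_nonneg x) (Real.sqrt_nonneg y)
  nlinarith

/-- The geometric mean of two components with different multipliers is integrable. -/
theorem integrable_sqrt_mul {Y₁ Y₂ Y₁' Y₂' R₁ R₂ b₁ b₂ : Ω → ℝ}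
    (hY₁ : Measurable Y₁) (hY₂ : Measurable Y₂) (hY₁' : Measurable Y₁') (hY₂' : Measurable Y₂')
    (hR₁ : Measurable R₁) (hR₂ : Measurable R₂) (hb₁ : Measurable b₁) (hb₂ : Measurable b₂)
    (Y₁0 : ∀ ω, 0 ≤ Y₁ ω) (Y₂0 : ∀ ω, 0 ≤ Y₂ ω) (Y₁0' : ∀ ω, 0 ≤ Y₁' ω)
    (R₁0 : ∀ ω, 0 ≤ R₁ ω) (R₂0 : ∀ ω, 0 ≤ R₂ ω) (b₁0 : ∀ ω, 0 ≤ b₁ ω) (b₂0 : ∀ ω, 0 ≤ b₂ ω)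
    (hlaw : P.map (fun ω => √(Y₁ ω * Y₂ ω)) = P.map fun ω => √(Y₁' ω * Y₂' ω))
    (hind : IndepFun (fun ω => √(R₁ ω * R₂ ω)) (fun ω => √(Y₁ ω * Y₂ ω)) P)
    (hle₁ : ∀ ε : ℝ, 0 < ε → ∃ C, 0 ≤ C ∧ ∀ ω, Y₁' ω ≤ (1 + ε) * (R₁ ω * Y₁ ω) + C * b₁ ω)
    (hle₂ : ∀ ε : ℝ, 0 < ε → ∃ C, 0 ≤ C ∧ ∀ ω, Y₂' ω ≤ (1 + ε) * (R₂ ω * Y₂ ω) + C * b₂ ω)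
    (i₁ : Integrable R₁ P) (i₂ : Integrable R₂ P)
    (m₁ : ∫ ω, R₁ ω ∂P = 1) (m₂ : ∫ ω, R₂ ω ∂P = 1) (hne : ¬ ∀ᵐ ω ∂P, R₁ ω = R₂ ω)
    (hbm₁ : ∃ σ : ℝ, 0 < σ ∧ Integrable (fun ω => b₁ ω ^ (1 + σ)) P)
    (hbm₂ : ∃ σ : ℝ, 0 < σ ∧ Integrable (fun ω => b₂ ω ^ (1 + σ)) P)
    (hw₁ : ∀ β : ℝ, 0 < β → β < 1 → Integrable (fun ω => (R₁ ω * Y₁ ω) ^ β) P)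
    (hw₂ : ∀ β : ℝ, 0 < β → β < 1 → Integrable (fun ω => (R₂ ω * Y₂ ω) ^ β) P)
    (hwb : ∀ β : ℝ, 0 < β → β < 1 → Integrable (fun ω => b₂ ω ^ β) P) :
    Integrable (fun ω => √(Y₁ ω * Y₂ ω)) P := by
  obtain ⟨hri, hr1⟩ := integral_sqrt_mul_lt_one hR₁ hR₂ R₁0 R₂0 i₁ i₂ m₁ m₂ hne
  set ρ := ∫ ω, √(R₁ ω * R₂ ω) ∂P with hρ
  have hρ0 : 0 ≤ ρ := integral_nonneg fun ω => Real.sqrt_nonneg _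
  set ε := (1 - ρ) / 2 with hε
  have hε0 : 0 < ε := by rw [hε]; linarith
  obtain ⟨C₁, C₁0, hC₁⟩ := hle₁ ε hε0
  obtain ⟨C₂, C₂0, hC₂⟩ := hle₂ ε hε0
  have cross : ∀ {Z W : Ω → ℝ}, Measurable Z → Measurable W → (∀ ω, 0 ≤ Z ω) → (∀ ω, 0 ≤ W ω) →
      (∃ σ : ℝ, 0 < σ ∧ Integrable (fun ω => Z ω ^ (1 + σ)) P) →
      (∀ β : ℝ, 0 < β → β < 1 → Integrable (fun ω => W ω ^ β) P) →
      Integrable (fun ω => √(Z ω) * √(W ω)) P := by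
    intro Z W hZ hW hZ0 hW0 ⟨σ, hσ, hZi⟩ hWi
    have := integrable_rpow_mul_rpow (η := 1 / 2) hZ hW hZ0 hW0 hσ (by norm_num) (by norm_num)
      hZi hWi
    simp only [Real.sqrt_eq_rpow]
    convert this using 4
    norm_num
  have c1 := cross hb₂ (hR₁.mul hY₁) b₂0 (fun ω => mul_nonneg (R₁0 ω) (Y₁0 ω)) hbm₂ hw₁
  have c2 := cross hb₁ (hR₂.mul hY₂) b₁0 (fun ω => mul_nonneg (R₂0 ω) (Y₂0 ω)) hbm₁ hw₂
  have c3 := cross hb₁ hb₂ b₁0 b₂0 hbm₁ hwb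
  have key : ∀ {Y' R Y b : Ω → ℝ} {C : ℝ}, 0 ≤ C → (∀ ω, 0 ≤ R ω * Y ω) → (∀ ω, 0 ≤ b ω) →
      (∀ ω, Y' ω ≤ (1 + ε) * (R ω * Y ω) + C * b ω) →
      ∀ ω, √(Y' ω) ≤ √(1 + ε) * √(R ω * Y ω) + √C * √(b ω) := by
    intro Y' R Y b C hC hRY hb hle ω
    refine (Real.sqrt_le_sqrt (hle ω)).trans ?_
    rw [← Real.sqrt_mul (by linarith), ← Real.sqrt_mul hC]
    exact sqrt_add_le (mul_nonneg (by linarith) (hRY ω)) (mul_nonneg hC (hb ω))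
  -- The product of the two square-root bounds has leading term (1 + ε)√(R₁R₂)√(Y₁Y₂), a contraction
  -- by the choice of ε. Each of the three other terms contains a b with more than a first moment,
  -- and is integrable by the case η = 1/2 of the mixed moments.
  set V : Ω → ℝ := fun ω => √(1 + ε) * √C₂ * (√(b₂ ω) * √(R₁ ω * Y₁ ω))
    + √(1 + ε) * √C₁ * (√(b₁ ω) * √(R₂ ω * Y₂ ω)) + √C₁ * √C₂ * (√(b₁ ω) * √(b₂ ω)) with hV
  have hVi : Integrable V P := ((c1.const_mul _).add (c2.const_mul _)).add (c3.const_mul _)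
  refine integrable_of_le_mul_add (U' := fun ω => √(Y₁' ω * Y₂' ω))
    (R := fun ω => (1 + ε) * √(R₁ ω * R₂ ω)) (V := V) (hY₁.mul hY₂).sqrt (hY₁'.mul hY₂').sqrt
    ((hR₁.mul hR₂).sqrt.const_mul _) ?_ (fun ω => Real.sqrt_nonneg _) (fun ω => by positivity)
    (fun ω => by positivity) hlaw (hind.comp (measurable_const_mul (1 + ε)) measurable_id)
    (Eventually.of_forall fun ω => ?_) (hri.const_mul _) ?_ hVi
  · fun_prop
  · have k1 := key C₁0 (fun ω => mul_nonneg (R₁0 ω) (Y₁0 ω)) b₁0 hC₁ ω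
    have k2 := key C₂0 (fun ω => mul_nonneg (R₂0 ω) (Y₂0 ω)) b₂0 hC₂ ω
    rw [Real.sqrt_mul (Y₁0' ω)]
    refine (mul_le_mul k1 k2 (Real.sqrt_nonneg _) (by positivity)).trans (le_of_eq ?_)
    rw [hV]
    simp only [Real.sqrt_mul (R₁0 ω), Real.sqrt_mul (R₂0 ω), Real.sqrt_mul (Y₁0 ω)]
    have hsq : √(1 + ε) * √(1 + ε) = 1 + ε := Real.mul_self_sqrt (by linarith)
    linear_combination (√(R₁ ω) * √(Y₁ ω) * √(R₂ ω) * √(Y₂ ω)) * hsq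
  · rw [integral_const_mul, ← hρ, hε]
    nlinarith

/-- The tail of an integrable function is negligible. -/
lemma tendsto_mul_measureReal_ge {U : Ω → ℝ} (hU : Measurable U) (hU0 : ∀ ω, 0 ≤ U ω)
    (hi : Integrable U P) {δ : ℝ} (hδ : 0 < δ) :
    Tendsto (fun t : ℝ => t * P.real {ω | δ * t ≤ U ω}) atTop (𝓝 0) := by
  have hm : ∀ t : ℝ, MeasurableSet {ω | δ * t ≤ U ω} := fun t =>
    measurableSet_le measurable_const hU
  -- For t ≥ 0 the integrand is dominated by U/δ, and it vanishes as soon as t > U/δ.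
  have h1 : Tendsto (fun t : ℝ => ∫ ω, {ω | δ * t ≤ U ω}.indicator (fun _ => t) ω ∂P) atTop
      (𝓝 (∫ _, (0 : ℝ) ∂P)) := by
    refine tendsto_integral_filter_of_dominated_convergence (fun ω => δ⁻¹ * U ω)
      (Eventually.of_forall fun t => (measurable_const.indicator (hm t)).aestronglyMeasurable)
      ?_ (hi.const_mul _) (Eventually.of_forall fun ω => ?_)
    · filter_upwards [eventually_ge_atTop 0] with t ht
      refine Eventually.of_forall fun ω => ?_
      by_cases hω : ω ∈ {ω | δ * t ≤ U ω}
      · rw [indicator_of_mem hω, Real.norm_of_nonneg ht, le_inv_mul_iff₀ hδ]; exact hω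
      · rw [indicator_of_notMem hω, norm_zero]
        exact mul_nonneg (inv_nonneg.2 hδ.le) (hU0 ω)
    · refine tendsto_const_nhds.congr' ?_
      filter_upwards [eventually_gt_atTop (U ω / δ)] with t ht
      rw [indicator_of_notMem]
      rw [div_lt_iff₀ hδ] at ht
      show ¬ δ * t ≤ U ω
      linarith
  rw [integral_zero] at h1
  refine h1.congr fun t => ?_
  rw [integral_indicator (hm t), setIntegral_const, smul_eq_mul, mul_comm]

end Independence

/-! ### The full recursion: its blocks and its pairs of coordinates. -/

section Diagonal

variable {Ω : Type*} [MeasurableSpace Ω] {P : Measure Ω} [IsProbabilityMeasure P]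

theorem IsBlockSRE.exists_isTailMeasure {ι : Type*} [Fintype ι] {α : ι → ℝ}
    {X A B : Ω → ι → ℝ} {R : Ω → ℝ} (h : IsBlockSRE P α X A B R) :
    ∃ C₀ Λ, IsTailMeasure P α X C₀ Λ := by
  obtain ⟨C, hC0, hC⟩ := h.exists_tail_bound
  have hb : IsTailBounded P α X C := ⟨h.pos, h.measX, hC0, hC⟩
  obtain ⟨Λ, hreg, hΛ⟩ := hb.exists_measure fun f L r K hL hf => by
    obtain ⟨D, hD⟩ := hf.exists_bound h.pos
    obtain ⟨l, hl⟩ := h.exists_tendsto_scaled hL hD hf.pos (fun x hx => (hf.supp x hx).1)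
      fun x hx => (hf.supp x hx).2
    refine ⟨l, (hl.comp Real.tendsto_log_atTop).congr' ?_⟩
    filter_upwards [eventually_gt_atTop 0] with t ht
    exact (tmean_eq_scaled ht).symm
  exact ⟨C, Λ, hb, hreg, hΛ⟩

/-- A stochastic recursion `X = A X + B` in law, with a diagonal `A`. -/
structure IsDiagonalSRE {d : ℕ} (P : Measure Ω) (α : Fin d → ℝ) (X A B : Ω → Fin d → ℝ) :
    Prop where
  pos : ∀ i, 0 < α i
  measX : Measurable X
  measA : Measurable A
  measB : Measurable B
  law : P.map X = P.map fun ω => (fun i => A ω i * X ω i) + B ω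
  indep : IndepFun A X P
  nonarith : ∀ j, ¬ IsArithmetic ((ProbabilityTheory.cond P {ω | A ω j ≠ 0}).map
    fun ω => Real.log |A ω j|)
  integrable : ∀ j, Integrable (fun ω => |A ω j| ^ α j) P
  mean : ∀ j, ∫ ω, |A ω j| ^ α j ∂P = 1
  integrable_log : ∀ j, Integrable (fun ω => |A ω j| ^ α j * Real.posLog |A ω j|) P
  moment : ∀ j, ∃ σ : ℝ, 0 < σ ∧ Integrable (fun ω => |B ω j| ^ (α j + σ)) P

namespace IsDiagonalSRE

variable {d : ℕ} {α : Fin d → ℝ} {X A B : Ω → Fin d → ℝ}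

lemma measurable_coord (h : IsDiagonalSRE P α X A B) (j : Fin d) :
    Measurable fun ω => |A ω j| ^ α j :=
  ((measurable_pi_apply j).comp h.measA).abs.pow_const _

/-- Where A_j ≠ 0 the logarithm is α_j log |A_j|, so a lattice of step b corresponds to one of step
b/α_j. -/
lemma not_arithmetic (h : IsDiagonalSRE P α X A B) (j : Fin d) :
    ¬ ∃ b : ℝ, 0 < b ∧ ∀ᵐ ω ∂P, 0 < |A ω j| ^ α j →
      Real.log (|A ω j| ^ α j) ∈ AddSubgroup.zmultiples b := by
  rintro ⟨b, hb, hae⟩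
  have hAj : Measurable fun ω => A ω j := (measurable_pi_apply j).comp h.measA
  have hα := h.pos j
  refine h.nonarith j ⟨b / α j, div_pos hb hα, ?_⟩
  have hcount : MeasurableSet {x : ℝ | x ∈ AddSubgroup.zmultiples (b / α j)} :=
    (countable_range fun k : ℤ => k • (b / α j)).measurableSet
  have hlog : Measurable fun ω => Real.log |A ω j| := Real.measurable_log.comp hAj.abs
  rw [ae_map_iff hlog.aemeasurable hcount]
  have hne : MeasurableSet {ω | A ω j ≠ 0} := hAj (measurableSet_singleton 0).compl
  filter_upwards [(cond_absolutelyContinuous (s := {ω | A ω j ≠ 0})).ae_le hae,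
    ae_cond_mem hne] with ω h1 h2
  have hpos : 0 < |A ω j| := abs_pos.2 h2
  obtain ⟨k, hk⟩ := AddSubgroup.mem_zmultiples_iff.1 (h1 (Real.rpow_pos_of_pos hpos _))
  rw [Real.log_rpow hpos] at hk
  refine AddSubgroup.mem_zmultiples_iff.2 ⟨k, ?_⟩
  rw [zsmul_eq_mul] at hk ⊢
  field_simp
  linarith

/-- Only the positive part of the logarithm needs a hypothesis: |r log r| is at most 1 for 0 ≤ r ≤
1. -/
lemma integrable_mul_log (h : IsDiagonalSRE P α X A B) (j : Fin d) :
    Integrable (fun ω => |A ω j| ^ α j * Real.log (|A ω j| ^ α j)) P := by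
  have hα := h.pos j
  refine ((integrable_const (1 : ℝ)).add ((h.integrable_log j).const_mul (α j))).mono'
    ((h.measurable_coord j).mul (Real.measurable_log.comp
      (h.measurable_coord j))).aestronglyMeasurable (Eventually.of_forall fun ω => ?_)
  set R := |A ω j| ^ α j with hR
  have hR0 : 0 ≤ R := Real.rpow_nonneg (abs_nonneg _) _
  have hp : 0 ≤ α j * (R * Real.posLog |A ω j|) :=
    mul_nonneg hα.le (mul_nonneg hR0 Real.posLog_nonneg)
  simp only [Pi.add_apply, Real.norm_eq_abs]
  rcases hR0.eq_or_lt with h0 | h0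
  · rw [← h0, zero_mul, abs_zero]; linarith
  have hA : 0 < |A ω j| := by
    by_contra hn
    have : |A ω j| = 0 := le_antisymm (not_lt.1 hn) (abs_nonneg _)
    rw [hR, this, Real.zero_rpow hα.ne'] at h0
    exact lt_irrefl _ h0
  rcases le_or_gt R 1 with h1 | h1
  · have := Real.abs_log_mul_self_lt R h0 h1
    rw [mul_comm] at this
    linarith
  · have hlog : 0 ≤ Real.log R := Real.log_nonneg h1.le
    have e : Real.log R = α j * Real.log |A ω j| := Real.log_rpow hA _
    have hle : Real.log |A ω j| ≤ Real.posLog |A ω j| := le_max_right _ _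
    rw [abs_of_nonneg (mul_nonneg hR0 hlog), e]
    have := mul_le_mul_of_nonneg_left hle (mul_nonneg hα.le hR0)
    nlinarith

/-- A single σ below all ratios τ_i/α_i ensures α_i(1 + σ) ≤ α_i + τ_i for every coordinate. -/
lemma exists_moment (h : IsDiagonalSRE P α X A B) {ι : Type*} [Fintype ι] (e : ι → Fin d) :
    ∃ σ : ℝ, 0 < σ ∧
      Integrable (fun ω => anorm (fun i => α (e i)) (fun i => B ω (e i)) ^ (1 + σ)) P := by
  choose τ hτ hτi using h.moment
  have hα : ∀ i, 0 < α (e i) := fun i => h.pos _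
  have hq0 : ∀ i, 0 < τ (e i) / α (e i) := fun i => div_pos (hτ _) (hα i)
  have hS : 0 ≤ ∑ i, (τ (e i) / α (e i))⁻¹ :=
    Finset.sum_nonneg fun i _ => (inv_pos.2 (hq0 i)).le
  set σ := (1 + ∑ i, (τ (e i) / α (e i))⁻¹)⁻¹ with hσ
  have hσ0 : 0 < σ := by positivity
  have hσle : ∀ i, σ ≤ τ (e i) / α (e i) := by
    intro i
    rw [hσ]
    refine inv_le_of_inv_le₀ (hq0 i) ?_
    have := Finset.single_le_sum (f := fun i => (τ (e i) / α (e i))⁻¹)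
      (fun i _ => (inv_pos.2 (hq0 i)).le) (Finset.mem_univ i)
    linarith
  have hBe : Measurable fun ω => (fun i => B ω (e i)) :=
    measurable_pi_iff.2 fun i => (measurable_pi_apply _).comp h.measB
  refine ⟨σ, hσ0, ?_⟩
  have hsum : Integrable (fun ω => ∑ i, (1 + |B ω (e i)| ^ (α (e i) + τ (e i)))) P :=
    integrable_finsetSum _ fun i _ => (integrable_const (1 : ℝ)).add (hτi (e i))
  refine hsum.mono' (((measurable_anorm hα).comp hBe).pow_const _).aestronglyMeasurable
    (Eventually.of_forall fun ω => ?_)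
  have hterm : ∀ i, 0 ≤ 1 + |B ω (e i)| ^ (α (e i) + τ (e i)) := fun i => by positivity
  rw [Real.norm_of_nonneg (Real.rpow_nonneg (anorm_nonneg _ _) _)]
  rcases isEmpty_or_nonempty ι with hι | hι
  · rw [anorm, Real.iSup_of_isEmpty, Real.zero_rpow (by linarith)]
    exact Finset.sum_nonneg fun i _ => hterm i
  obtain ⟨i, hi⟩ := exists_anorm_eq (fun i => α (e i)) (fun i => B ω (e i))
  rw [hi]
  refine le_trans ?_ (Finset.single_le_sum (f := fun i => 1 + |B ω (e i)| ^ (α (e i) + τ (e i)))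
    (fun i _ => hterm i) (Finset.mem_univ i))
  rw [← Real.rpow_mul (abs_nonneg _)]
  rcases le_or_gt |B ω (e i)| 1 with h1 | h1
  · have : |B ω (e i)| ^ (α (e i) * (1 + σ)) ≤ 1 :=
      Real.rpow_le_one (abs_nonneg _) h1 (mul_nonneg (hα i).le (by linarith))
    have h2 : 0 ≤ |B ω (e i)| ^ (α (e i) + τ (e i)) := by positivity
    linarith
  · have : |B ω (e i)| ^ (α (e i) * (1 + σ)) ≤ |B ω (e i)| ^ (α (e i) + τ (e i)) := by
      refine Real.rpow_le_rpow_of_exponent_le h1.le ?_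
      have := hσle i
      rw [le_div_iff₀ (hα i)] at this
      linarith
    linarith

/-- Coordinates with a common multiplier form a block. -/
theorem isBlockSRE (h : IsDiagonalSRE P α X A B) {ι : Type*} [Fintype ι] (e : ι → Fin d)
    (j : Fin d) (he : ∀ i, ∀ᵐ ω ∂P, |A ω (e i)| ^ α (e i) = |A ω j| ^ α j) :
    IsBlockSRE P (fun i => α (e i)) (fun ω i => X ω (e i)) (fun ω i => A ω (e i))
      (fun ω i => B ω (e i)) (fun ω => |A ω j| ^ α j) := by
  have hre : Measurable fun (x : Fin d → ℝ) (i : ι) => x (e i) :=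
    measurable_pi_iff.2 fun i => measurable_pi_apply _
  have hAXB : Measurable fun ω => (fun i => A ω i * X ω i) + B ω :=
    measurable_pi_iff.2 fun i => (((measurable_pi_apply i).comp h.measA).mul
      ((measurable_pi_apply i).comp h.measX)).add ((measurable_pi_apply i).comp h.measB)
  exact
    { pos := fun i => h.pos _
      measX := hre.comp h.measX
      measA := hre.comp h.measA
      measB := hre.comp h.measB
      measR := h.measurable_coord j
      law := by
        have e1 := Measure.map_map (μ := P) hre h.measX
        have e2 := Measure.map_map (μ := P) hre hAXB
        rw [h.law, e2] at e1
        exact e1.symm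
      indep := h.indep.comp hre hre
      indepR := h.indep.comp (φ := fun a : Fin d → ℝ => |a j| ^ α j)
        (Measurable.pow_const (measurable_pi_apply j).abs _) hre
      nonneg := fun ω => Real.rpow_nonneg (abs_nonneg _) _
      eqR := ae_all_iff.2 he
      integrable := h.integrable j
      mean := h.mean j
      integrable_log := h.integrable_mul_log j
      nonarith := h.not_arithmetic j
      moment := h.exists_moment e }

/-- Coordinates with different multipliers are not large simultaneously. -/
theorem tendsto_joint_tail (h : IsDiagonalSRE P α X A B) {i j : Fin d}
    (hij : ¬ ∀ᵐ ω ∂P, |A ω i| ^ α i = |A ω j| ^ α j) {δ : ℝ} (hδ : 0 < δ) :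
    Tendsto (fun t : ℝ => t * P.real {ω | δ * t ≤ |X ω i| ^ α i ∧ δ * t ≤ |X ω j| ^ α j})
      atTop (𝓝 0) := by
  -- Any coordinate is a block by itself, so the moment bounds for blocks apply to it.
  have single : ∀ k : Fin d, IsBlockSRE P (fun _ : Unit => α k) (fun ω _ => X ω k)
      (fun ω _ => A ω k) (fun ω _ => B ω k) (fun ω => |A ω k| ^ α k) := fun k =>
    h.isBlockSRE (fun _ => k) k fun _ => Eventually.of_forall fun _ => rfl
  have hun : ∀ (a y : ℝ), anorm (fun _ : Unit => a) (fun _ => y) = |y| ^ a := fun a y => by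
    simp [anorm]
  have mc : ∀ {Z : Ω → Fin d → ℝ}, Measurable Z → ∀ k, Measurable fun ω => |Z ω k| ^ α k :=
    fun hZ k => ((measurable_pi_apply k).comp hZ).abs.pow_const _
  have hAXB : Measurable fun ω => (fun i => A ω i * X ω i) + B ω :=
    measurable_pi_iff.2 fun i => (((measurable_pi_apply i).comp h.measA).mul
      ((measurable_pi_apply i).comp h.measX)).add ((measurable_pi_apply i).comp h.measB)
  have n0 : ∀ (y : ℝ) k, 0 ≤ |y| ^ α k := fun y k => Real.rpow_nonneg (abs_nonneg _) _
  have hg : Measurable fun x : Fin d → ℝ => √(|x i| ^ α i * |x j| ^ α j) :=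
    (((measurable_pi_apply i).abs.pow_const _).mul
      ((measurable_pi_apply j).abs.pow_const _)).sqrt
  have hle : ∀ k, ∀ ε : ℝ, 0 < ε → ∃ C, 0 ≤ C ∧ ∀ ω, |A ω k * X ω k + B ω k| ^ α k
      ≤ (1 + ε) * (|A ω k| ^ α k * |X ω k| ^ α k) + C * |B ω k| ^ α k := by
    intro k ε hε
    obtain ⟨C, hC0, hC⟩ := exists_abs_add_rpow_le (h.pos k).le hε
    refine ⟨C, hC0, fun ω => ?_⟩
    have := hC (A ω k * X ω k) (B ω k)
    rwa [abs_mul, Real.mul_rpow (abs_nonneg _) (abs_nonneg _)] at this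
  have hmom : ∀ k, ∃ σ : ℝ, 0 < σ ∧ Integrable (fun ω => (|B ω k| ^ α k) ^ (1 + σ)) P := by
    intro k
    obtain ⟨σ, hσ, hi⟩ := (single k).moment
    simp only [hun] at hi
    exact ⟨σ, hσ, hi⟩
  have hw : ∀ k, ∀ β : ℝ, 0 < β → β < 1 →
      Integrable (fun ω => (|A ω k| ^ α k * |X ω k| ^ α k) ^ β) P := by
    intro k β h1 h2
    have := (single k).integrable_mul_rpow h1 h2
    simpa only [hun] using this
  have hsqrt : Integrable (fun ω => √(|X ω i| ^ α i * |X ω j| ^ α j)) P := by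
    refine integrable_sqrt_mul (Y₁' := fun ω => |A ω i * X ω i + B ω i| ^ α i)
      (Y₂' := fun ω => |A ω j * X ω j + B ω j| ^ α j) (b₁ := fun ω => |B ω i| ^ α i)
      (b₂ := fun ω => |B ω j| ^ α j)
      (mc h.measX i) (mc h.measX j) (mc hAXB i) (mc hAXB j) (mc h.measA i) (mc h.measA j)
      (mc h.measB i) (mc h.measB j) (fun _ => n0 _ _) (fun _ => n0 _ _) (fun _ => n0 _ _)
      (fun _ => n0 _ _) (fun _ => n0 _ _) (fun _ => n0 _ _) (fun _ => n0 _ _) ?_ ?_ (hle i) (hle j)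
      (h.integrable i) (h.integrable j) (h.mean i) (h.mean j) hij (hmom i) (hmom j) (hw i) (hw j) ?_
    · have e1 := Measure.map_map (μ := P) hg h.measX
      have e2 := Measure.map_map (μ := P) hg hAXB
      rw [h.law, e2] at e1
      exact e1.symm
    · exact h.indep.comp hg hg
    · intro β h1 h2
      have := (single j).integrable_anormB_rpow h1.le h2.le
      simpa only [hun] using this
  -- When both coordinates exceed the level δt, so does their integrable geometric mean.
  refine squeeze_zero' ?_ ?_ (tendsto_mul_measureReal_ge ((mc h.measX i).mul (mc h.measX j)).sqrt
    (fun ω => Real.sqrt_nonneg _) hsqrt hδ)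
  · filter_upwards [eventually_ge_atTop 0] with t ht
    exact mul_nonneg ht measureReal_nonneg
  · filter_upwards [eventually_ge_atTop 0] with t ht
    refine mul_le_mul_of_nonneg_left (measureReal_mono fun ω hω => ?_) ht
    have hω : δ * t ≤ |X ω i| ^ α i ∧ δ * t ≤ |X ω j| ^ α j := hω
    refine Real.le_sqrt_of_sq_le ?_
    rw [sq]
    exact mul_le_mul hω.1 hω.2 (by positivity) (n0 _ _)

end IsDiagonalSRE

end Diagonal

/-! ### The blocks inside ℝ^d and the measures they carry. -/

section Blocks

variable {d : ℕ} {s : Setoid (Fin d)} {α : Fin d → ℝ}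

/-- The inclusion of the block `l` into `ℝ^d`. -/
def embed (s : Setoid (Fin d)) (l : Blocks s) (x : Coord s l → ℝ) : Fin d → ℝ :=
  assemble s (Function.update 0 l x)

lemma embed_of_eq {l : Blocks s} (x : Coord s l → ℝ) {i : Fin d} (h : Blocks.of s i = l) :
    embed s l x i = x ⟨i, h⟩ := by
  subst h
  simp [embed, assemble]

lemma embed_of_ne {l : Blocks s} (x : Coord s l → ℝ) {i : Fin d} (h : Blocks.of s i ≠ l) :
    embed s l x i = 0 := by
  simp [embed, assemble, Function.update_of_ne h]

lemma measurable_assemble : Measurable (assemble s) :=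
  measurable_pi_iff.2 fun i => (measurable_pi_apply _).comp (measurable_pi_apply (Blocks.of s i))

lemma continuous_embed (l : Blocks s) : Continuous (embed s l) := by
  refine continuous_pi fun i => ?_
  by_cases h : Blocks.of s i = l
  · simp only [embed_of_eq _ h]; exact continuous_apply _
  · simp only [embed_of_ne _ h]; exact continuous_const

lemma continuous_part (l : Blocks s) : Continuous (part s l) :=
  continuous_pi fun _ => continuous_apply _

lemma part_embed (l : Blocks s) (x : Coord s l → ℝ) : part s l (embed s l x) = x := by
  ext i
  exact embed_of_eq x i.2

lemma embed_dil (l : Blocks s) (t : ℝ) (x : Coord s l → ℝ) :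
    embed s l (dil (part s l α) t x) = dil α t (embed s l x) := by
  ext i
  by_cases h : Blocks.of s i = l
  · simp only [dil, embed_of_eq _ h]; rfl
  · simp only [dil, embed_of_ne _ h, mul_zero]

lemma embed_ne_zero {l : Blocks s} {x : Coord s l → ℝ} (hx : x ≠ 0) : embed s l x ≠ 0 := by
  intro h
  refine hx ?_
  rw [← part_embed l x, h]
  rfl

lemma anorm_part_le (l : Blocks s) (x : Fin d → ℝ) :
    anorm (part s l α) (part s l x) ≤ anorm α x :=
  (anorm_le_iff _ (anorm_nonneg _ _)).2 fun i => le_anorm α x i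

lemma anorm_embed (hα : ∀ i, 0 < α i) (l : Blocks s) (x : Coord s l → ℝ) :
    anorm α (embed s l x) = anorm (part s l α) x := by
  refine le_antisymm ((anorm_le_iff _ (anorm_nonneg _ _)).2 fun i => ?_) ?_
  · by_cases h : Blocks.of s i = l
    · rw [embed_of_eq x h]
      exact le_anorm (part s l α) x ⟨i, h⟩
    · rw [embed_of_ne x h, abs_zero, Real.zero_rpow (hα i).ne']
      exact anorm_nonneg _ _
  · have := anorm_part_le (α := α) l (embed s l x)
    rwa [part_embed] at this

lemma exists_le_anorm_part {r : ℝ} (hr : 0 < r) {x : Fin d → ℝ} (hx : r ≤ anorm α x) :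
    ∃ l : Blocks s, r ≤ anorm (part s l α) (part s l x) := by
  obtain ⟨i, hi⟩ := (le_anorm_iff x hr).1 hx
  exact ⟨Blocks.of s i, hi.trans (le_anorm (part s (Blocks.of s i) α) (part s _ x) ⟨i, rfl⟩)⟩

lemma part_pos (hα : ∀ i, 0 < α i) (l : Blocks s) : ∀ i, 0 < part s l α i := fun i => hα i

lemma IsTestFun.slice (hα : ∀ i, 0 < α i) {f : (Fin d → ℝ) → ℝ} (hf : IsTestFun α f)
    (l : Blocks s) : IsTestFun (part s l α) (slice s l f) := by
  obtain ⟨C, hC⟩ := hf.bounded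
  obtain ⟨r, hr, hs⟩ := hf.exists_supp
  refine isTestFun_of_supp (part_pos hα l) (hf.continuous.comp (continuous_embed l))
    (fun x => hC _) hr fun x hx => ?_
  rw [← anorm_embed hα]
  exact hs _ hx

/-- The inclusion of a punctured block. -/
def puncturedEmbed (s : Setoid (Fin d)) (l : Blocks s) (x : Punctured (Coord s l)) :
    Punctured (Fin d) := ⟨embed s l x.1, embed_ne_zero x.2⟩

lemma continuous_puncturedEmbed (l : Blocks s) : Continuous (puncturedEmbed s l) :=
  ((continuous_embed l).comp continuous_subtype_val).subtype_mk _

/-- The inclusion of the unit sphere of a block. -/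
def sphereEmbed (hα : ∀ i, 0 < α i) (l : Blocks s) (w : asphere (part s l α)) : asphere α :=
  ⟨embed s l w.1, (anorm_embed hα l w.1).trans w.2⟩

lemma continuous_sphereEmbed (hα : ∀ i, 0 < α i) (l : Blocks s) :
    Continuous (sphereEmbed hα l) :=
  ((continuous_embed l).comp continuous_subtype_val).subtype_mk _

lemma direction_puncturedEmbed (hα : ∀ i, 0 < α i) (l : Blocks s) (x : Punctured (Coord s l)) :
    direction hα (puncturedEmbed s l x) = sphereEmbed hα l (direction (part_pos hα l) x) := by
  refine Subtype.ext ?_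
  show dil α (anorm α (embed s l x.1))⁻¹ (embed s l x.1) = embed s l _
  rw [anorm_embed hα, ← embed_dil]
  rfl

/-- The sum of measures carried by the blocks. -/
def blockSum (s : Setoid (Fin d)) (Λb : (l : Blocks s) → Measure (Punctured (Coord s l))) :
    Measure (Punctured (Fin d)) := ∑ l, (Λb l).map (puncturedEmbed s l)

lemma blockSum_apply (Λb : (l : Blocks s) → Measure (Punctured (Coord s l)))
    {E : Set (Punctured (Fin d))} (hE : MeasurableSet E) :
    blockSum s Λb E = ∑ l, Λb l (puncturedEmbed s l ⁻¹' E) := by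
  rw [blockSum, Measure.finsetSum_apply]
  exact Finset.sum_congr rfl fun l _ =>
    Measure.map_apply (continuous_puncturedEmbed l).measurable hE

/-- The inclusion of a block preserves the gauge and commutes with taking directions. -/
lemma angular_blockSum (hα : ∀ i, 0 < α i)
    (Λb : (l : Blocks s) → Measure (Punctured (Coord s l))) :
    angular hα (blockSum s Λb)
      = ∑ l, (angular (part_pos hα l) (Λb l)).map (sphereEmbed hα l) := by
  ext U hU
  have hE : MeasurableSet {x : Punctured (Fin d) | 1 < anorm α x.1 ∧ direction hα x ∈ U} :=
    (measurableSet_lt_anorm hα 1).inter ((continuous_direction hα).measurable hU)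
  rw [angular_apply hα _ hU, blockSum_apply _ hE, Measure.finsetSum_apply]
  refine Finset.sum_congr rfl fun l _ => ?_
  have hm := (continuous_sphereEmbed hα l).measurable
  rw [Measure.map_apply hm hU, angular_apply _ _ (hm hU)]
  congr 1
  ext x
  simp only [mem_preimage, mem_ofPred_eq, ← direction_puncturedEmbed]
  refine and_congr_left fun _ => ?_
  show 1 < anorm α (embed s l x.1) ↔ _
  rw [anorm_embed hα]

lemma integral_blockSum (Λb : (l : Blocks s) → Measure (Punctured (Coord s l)))
    {f : (Fin d → ℝ) → ℝ} (hf : Continuous f)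
    (hi : ∀ l, Integrable (fun x : Punctured (Coord s l) => slice s l f x.1) (Λb l)) :
    ∫ x, f x.1 ∂(blockSum s Λb) = ∑ l, ∫ x, slice s l f x.1 ∂(Λb l) := by
  have hm : ∀ l, AEStronglyMeasurable (fun x : Punctured (Fin d) => f x.1)
      ((Λb l).map (puncturedEmbed s l)) := fun l =>
    (hf.comp continuous_subtype_val).aestronglyMeasurable
  rw [blockSum, integral_finsetSum_measure fun l _ => (integrable_map_measure (hm l)
    (continuous_puncturedEmbed l).aemeasurable).2 (hi l)]
  exact Finset.sum_congr rfl fun l _ =>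
    integral_map (continuous_puncturedEmbed l).aemeasurable (hm l)

/-- Finite mass away from the origin is local finiteness on the punctured space, which implies
regularity because that space is metric and σ-compact. -/
lemma regular_blockSum (hα : ∀ i, 0 < α i) (Λb : (l : Blocks s) → Measure (Punctured (Coord s l)))
    (hfin : ∀ l, ∀ u : ℝ, 0 < u → Λb l {x | u ≤ anorm (part s l α) x.1} < ∞) :
    (blockSum s Λb).Regular := by
  have hN : Continuous fun x : Punctured (Fin d) => anorm α x.1 :=
    (continuous_anorm hα).comp continuous_subtype_val
  haveI : IsLocallyFiniteMeasure (blockSum s Λb) := by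
    refine ⟨fun x => ?_⟩
    have hx : 0 < anorm α x.1 := (anorm_pos_iff hα).2 x.2
    refine ⟨{y | anorm α x.1 / 2 ≤ anorm α y.1}, ?_, ?_⟩
    · filter_upwards [hN.continuousAt.eventually_const_lt (half_lt_self hx)] with y hy using hy.le
    · rw [blockSum_apply _ (IsTailMeasure.measurableSet_le_anorm hα _)]
      refine ENNReal.sum_lt_top.2 fun l _ => ?_
      refine lt_of_eq_of_lt ?_ (hfin l _ (half_pos hx))
      congr 1
      ext y
      show _ ≤ anorm α (embed s l y.1) ↔ _
      rw [anorm_embed hα]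
      rfl
  exact Measure.Regular.of_sigmaCompactSpace_of_isLocallyFiniteMeasure _

/-- On a box every factor other than the one of index l is 0 or 1, according to whether the
corresponding side contains the origin. -/
lemma pi_update_dirac (l : Blocks s) (μ : Measure (Coord s l → ℝ)) [IsFiniteMeasure μ] :
    Measure.pi (Function.update (fun k : Blocks s => Measure.dirac (0 : Coord s k → ℝ)) l μ)
      = μ.map (Function.update (0 : (k : Blocks s) → Coord s k → ℝ) l) := by
  haveI : ∀ k, SigmaFinite
      (Function.update (fun k : Blocks s => Measure.dirac (0 : Coord s k → ℝ)) l μ k) := by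
    intro k
    by_cases h : k = l
    · subst h; rw [Function.update_self]; infer_instance
    · rw [Function.update_of_ne h]; infer_instance
  refine Measure.pi_eq fun S hS => ?_
  rw [Measure.map_apply (measurable_update 0) (MeasurableSet.univ_pi hS),
    Fintype.prod_eq_mul_prod_compl l, Function.update_self]
  have hrest : ∏ k ∈ ({l} : Finset (Blocks s))ᶜ,
      (Function.update (fun k : Blocks s => Measure.dirac (0 : Coord s k → ℝ)) l μ k) (S k)
      = ∏ k ∈ ({l} : Finset (Blocks s))ᶜ, (S k).indicator 1 (0 : Coord s k → ℝ) := by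
    refine Finset.prod_congr rfl fun k hk => ?_
    have hkl : k ≠ l := by simpa using hk
    rw [Function.update_of_ne hkl, Measure.dirac_apply' _ (hS k)]
  rw [hrest]
  by_cases hall : ∀ k, k ≠ l → (0 : Coord s k → ℝ) ∈ S k
  · rw [Finset.prod_eq_one fun k hk => indicator_of_mem (hall k (by simpa using hk)) _, mul_one]
    congr 1
    ext x
    simp only [mem_preimage, mem_univ_pi]
    constructor
    · intro h; simpa using h l
    · intro h k
      by_cases hk : k = l
      · subst hk; simpa using h
      · rw [Function.update_of_ne hk]; exact hall k hk
  · push Not at hall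
    obtain ⟨k, hk, hkS⟩ := hall
    rw [Finset.prod_eq_zero (i := k) (by simpa using hk) (indicator_of_notMem hkS _), mul_zero]
    convert measure_empty (μ := μ)
    refine eq_empty_of_forall_notMem fun x hx => hkS ?_
    have := hx k (mem_univ k)
    rwa [Function.update_of_ne hk] at this

/-- The measure carried by the sphere of a block, as a measure on `ℝ^d`. -/
lemma placed_eq_map (hα : ∀ i, 0 < α i) (l : Blocks s) (μ : Measure (asphere (part s l α)))
    [IsFiniteMeasure μ] : placed s α l μ = (μ.map (sphereEmbed hα l)).map Subtype.val := by
  have hu : Measurable (Function.update (0 : (k : Blocks s) → Coord s k → ℝ) l) :=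
    measurable_update 0
  rw [placed, pi_update_dirac, Measure.map_map measurable_assemble hu,
    Measure.map_map (measurable_assemble.comp hu) measurable_subtype_coe,
    Measure.map_map measurable_subtype_coe (continuous_sphereEmbed hα l).measurable]
  rfl

lemma angular_blockSum_real_univ (hα : ∀ i, 0 < α i)
    (Λb : (l : Blocks s) → Measure (Punctured (Coord s l)))
    [∀ l, IsFiniteMeasure (angular (part_pos hα l) (Λb l))] :
    (angular hα (blockSum s Λb)).real univ
      = ∑ l, (angular (part_pos hα l) (Λb l)).real univ := by
  rw [angular_blockSum, measureReal_def, Measure.finsetSum_apply, ENNReal.toReal_sum]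
  · refine Finset.sum_congr rfl fun l _ => ?_
    rw [Measure.map_apply (continuous_sphereEmbed hα l).measurable MeasurableSet.univ,
      preimage_univ]
    rfl
  · intro l _
    rw [Measure.map_apply (continuous_sphereEmbed hα l).measurable MeasurableSet.univ,
      preimage_univ]
    exact measure_ne_top _ _

lemma map_val_angular_blockSum (hα : ∀ i, 0 < α i)
    (Λb : (l : Blocks s) → Measure (Punctured (Coord s l)))
    (hfin : ∀ l, IsFiniteMeasure (angular (part_pos hα l) (Λb l))) :
    (angular hα (blockSum s Λb)).map Subtype.val
      = ∑ l, placed s α l (angular (part_pos hα l) (Λb l)) := by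
  ext E hE
  rw [angular_blockSum, Measure.map_apply measurable_subtype_coe hE, Measure.finsetSum_apply,
    Measure.finsetSum_apply]
  refine Finset.sum_congr rfl fun l _ => ?_
  rw [placed_eq_map hα, Measure.map_apply measurable_subtype_coe hE]

end Blocks

/-! ### Gluing the blocks. -/

section Global

variable {Ω : Type*} [MeasurableSpace Ω] {P : Measure Ω} [IsProbabilityMeasure P]
  {d : ℕ} {s : Setoid (Fin d)} {α : Fin d → ℝ} {X : Ω → Fin d → ℝ}

/-- Transfers uniform continuity from the norm to the gauge; the witness lies below every δ^{α_i}.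
-/
lemma exists_norm_lt_of_anorm_lt {ι : Type*} [Fintype ι] {α : ι → ℝ} (hα : ∀ i, 0 < α i) {δ : ℝ}
    (hδ : 0 < δ) : ∃ ε : ℝ, 0 < ε ∧ ∀ x : ι → ℝ, anorm α x < ε → ‖x‖ < δ := by
  have hS : 0 ≤ ∑ i, (δ ^ α i)⁻¹ := Finset.sum_nonneg fun i _ => by positivity
  refine ⟨(1 + ∑ i, (δ ^ α i)⁻¹)⁻¹, by positivity, fun x hx => ?_⟩
  rw [pi_norm_lt_iff hδ]
  intro i
  have h1 : (1 + ∑ i, (δ ^ α i)⁻¹)⁻¹ ≤ δ ^ α i := by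
    refine inv_le_of_inv_le₀ (by positivity) ?_
    have := Finset.single_le_sum (f := fun i => (δ ^ α i)⁻¹)
      (fun i _ => by positivity) (Finset.mem_univ i)
    linarith
  have h2 : |x i| ^ α i < δ ^ α i := ((le_anorm α x i).trans_lt hx).trans_le h1
  exact (Real.rpow_lt_rpow_iff (abs_nonneg _) hδ.le (hα i)).1 h2

/-- The vectors with two large coordinates. -/
def jointTail (α : Fin d → ℝ) (ε : ℝ) (q : Fin d × Fin d) : Set (Fin d → ℝ) :=
  {x | ε ≤ |x q.1| ^ α q.1 ∧ ε ≤ |x q.2| ^ α q.2}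

lemma measurableSet_jointTail (α : Fin d → ℝ) (ε : ℝ) (q : Fin d × Fin d) :
    MeasurableSet (jointTail α ε q) :=
  (measurableSet_le measurable_const ((measurable_pi_apply q.1).abs.pow_const _)).inter
    (measurableSet_le measurable_const ((measurable_pi_apply q.2).abs.pow_const _))

/-- The pairs of coordinates in different blocks. -/
def crossPairs (s : Setoid (Fin d)) : Finset (Fin d × Fin d) :=
  Finset.univ.filter fun q => Blocks.of s q.1 ≠ Blocks.of s q.2

/-- A function supported away from the origin is close to the sum of its slices, except where two
blocks are large. -/
lemma abs_sub_sum_slice_le (hα : ∀ i, 0 < α i) {f : (Fin d → ℝ) → ℝ} {C r ε κ : ℝ}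
    (hC : ∀ x, |f x| ≤ C) (hs : ∀ x, f x ≠ 0 → r ≤ anorm α x) (hε : 0 < ε) (hεr : ε ≤ r)
    (hκ : 0 ≤ κ) (hf : ∀ x y, anorm α (x - y) < ε → |f x - f y| ≤ κ) (x : Fin d → ℝ) :
    |f x - ∑ l, slice s l f (part s l x)| ≤ {y | r ≤ anorm α y}.indicator (fun _ => κ) x
      + ∑ q ∈ crossPairs s,
        (jointTail α ε q).indicator (fun _ => C * (1 + Fintype.card (Blocks s))) x := by
  have hC0 : 0 ≤ C := (abs_nonneg _).trans (hC 0)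
  set D := C * (1 + (Fintype.card (Blocks s) : ℝ)) with hD
  have hD0 : 0 ≤ D := by positivity
  have hjn : ∀ q ∈ crossPairs s, 0 ≤ (jointTail α ε q).indicator (fun _ => D) x := fun q _ =>
    indicator_nonneg (fun _ _ => hD0) x
  have hin : 0 ≤ {y | r ≤ anorm α y}.indicator (fun _ => κ) x :=
    indicator_nonneg (fun _ _ => hκ) x
  have hzero : ∀ l : Blocks s, anorm (part s l α) (part s l x) < r →
      slice s l f (part s l x) = 0 := by
    intro l hl
    by_contra hne
    have := hs _ hne
    rw [← embed, anorm_embed hα] at this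
    linarith
  -- With large coordinates in two blocks only the crude bound C(1 + p) is available. Otherwise all
  -- large coordinates lie in one block, setting the others to zero moves x by less than ε in the
  -- gauge, and the other slices vanish.
  by_cases hq : ∃ q ∈ crossPairs s, x ∈ jointTail α ε q
  · obtain ⟨q, hq, hxq⟩ := hq
    have h1 := Finset.single_le_sum hjn hq
    rw [indicator_of_mem hxq] at h1
    have h2 : |∑ l, slice s l f (part s l x)| ≤ Fintype.card (Blocks s) * C := by
      refine (Finset.abs_sum_le_sum_abs _ _).trans ?_
      refine (Finset.sum_le_card_nsmul _ _ C fun l _ => hC _).trans (le_of_eq ?_)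
      rw [nsmul_eq_mul, Finset.card_univ]
    have h3 := abs_sub (f x) (∑ l, slice s l f (part s l x))
    have h4 := hC x
    have h5 : D = C + Fintype.card (Blocks s) * C := by rw [hD]; ring
    linarith
  · push Not at hq
    have hsumn := Finset.sum_nonneg hjn
    by_cases hx : r ≤ anorm α x
    · rw [indicator_of_mem (show x ∈ {y | r ≤ anorm α y} from hx)]
      obtain ⟨i, hi⟩ := (le_anorm_iff x (hε.trans_le hεr)).1 hx
      have hsmall : ∀ j, Blocks.of s j ≠ Blocks.of s i → |x j| ^ α j < ε := by
        intro j hj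
        by_contra hlt
        refine hq (i, j) ?_ ⟨hεr.trans hi, not_lt.1 hlt⟩
        simpa [crossPairs] using hj.symm
      have hother : ∀ l, l ≠ Blocks.of s i → slice s l f (part s l x) = 0 := by
        intro l hl
        refine hzero l (lt_of_lt_of_le ?_ hεr)
        by_contra hlt
        obtain ⟨j, hj⟩ := (le_anorm_iff _ hε).1 (not_lt.1 hlt)
        have := hsmall j.1 (by rw [j.2]; exact hl)
        exact absurd hj (not_le.2 this)
      rw [Finset.sum_eq_single (Blocks.of s i) (fun l _ hl => hother l hl) (by simp)]
      refine le_add_of_le_of_nonneg (hf _ _ ?_) hsumn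
      by_contra hlt
      obtain ⟨j, hj⟩ := (le_anorm_iff _ hε).1 (not_lt.1 hlt)
      rw [← embed, Pi.sub_apply] at hj
      by_cases hji : Blocks.of s j = Blocks.of s i
      · rw [embed_of_eq _ hji, part, sub_self, abs_zero, Real.zero_rpow (hα j).ne'] at hj
        linarith
      · rw [embed_of_ne _ hji, sub_zero] at hj
        linarith [hsmall j hji]
    · have hfx : f x = 0 := by
        by_contra hne; exact hx (hs x hne)
      have hsl : ∀ l, slice s l f (part s l x) = 0 := fun l =>
        hzero l ((anorm_part_le l x).trans_lt (not_le.1 hx))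
      rw [hfx, Finset.sum_eq_zero fun l _ => hsl l, sub_zero, abs_zero]
      linarith

/-- The limit measures of the blocks determine the limit measure of the vector. -/
theorem isTailMeasure_blockSum (hα : ∀ i, 0 < α i) (hX : Measurable X)
    {Cb : Blocks s → ℝ} {Λb : (l : Blocks s) → Measure (Punctured (Coord s l))}
    (hb : ∀ l, IsTailMeasure P (part s l α) (fun ω => part s l (X ω)) (Cb l) (Λb l))
    (hjoint : ∀ i j, Blocks.of s i ≠ Blocks.of s j → ∀ δ : ℝ, 0 < δ →
      Tendsto (fun t : ℝ => t * P.real {ω | δ * t ≤ |X ω i| ^ α i ∧ δ * t ≤ |X ω j| ^ α j})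
        atTop (𝓝 0)) :
    IsTailMeasure P α X (∑ l, Cb l) (blockSum s Λb) := by
  have hbound : IsTailBounded P α X (∑ l, Cb l) := by
    refine ⟨hα, hX, Finset.sum_nonneg fun l _ => (hb l).tailBounded.nonneg, fun t ht => ?_⟩
    have hsub : {ω | t ≤ anorm α (X ω)}
        ⊆ ⋃ l ∈ (Finset.univ : Finset (Blocks s)),
          {ω | t ≤ anorm (part s l α) (part s l (X ω))} := by
      intro ω hω
      obtain ⟨l, hl⟩ := exists_le_anorm_part (s := s) ht hω
      simp only [mem_iUnion]
      exact ⟨l, Finset.mem_univ l, hl⟩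
    calc t * P.real {ω | t ≤ anorm α (X ω)}
        ≤ t * ∑ l, P.real {ω | t ≤ anorm (part s l α) (part s l (X ω))} := by
          gcongr
          exact (measureReal_mono hsub (measure_ne_top _ _)).trans (measureReal_biUnion_finset_le _ _)
      _ = ∑ l, t * P.real {ω | t ≤ anorm (part s l α) (part s l (X ω))} := Finset.mul_sum _ _ _
      _ ≤ ∑ l, Cb l := Finset.sum_le_sum fun l _ => (hb l).tailBounded.tail t ht
  refine ⟨hbound, regular_blockSum hα Λb fun l u hu =>
    ((hb l).measure_tail_le hu).trans_lt ENNReal.ofReal_lt_top, fun f r K hf => ?_⟩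
  obtain ⟨C, hC⟩ := hf.exists_bound hα
  have hC0 : 0 ≤ C := (abs_nonneg _).trans (hC 0)
  have hr := hf.pos
  have hft : IsTestFun α f := isTestFun_of_supp hα hf.continuous hC hr fun x hx => (hf.supp x hx).1
  have hslice : ∀ l, IsTestFun (part s l α) (slice s l f) := fun l => hft.slice hα l
  have hsi : ∀ l, Integrable (fun x : Punctured (Coord s l) => slice s l f x.1) (Λb l) := by
    intro l
    obtain ⟨r', hr', hs'⟩ := (hslice l).exists_supp
    exact ((hb l).integrable_of_supp (hslice l).continuous.measurable (fun x => hC _) hr' hs').1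
  rw [integral_blockSum Λb hf.continuous hsi]
  have hlim : Tendsto (fun t => ∑ l, tmean P (part s l α) (fun ω => part s l (X ω)) (slice s l f) t)
      atTop (𝓝 (∑ l, ∫ x, slice s l f x.1 ∂(Λb l))) :=
    tendsto_finsetSum _ fun l _ => (hb l).tendsto_tmean (hslice l)
  suffices hdiff : Tendsto (fun t => tmean P α X f t
      - ∑ l, tmean P (part s l α) (fun ω => part s l (X ω)) (slice s l f) t) atTop (𝓝 0) by
    simpa using hdiff.add hlim
  set C₀ := ∑ l, Cb l with hC₀
  have hC₀0 : 0 ≤ C₀ := hbound.nonneg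
  rw [Metric.tendsto_nhds]
  intro θ hθ
  set κ := θ / (4 * (C₀ / r + 1)) with hκ
  have hκ0 : 0 < κ := by positivity
  -- Compact support gives uniform continuity, so it helps that limits need to be identified for
  -- shell functions only.
  obtain ⟨δ, hδ, hδf⟩ := Metric.uniformContinuous_iff.1
    ((hf.hasCompactSupport hα).uniformContinuous_of_continuous hf.continuous) κ hκ0
  obtain ⟨ε', hε'0, hε'⟩ := exists_norm_lt_of_anorm_lt hα hδ
  set ε := min ε' r with hε
  have hε0 : 0 < ε := lt_min hε'0 hr
  have hfε : ∀ x y, anorm α (x - y) < ε → |f x - f y| ≤ κ := by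
    intro x y hxy
    have := hδf (a := x) (b := y) (by
      rw [dist_eq_norm]; exact hε' _ (hxy.trans_le (min_le_left _ _)))
    exact this.le
  set D := C * (1 + (Fintype.card (Blocks s) : ℝ)) with hD
  have hD0 : 0 ≤ D := by positivity
  -- The region |x|_α ≥ r contributes κ times the tail bound, at most θ/4 by the choice of κ; the
  -- joint tails tend to zero for fixed ε.
  have hest : ∀ t : ℝ, 0 < t → |tmean P α X f t
      - ∑ l, tmean P (part s l α) (fun ω => part s l (X ω)) (slice s l f) t|
      ≤ κ * (C₀ / r) + D * ∑ q ∈ crossPairs s,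
        t * P.real {ω | ε * t ≤ |X ω q.1| ^ α q.1 ∧ ε * t ≤ |X ω q.2| ^ α q.2} := by
    intro t ht
    have ht' : 0 ≤ t⁻¹ := inv_nonneg.2 ht.le
    have hXt : Measurable fun ω => dil α t⁻¹ (X ω) := (continuous_dil t⁻¹).measurable.comp hX
    have i1 := integrable_comp_dil (P := P) (α := α) hX hf.continuous hC t⁻¹
    have i2 : ∀ l, Integrable
        (fun ω => slice s l f (dil (part s l α) t⁻¹ (part s l (X ω)))) P := fun l =>
      integrable_comp_dil (P := P) ((continuous_part l).measurable.comp hX)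
        (hslice l).continuous (fun x => hC _) t⁻¹
    have e1 : tmean P α X f t
        - ∑ l, tmean P (part s l α) (fun ω => part s l (X ω)) (slice s l f) t
        = t * ∫ ω, (f (dil α t⁻¹ (X ω))
          - ∑ l, slice s l f (part s l (dil α t⁻¹ (X ω)))) ∂P := by
      have e0 := integral_sub i1 (integrable_finsetSum Finset.univ fun l _ => i2 l)
      rw [integral_finsetSum _ fun l _ => i2 l] at e0
      simp only [tmean]
      rw [← Finset.mul_sum, ← mul_sub, ← e0]
      rfl
    have hE : MeasurableSet {ω | r ≤ anorm α (dil α t⁻¹ (X ω))} :=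
      measurableSet_le measurable_const ((measurable_anorm hα).comp hXt)
    have hJ : ∀ q : Fin d × Fin d,
        MeasurableSet ((fun ω => dil α t⁻¹ (X ω)) ⁻¹' jointTail α ε q) := fun q =>
      hXt (measurableSet_jointTail α ε q)
    have j1 : Integrable (fun ω => {y | r ≤ anorm α y}.indicator (fun _ => κ)
        (dil α t⁻¹ (X ω))) P := (integrable_const κ).indicator hE
    have j2 : ∀ q, Integrable (fun ω => (jointTail α ε q).indicator (fun _ => D)
        (dil α t⁻¹ (X ω))) P := fun q => (integrable_const D).indicator (hJ q)
    have v1 : ∫ ω, {y | r ≤ anorm α y}.indicator (fun _ => κ) (dil α t⁻¹ (X ω)) ∂P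
        = P.real {ω | r * t ≤ anorm α (X ω)} * κ := by
      have hset : {ω | r ≤ anorm α (dil α t⁻¹ (X ω))} = {ω | r * t ≤ anorm α (X ω)} := by
        ext ω
        simp only [mem_ofPred_eq]
        rw [anorm_dil hα ht', le_inv_mul_iff₀ ht, mul_comm]
      rw [← hset, ← smul_eq_mul, ← setIntegral_const, ← integral_indicator hE]
      rfl
    have v2 : ∀ q : Fin d × Fin d,
        ∫ ω, (jointTail α ε q).indicator (fun _ => D) (dil α t⁻¹ (X ω)) ∂P
        = P.real {ω | ε * t ≤ |X ω q.1| ^ α q.1 ∧ ε * t ≤ |X ω q.2| ^ α q.2} * D := by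
      intro q
      have hc : ∀ (x : Fin d → ℝ) k, ε ≤ |dil α t⁻¹ x k| ^ α k ↔ ε * t ≤ |x k| ^ α k := by
        intro x k
        have : |dil α t⁻¹ x k| ^ α k = t⁻¹ * |x k| ^ α k := by
          rw [dil, abs_mul, Real.mul_rpow (abs_nonneg _) (abs_nonneg _),
            abs_of_nonneg (Real.rpow_nonneg ht' _), ← Real.rpow_mul ht', one_div,
            inv_mul_cancel₀ (hα k).ne', Real.rpow_one]
        rw [this, le_inv_mul_iff₀ ht, mul_comm]
      have hset : (fun ω => dil α t⁻¹ (X ω)) ⁻¹' jointTail α ε q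
          = {ω | ε * t ≤ |X ω q.1| ^ α q.1 ∧ ε * t ≤ |X ω q.2| ^ α q.2} := by
        ext ω
        exact and_congr (hc _ _) (hc _ _)
      rw [← hset, ← smul_eq_mul, ← setIntegral_const, ← integral_indicator (hJ q)]
      rfl
    rw [e1, abs_mul, abs_of_pos ht]
    have hnorm := norm_integral_le_of_norm_le (μ := P)
      (f := fun ω => f (dil α t⁻¹ (X ω)) - ∑ l, slice s l f (part s l (dil α t⁻¹ (X ω))))
      (j1.add (integrable_finsetSum (crossPairs s) fun q _ => j2 q))
      (Eventually.of_forall fun ω => abs_sub_sum_slice_le (s := s) hα hC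
        (fun x hx => (hf.supp x hx).1) hε0 (min_le_right _ _) hκ0.le hfε (dil α t⁻¹ (X ω)))
    have htail : t * P.real {ω | r * t ≤ anorm α (X ω)} ≤ C₀ / r := by
      rw [le_div_iff₀ hr]
      linarith [hbound.tail (r * t) (by positivity)]
    have e2 : ∫ ω, ((fun ω => {y | r ≤ anorm α y}.indicator (fun _ => κ) (dil α t⁻¹ (X ω)))
        + fun ω => ∑ q ∈ crossPairs s, (jointTail α ε q).indicator (fun _ => D)
          (dil α t⁻¹ (X ω))) ω ∂P = P.real {ω | r * t ≤ anorm α (X ω)} * κ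
        + ∑ q ∈ crossPairs s,
          P.real {ω | ε * t ≤ |X ω q.1| ^ α q.1 ∧ ε * t ≤ |X ω q.2| ^ α q.2} * D := by
      rw [integral_add' j1 (integrable_finsetSum (crossPairs s) fun q _ => j2 q), v1,
        integral_finsetSum _ fun q _ => j2 q]
      congr 1
      exact Finset.sum_congr rfl fun q _ => v2 q
    calc _ ≤ t * (P.real {ω | r * t ≤ anorm α (X ω)} * κ + ∑ q ∈ crossPairs s,
          P.real {ω | ε * t ≤ |X ω q.1| ^ α q.1 ∧ ε * t ≤ |X ω q.2| ^ α q.2} * D) := by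
          refine mul_le_mul_of_nonneg_left ?_ ht.le
          rw [← e2]
          exact hnorm
      _ = κ * (t * P.real {ω | r * t ≤ anorm α (X ω)}) + D * ∑ q ∈ crossPairs s,
          t * P.real {ω | ε * t ≤ |X ω q.1| ^ α q.1 ∧ ε * t ≤ |X ω q.2| ^ α q.2} := by
          rw [mul_add, Finset.mul_sum, Finset.mul_sum]
          congr 1
          · ring
          · exact Finset.sum_congr rfl fun q _ => by ring
      _ ≤ _ := by gcongr
  have hpairs : Tendsto (fun t : ℝ => D * ∑ q ∈ crossPairs s,
      t * P.real {ω | ε * t ≤ |X ω q.1| ^ α q.1 ∧ ε * t ≤ |X ω q.2| ^ α q.2}) atTop (𝓝 0) := by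
    have := (tendsto_finsetSum (crossPairs s) fun q hq =>
      hjoint q.1 q.2 (Finset.mem_filter.1 hq).2 ε hε0).const_mul D
    simpa using this
  filter_upwards [hpairs.eventually_lt_const (show (0 : ℝ) < θ / 2 by positivity),
    eventually_gt_atTop 0] with t h1 ht
  rw [Real.dist_eq, sub_zero]
  have h2 : κ * (C₀ / r) ≤ θ / 4 := by
    calc κ * (C₀ / r) ≤ κ * (C₀ / r + 1) := by gcongr; linarith
      _ = θ / 4 := by rw [hκ]; field_simp
  linarith [hest t ht]

end Global

end DiagonalSRE

end

/-! ### Assembly of the theorem. -/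

theorem mainTheorem1 {Ω : Type*} [MeasurableSpace Ω] (P : Measure Ω) [IsProbabilityMeasure P]
    (d : ℕ) (X A B : Ω → Fin d → ℝ)
    (hX : Measurable X) (hA : Measurable A) (hB : Measurable B)
    -- `X` has the law of `diag(A) X + B`, and `A`, `X` are independent
    (hXAB : IdentDistrib X (fun ω => Matrix.mulVec (Matrix.diagonal (A ω)) (X ω) + B ω) P P)
    (hAX : IndepFun A X P)
    (α : Fin d → ℝ) (hα : ∀ j, 0 < α j)
    -- `log |A_j|` conditioned on `A_j ≠ 0` is non-arithmetic
    (hA0 : ∀ j, ¬ DiagonalSRE.IsArithmetic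
      ((ProbabilityTheory.cond P {ω | A ω j ≠ 0}).map (fun ω => Real.log |A ω j|)))
    (hA1 : ∀ j, Integrable (fun ω => |A ω j| ^ α j) P ∧ ∫ ω, |A ω j| ^ α j ∂P = 1)
    (hA2 : ∀ j, Integrable (fun ω => |A ω j| ^ α j * Real.posLog |A ω j|) P ∧
      ∃ σ : ℝ, 0 < σ ∧ Integrable (fun ω => |B ω j| ^ (α j + σ)) P)
    (s : Setoid (Fin d)) (hs : s = DiagonalSRE.blockSetoid P A α) :
    ∃ (Λ : Measure {x : Fin d → ℝ // x ≠ 0})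
      (Λb : (l : DiagonalSRE.Blocks s) → Measure {x : DiagonalSRE.Coord s l → ℝ // x ≠ 0})
      (c : DiagonalSRE.Blocks s → ℝ)
      (ν' : (l : DiagonalSRE.Blocks s) →
        Measure (DiagonalSRE.asphere (DiagonalSRE.part s l α))),
      -- `Λ` and all `Λ_l` are Radon measures
      Λ.Regular ∧ (∀ l, (Λb l).Regular) ∧
      -- convergence of `t E f(δ_{1/t} X)` to `⟨f, Λ⟩ = ∑_l ⟨f_l, Λ_l⟩`
      (∀ f : (Fin d → ℝ) → ℝ, DiagonalSRE.IsTestFun α f →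
        Integrable (fun x : {x : Fin d → ℝ // x ≠ 0} => f x) Λ ∧
        (∀ l, Integrable (fun x : {x : DiagonalSRE.Coord s l → ℝ // x ≠ 0} =>
          DiagonalSRE.slice s l f x) (Λb l)) ∧
        Tendsto (fun t : ℝ => t * ∫ ω, f (DiagonalSRE.dil α t⁻¹ (X ω)) ∂P) atTop
          (𝓝 (∑ l, ∫ x, DiagonalSRE.slice s l f x.1 ∂(Λb l))) ∧
        ∑ l, ∫ x, DiagonalSRE.slice s l f x.1 ∂(Λb l) = ∫ x, f x.1 ∂Λ) ∧
      -- `c_l = lim t P(|X^{(l)}|_α > t)`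
      (∀ l, Tendsto (fun t : ℝ => t * P.real {ω | t <
          DiagonalSRE.anorm (DiagonalSRE.part s l α) (DiagonalSRE.part s l (X ω))})
        atTop (𝓝 (c l))) ∧
      -- the finite measures on the spheres, their total masses and the polar form of `Λ_l`
      (∀ l, IsFiniteMeasure (ν' l) ∧ (ν' l).real univ = c l ∧
        ∀ f : (Fin d → ℝ) → ℝ, DiagonalSRE.IsTestFun α f →
          ∫ x, DiagonalSRE.slice s l f x.1 ∂(Λb l) =
            ∫ r in Ioi (0 : ℝ), (∫ w, DiagonalSRE.slice s l f
              (DiagonalSRE.dil (DiagonalSRE.part s l α) r w.1) ∂(ν' l)) / r ^ 2) ∧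
      -- `t P(|X|_α > t) → c_∞ = ∑_l c_l`
      Tendsto (fun t : ℝ => t * P.real {ω | t < DiagonalSRE.anorm α (X ω)}) atTop
        (𝓝 (∑ l, c l)) ∧
      -- if `c_∞ > 0`, the weak limit `ν` of the angular laws and its decomposition
      (0 < ∑ l, c l →
        ∃ ν : Measure (DiagonalSRE.asphere α), IsProbabilityMeasure ν ∧
          (∀ φ : BoundedContinuousFunction (DiagonalSRE.asphere α) ℝ,
            Tendsto (fun t : ℝ => ∫ w, φ w ∂(DiagonalSRE.angularLaw P α X t)) atTop
              (𝓝 (∫ w, φ w ∂ν))) ∧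
          ν.map Subtype.val =
            (ENNReal.ofReal (∑ l, c l))⁻¹ • ∑ l, DiagonalSRE.placed s α l (ν' l)) := by
  subst hs
  have hmul : ∀ ω, Matrix.mulVec (Matrix.diagonal (A ω)) (X ω) = fun i => A ω i * X ω i :=
    fun ω => funext fun i => Matrix.mulVec_diagonal _ _ _
  have h : DiagonalSRE.IsDiagonalSRE P α X A B :=
    { pos := hα
      measX := hX
      measA := hA
      measB := hB
      law := by simpa only [hmul] using hXAB.map_eq
      indep := hAX
      nonarith := hA0
      integrable := fun j => (hA1 j).1
      mean := fun j => (hA1 j).2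
      integrable_log := fun j => (hA2 j).1
      moment := fun j => (hA2 j).2 }
  set s := DiagonalSRE.blockSetoid P A α with hs
  have hex : ∀ l : DiagonalSRE.Blocks s, ∃ C₀ Λ, DiagonalSRE.IsTailMeasure P
      (DiagonalSRE.part s l α) (fun ω => DiagonalSRE.part s l (X ω)) C₀ Λ := by
    intro l
    -- A representative j of the class provides the common multiplier R = |A_j|^{α_j}.
    obtain ⟨j, rfl⟩ := Quotient.exists_rep l
    exact (h.isBlockSRE (fun i : DiagonalSRE.Coord s (DiagonalSRE.Blocks.of s j) => i.1) j
      fun i => Quotient.exact i.2).exists_isTailMeasure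
  choose Cb Λb hb using hex
  have hΛ := DiagonalSRE.isTailMeasure_blockSum hα hX hb fun i j hij δ hδ =>
    h.tendsto_joint_tail (fun hae => hij (Quotient.sound hae)) hδ
  have hfin : ∀ l, IsFiniteMeasure (DiagonalSRE.angular (DiagonalSRE.part_pos hα l) (Λb l)) :=
    fun l => (hb l).isFiniteMeasure_angular
  have hfinΛ : IsFiniteMeasure (DiagonalSRE.angular hα (DiagonalSRE.blockSum s Λb)) :=
    hΛ.isFiniteMeasure_angular
  have hinteg : ∀ f, DiagonalSRE.IsTestFun α f → ∀ l,
      Integrable (fun x : {x : DiagonalSRE.Coord s l → ℝ // x ≠ 0} =>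
        DiagonalSRE.slice s l f x.1) (Λb l) :=
    fun f hf l => (hb l).integrable (hf.slice hα l)
  have hmass : (DiagonalSRE.angular hα (DiagonalSRE.blockSum s Λb)).real univ
      = ∑ l, (DiagonalSRE.angular (DiagonalSRE.part_pos hα l) (Λb l)).real univ :=
    DiagonalSRE.angular_blockSum_real_univ hα Λb
  refine ⟨DiagonalSRE.blockSum s Λb, Λb,
    fun l => (DiagonalSRE.angular (DiagonalSRE.part_pos hα l) (Λb l)).real univ,
    fun l => DiagonalSRE.angular (DiagonalSRE.part_pos hα l) (Λb l),
    hΛ.regular, fun l => (hb l).regular, fun f hf => ?_, fun l => (hb l).tendsto_tail,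
    fun l => ⟨hfin l, rfl, fun f hf => ?_⟩, ?_, fun hpos => ?_⟩
  · have e := DiagonalSRE.integral_blockSum Λb hf.continuous (hinteg f hf)
    refine ⟨hΛ.integrable hf, hinteg f hf, ?_, e.symm⟩
    rw [← e]
    exact hΛ.tendsto_tmean hf
  · exact (hb l).integral_polar (hf.slice hα l).continuous.measurable (hinteg f hf l)
  · rw [← hmass]
    exact hΛ.tendsto_tail
  · rw [← hmass] at hpos ⊢
    -- The limit law is the angular part of the glued measure divided by its mass c_∞; its
    -- decomposition is that of the angular part over the blocks.
    refine ⟨(ENNReal.ofReal ((DiagonalSRE.angular hα (DiagonalSRE.blockSum s Λb)).real univ))⁻¹ •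
      DiagonalSRE.angular hα (DiagonalSRE.blockSum s Λb), ⟨?_⟩, fun φ => ?_, ?_⟩
    · rw [Measure.smul_apply, smul_eq_mul, ofReal_measureReal]
      refine ENNReal.inv_mul_cancel (fun h0 => ?_) (measure_ne_top _ _)
      rw [measureReal_def, h0] at hpos
      exact lt_irrefl _ hpos
    · rw [integral_smul_measure, ENNReal.toReal_inv, ENNReal.toReal_ofReal hpos.le]
      exact hΛ.tendsto_angularLaw hpos φ
    · rw [Measure.map_smul, DiagonalSRE.map_val_angular_blockSum hα Λb hfin]
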